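/- **Setting.** Let $G$ be a compact quantum group algebra (a cosemisimple Hopf $*$-algebra over $\mathbb C$ whose Haar functional $\mathbf h$ satisfies $\mathbf h(aa^*)>0$ for $a\neq 0$), $H$ a cosemisimple Hopf $*$-algebra, $\pi:G\to H$ a surjective Hopf $*$-algebra map, and $M=G^{H}=\{g\in G:(\mathrm{id}\otimes\pi)\Delta(g)=g\otimes 1\}$ the corresponding quantum homogeneous space; write $\varepsilon$ for the counit and $M^+=M\cap\ker\varepsilon$. Let $(\Omega^\bullet,\mathrm d)$ be a covariant differential $*$-calculus over $M$ of total dimension $2n$ (that is, $\Omega^k=0$ for $k>2n$ and $\Omega^{2n}\ne0$), with $\Omega^\bullet M^+\subseteq M^+\Omega^\bullet$ and $\Phi(\Omega^\bullet):=\Omega^\bullet/M^+\Omega^\bullet$ finite-dimensional. Let $(\Omega^{(\bullet,\bullet)},\kappa)$ be a covariant Kähler structure: $\Omega^{(\bullet,\bullet)}$ is a complex structure (an $\mathbb N_0^2$-algebra grading with $\Omega^k=\bigoplus_{a+b=k}\Omega^{(a,b)}$, $(\Omega^{(a,b)})^*=\Omega^{(b,a)}$ and $\mathrm d=\partial+\overline\partial$,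 where $\partial,\overline\partial$ are the components of $\mathrm d$ of bidegree $(1,0)$ and $(0,1)$) with each $\Omega^{(a,b)}$ a left $G$-subcomodule, and $\kappa\in\Omega^{(1,1)}$ is a left $G$-coinvariant, central, real, $\mathrm d$-closed form such that, with $L(\omega):=\kappa\wedge\omega$, the maps $L^{n-k}:\Omega^k\to\Omega^{2n-k}$ are isomorphisms for all $0\le k<n$. Let $P^k=\{\alpha\in\Omega^k: L^{n-k+1}\alpha=0\}$ for $k\le n$, and $P^{(a,b)}=P^{a+b}\cap\Omega^{(a,b)}$ for $a+b\le n$. For a Hodge parameter $h>0$ let $*_h$ be the Hodge map, the linear map determined by $$*_h(L^j\alpha)=(-1)^{\frac{k(k+1)}2}\,i^{a-b}\,\frac{[j]_h!}{[n-j-k]_h!}\,L^{n-j-k}\alpha,\qquad \alpha\in P^{(a,b)},\ k=a+b,\ 0\le j\le n-k,$$ with $[m]_h=h^{m-1}+h^{m-3}+\dots+h^{-m+1}$ and $[m]_h!=[1]_h\cdots[m]_h$. Let $\mathrm{vol}=*_h|_{\Omega^{2n}}:\Omega^{2n}\to M$, let $\int\omega=\mathbf h(\mathrm{vol}(\omega))$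 for $\omega\in\Omega^{2n}$, and let $g$ be the metric with $g(\omega,\nu)=\mathrm{vol}(\omega\wedge *_h(\nu^*))$ for $\omega,\nu\in\Omega^k$ and $g(\Omega^k,\Omega^l)=0$ for $k\neq l$. Assume that the structure is positive definite, i.e. $([\omega],[\nu])\mapsto\varepsilon(g(\omega,\nu))$ is an inner product on $\Phi(\Omega^\bullet)$, and that the integral is closed, i.e. $\int\mathrm d\omega=0$ for all $\omega\in\Omega^{2n-1}$. **Notation.** For $\delta\in\{\mathrm d,\partial,\overline\partial\}$ let $H^k_\delta=\ker(\delta:\Omega^k\to\Omega^{k+1})/\delta(\Omega^{k-1})$, let $H^{(a,b)}_\delta\subseteq H^{a+b}_\delta$ be the subspace of classes represented by $\delta$-closed forms in $\Omega^{(a,b)}$ (for $\delta=\partial,\overline\partial$ these are the Dolbeault cohomology groups), and let $L^j:H^k_\delta\to H^{k+2j}_\delta$ be the well-defined map $[\omega]\mapsto[\kappa^j\wedge\omega]$. Let $H^{(a,b)}_{\delta,\mathrm{prim}}=\ker\big(L^{n-(a+b)+1}|_{H^{(a,b)}_\delta}\big)$ if $a+b\le n$, and $H^{(a,b)}_{\delta,\mathrm{prim}}=0$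 if $a+b>n$. **Theorem (Hard Lefschetz).** For every $\delta\in\{\mathrm d,\partial,\overline\partial\}$: 1. $L^k:H^{n-k}_\delta\to H^{n+k}_\delta$ is an isomorphism for all $k=0,\dots,n$; 2. for every $k\ge 0$, there is an (internal) direct sum decomposition $$H^k_\delta=\bigoplus_{i\ge0}\ \bigoplus_{a+b=k-2i}L^i\,H^{(a,b)}_{\delta,\mathrm{prim}}.$$ Moreover, for every $k$ and $\delta\in\{\mathrm d,\partial,\overline\partial\}$ there is a linear isomorphism $H^k_{\mathrm d}\cong H^k_\delta$ which maps $[\omega]_{\mathrm d}$ to $[\omega]_\delta$ for every $\mathrm d$-closed $\omega\in\Omega^{(a,b)}$, $a+b=k$, so that the decomposition in 2 describes de Rham cohomology also when $H^{(a,b)}$ is read as a Dolbeault group. -/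

import Mathlib

open scoped TensorProduct DirectSum

set_option linter.unusedSectionVars false

noncomputable section

namespace QKahler

/-! ### Hopf `*`-algebras, Haar functionals, quantum homogeneous spaces -/

/-- A Hopf `*`-algebra over `ℂ`: a Hopf algebra which is a `*`-algebra and whose comultiplication
is a `*`-map, the tensor product carrying the involution `(a ⊗ b)* = a* ⊗ b*`. -/
class HopfStarAlgebra (G : Type*) [Ring G] [StarRing G] [HopfAlgebra ℂ G] [StarModule ℂ G] :
    Prop where
  comul_star : ∀ a : G, Coalgebra.comul (R := ℂ) (star a) = star (Coalgebra.comul (R := ℂ) a)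

/-- `h(1) = 1`, `(id ⊗ h) Δ(g) = h(g) 1` and `(h ⊗ id) Δ(g) = h(g) 1`. -/
def IsHaarFunctional {G : Type*} [Ring G] [HopfAlgebra ℂ G] (h : G →ₗ[ℂ] ℂ) : Prop :=
  h 1 = 1 ∧
  (∀ g : G, TensorProduct.rid ℂ G (h.lTensor G (Coalgebra.comul (R := ℂ) g)) = h g • (1 : G)) ∧
  (∀ g : G, TensorProduct.lid ℂ G (h.rTensor G (Coalgebra.comul (R := ℂ) g)) = h g • (1 : G))

/-- A Hopf algebra is cosemisimple if it admits a unique Haar functional. -/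
class Cosemisimple (G : Type*) [Ring G] [HopfAlgebra ℂ G] : Prop where
  existsUnique_haar : ∃! h : G →ₗ[ℂ] ℂ, IsHaarFunctional h

/-- The Haar functional of a cosemisimple Hopf algebra. -/
def haar (G : Type*) [Ring G] [HopfAlgebra ℂ G] [Cosemisimple G] : G →ₗ[ℂ] ℂ :=
  (Cosemisimple.existsUnique_haar (G := G)).choose

/-- A compact quantum group algebra: a cosemisimple Hopf `*`-algebra with `h(a a*) > 0` for all
`a ≠ 0`. -/
class CompactQuantumGroupAlgebra (G : Type*) [Ring G] [StarRing G] [HopfAlgebra ℂ G]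
    [StarModule ℂ G] : Prop extends HopfStarAlgebra G, Cosemisimple G where
  haar_pos : ∀ a : G, a ≠ 0 → 0 < (haar G (a * star a)).re ∧ (haar G (a * star a)).im = 0

section Homogeneous

variable (G H : Type*) [Ring G] [StarRing G] [HopfAlgebra ℂ G] [StarModule ℂ G]
  [HopfStarAlgebra G] [Ring H] [StarRing H] [HopfAlgebra ℂ H] [StarModule ℂ H]
  [HopfStarAlgebra H]

/-- The data of a quantum homogeneous space: a surjective Hopf `*`-algebra map `π : G → H`
(a bialgebra map between Hopf algebras respects the antipodes). -/
structure QuantumHomogeneousSpace where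
  proj : G →ₐc[ℂ] H
  proj_surjective : Function.Surjective proj
  proj_star : ∀ g : G, proj (star g) = star (proj g)

variable {G H}

namespace QuantumHomogeneousSpace

variable (X : QuantumHomogeneousSpace G H)

/-- The homogeneous right coaction `(id ⊗ π) Δ : G → G ⊗ H`. -/
def rightCoaction : G →ₐ[ℂ] G ⊗[ℂ] H :=
  (Algebra.TensorProduct.map (AlgHom.id ℂ G) (X.proj : G →ₐ[ℂ] H)).comp
    (Bialgebra.comulAlgHom ℂ G)

theorem star_map_tmul (t : G ⊗[ℂ] G) :
    Algebra.TensorProduct.map (AlgHom.id ℂ G) (X.proj : G →ₐ[ℂ] H) (star t) =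
      star (Algebra.TensorProduct.map (AlgHom.id ℂ G) (X.proj : G →ₐ[ℂ] H) t) := by
  induction t using TensorProduct.induction_on with
  | zero => simp
  | tmul x y =>
    simp [TensorProduct.star_tmul, X.proj_star]
  | add x y hx hy => rw [star_add, map_add, hx, hy, map_add, star_add]

theorem rightCoaction_star (g : G) : X.rightCoaction (star g) = star (X.rightCoaction g) := by
  simp only [rightCoaction, AlgHom.comp_apply, Bialgebra.comulAlgHom_apply,
    HopfStarAlgebra.comul_star, star_map_tmul]

/-- The quantum homogeneous space `M = G^H = {g | (id ⊗ π) Δ(g) = g ⊗ 1}`, a `*`-subalgebra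
of `G`. -/
def M : StarSubalgebra ℂ G where
  toSubalgebra := AlgHom.equalizer X.rightCoaction Algebra.TensorProduct.includeLeft
  star_mem' {g} hg := by
    have hg' : X.rightCoaction g = g ⊗ₜ[ℂ] (1 : H) := hg
    change X.rightCoaction (star g) = star g ⊗ₜ[ℂ] (1 : H)
    rw [rightCoaction_star, hg', TensorProduct.star_tmul, star_one]

/-- The restriction of the counit of `G` to `M`; its kernel is `M⁺`. -/
def counit : X.M →ₗ[ℂ] ℂ := (Coalgebra.counit (R := ℂ) (A := G)).comp X.M.subtype.toLinearMap

end QuantumHomogeneousSpace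

end Homogeneous

/-! ### Differential calculi -/

section Calculus

variable (A : Type*) [Ring A] [Algebra ℂ A] (Ω : Type*) [Ring Ω] [Algebra ℂ Ω]

/-- A differential calculus over `A`: an `ℕ`-graded algebra `Ω = ⨁ Ω^k` with `Ω^0 = A` (through
`incl`), and a square-zero degree one graded derivation `d`, such that `Ω^k` is spanned by the
forms `a₀ da₁ ∧ ⋯ ∧ daₖ`. -/
structure DifferentialCalculus where
  deg : ℕ → Submodule ℂ Ω
  grading : GradedAlgebra deg
  incl : A →ₐ[ℂ] Ω
  incl_injective : Function.Injective incl
  range_incl : LinearMap.range incl.toLinearMap = deg 0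
  d : Ω →ₗ[ℂ] Ω
  d_mem : ∀ k, ∀ ω ∈ deg k, d ω ∈ deg (k + 1)
  d_d : ∀ ω, d (d ω) = 0
  leibniz : ∀ k, ∀ ω ∈ deg k, ∀ ν, d (ω * ν) = d ω * ν + (-1 : ℂ) ^ k • (ω * d ν)
  deg_eq_span : ∀ k, deg k = Submodule.span ℂ
    {ω | ∃ (a₀ : A) (a : Fin k → A), ω = incl a₀ * (List.ofFn fun i => d (incl (a i))).prod}

attribute [instance] DifferentialCalculus.grading

/-- A differential `*`-calculus over a `*`-algebra. -/
structure StarCalculus [StarRing A] extends DifferentialCalculus A Ω where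
  conj : Ω →ₛₗ[starRingEnd ℂ] Ω
  conj_conj : ∀ ω, conj (conj ω) = ω
  conj_incl : ∀ a : A, conj (incl a) = incl (star a)
  d_conj : ∀ ω, d (conj ω) = conj (d ω)
  conj_mul : ∀ k l, ∀ ω ∈ deg k, ∀ ν ∈ deg l,
    conj (ω * ν) = (-1 : ℂ) ^ (k * l) • (conj ν * conj ω)

variable {A Ω}

namespace DifferentialCalculus

variable (C : DifferentialCalculus A Ω)

/-- The calculus has total dimension `N`. -/
def HasTotalDimension (N : ℕ) : Prop := (∀ k, N < k → C.deg k = ⊥) ∧ C.deg N ≠ ⊥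

/-- The inverse `Ω^0 → A` of the identification `A = Ω^0`. -/
def zeroEquiv : C.deg 0 ≃ₗ[ℂ] A :=
  ((LinearEquiv.ofInjective C.incl.toLinearMap C.incl_injective).trans
    (LinearEquiv.ofEq _ _ C.range_incl)).symm

/-- The projection of `Ω` onto `Ω^0 = A`. -/
def toZero : Ω →ₗ[ℂ] A :=
  C.zeroEquiv.toLinearMap ∘ₗ DirectSum.component ℂ ℕ (fun k => C.deg k) 0 ∘ₗ
    (DirectSum.decomposeLinearEquiv C.deg).toLinearMap

/-- The space of `δ`-closed `k`-forms. -/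
def cocycles (δ : Ω →ₗ[ℂ] Ω) (k : ℕ) : Submodule ℂ Ω := C.deg k ⊓ LinearMap.ker δ

/-- The image of `δ : Ω^(k-1) → Ω^k`, where `Ω^(-1) = 0`. -/
def coboundaries (δ : Ω →ₗ[ℂ] Ω) : ℕ → Submodule ℂ Ω
  | 0 => ⊥
  | k + 1 => (C.deg k).map δ

/-- The cohomology group `H^k_δ = ker(δ : Ω^k → Ω^(k+1)) / im(δ : Ω^(k-1) → Ω^k)`. -/
abbrev Cohomology (δ : Ω →ₗ[ℂ] Ω) (k : ℕ) : Type _ :=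
  C.cocycles δ k ⧸ (C.coboundaries δ k).comap (C.cocycles δ k).subtype

end DifferentialCalculus

/-! ### Complex and Hermitian structures -/

section Complex

variable [StarRing A]

/-- An almost complex structure: an `ℕ²`-algebra grading of `Ω` with
`Ω^k = ⨁_{a+b=k} Ω^(a,b)` and `(Ω^(a,b))* = Ω^(b,a)`. -/
structure AlmostComplexStructure (C : StarCalculus A Ω) where
  bideg : ℕ × ℕ → Submodule ℂ Ω
  bigrading : GradedAlgebra bideg
  deg_eq : ∀ k, C.deg k = ⨆ p ∈ Finset.HasAntidiagonal.antidiagonal k, bideg p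
  conj_bideg : ∀ a b, C.conj '' (bideg (a, b) : Set Ω) = bideg (b, a)

attribute [instance] AlmostComplexStructure.bigrading

namespace AlmostComplexStructure

variable {C : StarCalculus A Ω} (J : AlmostComplexStructure C)

/-- The operator which is `proj_{Ω^(p+v)} ∘ d` on `Ω^p`. -/
def component (v : ℕ × ℕ) : Ω →ₗ[ℂ] Ω :=
  DirectSum.toModule ℂ (ℕ × ℕ) Ω
      (fun p => GradedAlgebra.proj J.bideg (p + v) ∘ₗ C.d ∘ₗ (J.bideg p).subtype) ∘ₗ
    (DirectSum.decomposeLinearEquiv J.bideg).toLinearMap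

/-- `∂`. -/
def del : Ω →ₗ[ℂ] Ω := J.component (1, 0)

/-- `∂̄`. -/
def delbar : Ω →ₗ[ℂ] Ω := J.component (0, 1)

end AlmostComplexStructure

/-- A complex structure: an integrable almost complex structure. -/
structure ComplexStructure (C : StarCalculus A Ω) extends AlmostComplexStructure C where
  integrable : C.d = toAlmostComplexStructure.del + toAlmostComplexStructure.delbar

/-- An Hermitian structure on a calculus of total dimension `2n`: a complex structure together
with an almost symplectic form (a central real 2-form satisfying the Lefschetz isomorphism
condition) of bidegree `(1,1)`. -/
structure HermitianStructure (C : StarCalculus A Ω) (n : ℕ) extends ComplexStructure C where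
  totalDimension : C.HasTotalDimension (2 * n)
  form : Ω
  form_mem : form ∈ bideg (1, 1)
  form_central : ∀ ω, form * ω = ω * form
  form_real : C.conj form = form
  lefschetz_iso : ∀ k, k < n →
    Set.BijOn (fun ω => (LinearMap.mulLeft ℂ form ^ (n - k)) ω) (C.deg k) (C.deg (2 * n - k))

end Complex

end Calculus

/-! ### Lefschetz decomposition and Hodge maps -/

/-- The quantum integer `[m]_h = h^(m-1) + h^(m-3) + ⋯ + h^(-m+1)`. -/
def qInt (h : ℝ) (m : ℕ) : ℝ := ∑ i ∈ Finset.range m, h ^ ((m : ℤ) - 1 - 2 * i)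

/-- The quantum factorial `[m]_h!`. -/
def qFactorial (h : ℝ) (m : ℕ) : ℝ := ∏ i ∈ Finset.range m, qInt h (i + 1)

namespace HermitianStructure

section General

variable {A : Type*} [Ring A] [Algebra ℂ A] [StarRing A] {Ω : Type*} [Ring Ω] [Algebra ℂ Ω]
  {C : StarCalculus A Ω} {n : ℕ} (K : HermitianStructure C n)

/-- The Lefschetz operator `L(ω) = κ ∧ ω`. -/
def L : Ω →ₗ[ℂ] Ω := LinearMap.mulLeft ℂ K.form

/-- The primitive `k`-forms: `{α ∈ Ω^k | L^(n-k+1)(α) = 0}` if `k ≤ n`, and `0` if `k > n`. -/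
def primitive (k : ℕ) : Submodule ℂ Ω :=
  if k ≤ n then C.deg k ⊓ LinearMap.ker (K.L ^ (n - k + 1)) else ⊥

/-- The primitive `(a,b)`-forms. -/
def primitiveBi (p : ℕ × ℕ) : Submodule ℂ Ω := K.bideg p ⊓ K.primitive (p.1 + p.2)

/-- Indices `(j, (a, b))` with `j + a + b ≤ n`. -/
abbrev LefschetzIndex (n : ℕ) : Type := {t : ℕ × ℕ × ℕ // t.1 + (t.2.1 + t.2.2) ≤ n}

/-- The map `(α_(j,a,b)) ↦ ∑ L^j(α_(j,a,b))` on families of primitive `(a,b)`-forms. -/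
def assemble : (⨁ t : LefschetzIndex n, K.primitiveBi t.1.2) →ₗ[ℂ] Ω :=
  DirectSum.toModule ℂ (LefschetzIndex n) Ω
    (fun t => (K.L ^ t.1.1) ∘ₗ (K.primitiveBi t.1.2).subtype)

/-- The coefficient `(-1)^(k(k+1)/2) i^(a-b) [j]_h! / [n-j-k]_h!`, with `k = a + b`, in the
definition of the Hodge map. -/
def hodgeCoeff (n : ℕ) (h : ℝ) (j a b : ℕ) : ℂ :=
  (-1) ^ ((a + b) * (a + b + 1) / 2) * Complex.I ^ ((a : ℤ) - (b : ℤ)) *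
    ((qFactorial h j / qFactorial h (n - j - (a + b)) : ℝ) : ℂ)

/-- The map `(α_(j,a,b)) ↦ ∑ c_(j,a,b) L^(n-j-a-b)(α_(j,a,b))`. -/
def assembleHodge (h : ℝ) : (⨁ t : LefschetzIndex n, K.primitiveBi t.1.2) →ₗ[ℂ] Ω :=
  DirectSum.toModule ℂ (LefschetzIndex n) Ω
    (fun t => hodgeCoeff n h t.1.1 t.1.2.1 t.1.2.2 •
      ((K.L ^ (n - t.1.1 - (t.1.2.1 + t.1.2.2))) ∘ₗ (K.primitiveBi t.1.2).subtype))

theorem bideg_le_deg (p : ℕ × ℕ) : K.bideg p ≤ C.deg (p.1 + p.2) := by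
  rw [K.deg_eq]
  exact le_iSup₂_of_le p (by simp) le_rfl

theorem form_mem_deg : K.form ∈ C.deg 2 := K.bideg_le_deg (1, 1) K.form_mem

theorem L_pow_mem_deg (j : ℕ) : ∀ {k : ℕ} {ω : Ω}, ω ∈ C.deg k →
    (K.L ^ j) ω ∈ C.deg (k + 2 * j) := by
  induction j with
  | zero => intro k ω h; simpa using h
  | succ j ih =>
    intro k ω h
    rw [pow_succ', Module.End.mul_apply]
    have := SetLike.mul_mem_graded K.form_mem_deg (ih h)
    rw [show k + 2 * (j + 1) = 2 + (k + 2 * j) by ring]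
    exact this

theorem L_pow_mem_bideg (j : ℕ) : ∀ {p : ℕ × ℕ} {ω : Ω}, ω ∈ K.bideg p →
    (K.L ^ j) ω ∈ K.bideg (p + (j, j)) := by
  induction j with
  | zero => intro p ω h; simpa [← Prod.zero_eq_mk] using h
  | succ j ih =>
    intro p ω h
    rw [pow_succ', Module.End.mul_apply]
    have := SetLike.mul_mem_graded K.form_mem (ih h)
    rw [show p + (j + 1, j + 1) = (1, 1) + (p + (j, j)) by ext <;> simp <;> ring]
    exact this

theorem proj_L_pow (j : ℕ) (p : ℕ × ℕ) (ω : Ω) :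
    GradedAlgebra.proj K.bideg (p + (j, j)) ((K.L ^ j) ω) =
      (K.L ^ j) (GradedAlgebra.proj K.bideg p ω) := by
  induction ω using DirectSum.Decomposition.inductionOn K.bideg with
  | zero => simp
  | @homogeneous q m =>
    rw [GradedAlgebra.proj_apply, GradedAlgebra.proj_apply]
    by_cases hq : q = p
    · subst hq
      rw [DirectSum.decompose_of_mem_same _ (K.L_pow_mem_bideg j m.2),
        DirectSum.decompose_of_mem_same _ m.2]
    · rw [DirectSum.decompose_of_mem_ne _ (K.L_pow_mem_bideg j m.2) (by simpa using hq),
        DirectSum.decompose_of_mem_ne _ m.2 hq, map_zero]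
  | add x y hx hy => simp only [map_add, hx, hy]

theorem proj_eq_zero {k : ℕ} {p : ℕ × ℕ} (hp : p.1 + p.2 ≠ k) {ω : Ω} (hω : ω ∈ C.deg k) :
    GradedAlgebra.proj K.bideg p ω = 0 := by
  have hle : C.deg k ≤ LinearMap.ker (GradedAlgebra.proj K.bideg p) := by
    rw [K.deg_eq]
    refine iSup₂_le fun q hq ω hω => ?_
    rw [LinearMap.mem_ker, GradedAlgebra.proj_apply]
    refine DirectSum.decompose_of_mem_ne _ hω ?_
    rintro rfl
    exact hp (Finset.HasAntidiagonal.mem_antidiagonal.1 hq)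
  exact hle hω

theorem L_pow_bijOn {k : ℕ} (hk : k ≤ n) :
    Set.BijOn (fun ω => (K.L ^ (n - k)) ω) (C.deg k) (C.deg (2 * n - k)) := by
  rcases hk.lt_or_eq with h | rfl
  · exact K.lefschetz_iso k h
  · have : 2 * k - k = k := by omega
    simpa [this, Function.id_def] using Set.bijOn_id (C.deg k : Set Ω)

theorem mem_primitiveBi {a b : ℕ} (h : a + b ≤ n) {α : Ω} :
    α ∈ K.primitiveBi (a, b) ↔ α ∈ K.bideg (a, b) ∧ (K.L ^ (n - (a + b) + 1)) α = 0 := by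
  simp only [primitiveBi, primitive, h, if_true, Submodule.mem_inf, LinearMap.mem_ker]
  constructor
  · rintro ⟨h1, _, h3⟩; exact ⟨h1, h3⟩
  · rintro ⟨h1, h3⟩; exact ⟨h1, K.bideg_le_deg (a, b) h1, h3⟩

theorem L_pow_eq_zero_of_le {i j : ℕ} (hij : i ≤ j) {ω : Ω} (h : (K.L ^ i) ω = 0) :
    (K.L ^ j) ω = 0 := by
  obtain ⟨m, rfl⟩ := Nat.exists_eq_add_of_le' hij
  rw [pow_add, Module.End.mul_apply, h, map_zero]

theorem assemble_of (t : LefschetzIndex n) (α : K.primitiveBi t.1.2) :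
    K.assemble (DirectSum.lof ℂ _ (fun t : LefschetzIndex n => K.primitiveBi t.1.2) t α) =
      (K.L ^ t.1.1) α := by
  simp [assemble, DirectSum.toModule_lof]

theorem assemble_injective : Function.Injective K.assemble := by
  classical
  rw [injective_iff_map_eq_zero]
  intro f hf
  by_contra hne
  have hsupp : (DFinsupp.support f).Nonempty := by
    rw [Finset.nonempty_iff_ne_empty]
    simpa using hne
  obtain ⟨t₀, ht₀, hmax⟩ := Finset.exists_max_image (DFinsupp.support f) (fun t => t.1.1) hsupp
  have ht₀' : f t₀ ≠ 0 := by simpa using ht₀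
  obtain ⟨⟨J, a₀, b₀⟩, hle⟩ := t₀
  simp only at hle hmax
  set t₀ : LefschetzIndex n := ⟨(J, a₀, b₀), hle⟩ with ht₀def
  set N := n - (a₀ + b₀) - J with hN
  have hsum : K.assemble f = ∑ t ∈ DFinsupp.support f, (K.L ^ t.1.1) (f t : Ω) := by
    conv_lhs => rw [← DirectSum.sum_support_of f, map_sum]
    exact Finset.sum_congr rfl fun t _ => K.assemble_of t (f t)
  have key : GradedAlgebra.proj K.bideg ((a₀, b₀) + (N + J, N + J)) ((K.L ^ N) (K.assemble f)) =
      (K.L ^ (N + J)) (f t₀ : Ω) := by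
    rw [hsum, map_sum, map_sum, Finset.sum_eq_single t₀]
    · rw [← Module.End.mul_apply (K.L ^ N), ← pow_add, GradedAlgebra.proj_apply]
      exact DirectSum.decompose_of_mem_same _ (K.L_pow_mem_bideg _ (f t₀).2.1)
    · intro t ht hne
      have hJ := hmax t ht
      obtain ⟨⟨j, a, b⟩, hjab⟩ := t
      simp only at hJ hjab
      rw [← Module.End.mul_apply (K.L ^ N), ← pow_add]
      have hmem := (f ⟨(j, a, b), hjab⟩).2
      by_cases hq : ((a, b) : ℕ × ℕ) + (N + j, N + j) = (a₀, b₀) + (N + J, N + J)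
      · simp only [Prod.mk_add_mk, Prod.mk.injEq] at hq
        have hlt : j < J := by
          rcases hJ.lt_or_eq with h | h
          · exact h
          · exfalso
            apply hne
            rw [ht₀def, Subtype.mk.injEq, Prod.mk.injEq, Prod.mk.injEq]
            omega
        have h0 := ((K.mem_primitiveBi (by omega)).1 hmem).2
        rw [K.L_pow_eq_zero_of_le (i := n - (a + b) + 1) (by simp only; omega) h0, map_zero]
      · rw [GradedAlgebra.proj_apply]
        exact DirectSum.decompose_of_mem_ne _ (K.L_pow_mem_bideg _ hmem.1) hq
    · intro h; exact absurd ht₀ h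
  rw [hf, map_zero, map_zero] at key
  have hNJ : N + J = n - (a₀ + b₀) := by omega
  rw [hNJ] at key
  apply ht₀'
  apply Subtype.ext
  refine (K.L_pow_bijOn (k := a₀ + b₀) (by omega)).injOn
    (K.bideg_le_deg _ (f t₀).2.1) (Submodule.zero_mem _) ?_
  simp [← key]

theorem primitive_mem_range {k N : ℕ} (hkN : k + N ≤ n) {α : Ω} (hα : α ∈ C.deg k)
    (h0 : (K.L ^ (n - k + 1)) α = 0) : (K.L ^ N) α ∈ LinearMap.range K.assemble := by
  classical
  rw [← DirectSum.sum_support_decompose K.bideg α, map_sum]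
  refine Submodule.sum_mem _ fun p _ => ?_
  change (K.L ^ N) (GradedAlgebra.proj K.bideg p α) ∈ _
  by_cases hp : p.1 + p.2 = k
  · have hmem : GradedAlgebra.proj K.bideg p α ∈ K.primitiveBi p := by
      refine (K.mem_primitiveBi (a := p.1) (b := p.2) (by omega)).2 ⟨?_, ?_⟩
      · rw [GradedAlgebra.proj_apply]; exact Subtype.mem _
      · rw [hp, ← K.proj_L_pow, h0, map_zero]
    exact ⟨_, K.assemble_of ⟨(N, p), by simp only; omega⟩ ⟨_, hmem⟩⟩
  · rw [K.proj_eq_zero hp hα, map_zero]; exact Submodule.zero_mem _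

theorem L_pow_mem_range (k : ℕ) : ∀ N, k + N ≤ n → ∀ ω ∈ C.deg k,
    (K.L ^ N) ω ∈ LinearMap.range K.assemble := by
  induction k using Nat.strong_induction_on with
  | _ k ih =>
    intro N hN ω hω
    have hmem := K.L_pow_mem_deg (n - k + 1) hω
    rcases lt_or_ge k 2 with hk | hk
    · rw [K.totalDimension.1 _ (by omega), Submodule.mem_bot] at hmem
      exact K.primitive_mem_range hN hω hmem
    · rw [show k + 2 * (n - k + 1) = 2 * n - (k - 2) by omega] at hmem
      obtain ⟨z, hz, hzω⟩ := (K.L_pow_bijOn (k := k - 2) (by omega)).surjOn hmem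
      simp only at hzω
      have hLz : K.L z ∈ C.deg k := by
        have := K.L_pow_mem_deg 1 hz
        rwa [pow_one, show k - 2 + 2 * 1 = k by omega] at this
      have h1 : (K.L ^ (n - k + 1)) (ω - K.L z) = 0 := by
        rw [map_sub, ← hzω, show n - (k - 2) = n - k + 1 + 1 by omega, pow_succ _ (n - k + 1),
          Module.End.mul_apply, sub_self]
      have h2 := K.primitive_mem_range hN (Submodule.sub_mem _ hω hLz) h1
      have h3 := ih (k - 2) (by omega) (N + 1) (by omega) z hz
      rw [pow_succ, Module.End.mul_apply] at h3
      have := Submodule.add_mem _ h2 h3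
      rwa [← map_add, sub_add_cancel] at this

theorem assemble_surjective : Function.Surjective K.assemble := by
  rw [← LinearMap.range_eq_top, eq_top_iff]
  intro ω _
  classical
  rw [← DirectSum.sum_support_decompose C.deg ω]
  refine Submodule.sum_mem _ fun k _ => ?_
  have hmem : (DirectSum.decompose C.deg ω k : Ω) ∈ C.deg k := Subtype.mem _
  generalize (DirectSum.decompose C.deg ω k : Ω) = x at hmem
  rcases le_or_gt k n with hk | hk
  · simpa using K.L_pow_mem_range k 0 (by omega) x hmem
  · rcases le_or_gt k (2 * n) with hk2 | hk2
    · rw [show k = 2 * n - (2 * n - k) by omega] at hmem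
      obtain ⟨z, hz, rfl⟩ := (K.L_pow_bijOn (k := 2 * n - k) (by omega)).surjOn hmem
      exact K.L_pow_mem_range _ _ (by omega) z hz
    · rw [K.totalDimension.1 _ hk2, Submodule.mem_bot] at hmem
      rw [hmem]; exact Submodule.zero_mem _

/-- The Lefschetz decomposition `Ω ≅ ⨁_{j+a+b ≤ n} L^j(P^(a,b))`, where each `L^j` is injective
on `P^(a,b)`. -/
def lefschetzDecomposition : (⨁ t : LefschetzIndex n, K.primitiveBi t.1.2) ≃ₗ[ℂ] Ω :=
  LinearEquiv.ofBijective K.assemble ⟨K.assemble_injective, K.assemble_surjective⟩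

/-- The `h`-Hodge map `*_h`. -/
def hodge (h : ℝ) : Ω →ₗ[ℂ] Ω :=
  K.assembleHodge h ∘ₗ K.lefschetzDecomposition.symm.toLinearMap

/-- The defining formula of the Hodge map, for `α ∈ P^(a,b)`, `k = a + b` and `j ≤ n - k`
(`L^j(α)` vanishes for larger `j`). -/
theorem hodge_L_pow (h : ℝ) {j a b : ℕ} (hjab : j + (a + b) ≤ n) {α : Ω}
    (hα : α ∈ K.primitiveBi (a, b)) :
    K.hodge h ((K.L ^ j) α) = hodgeCoeff n h j a b • (K.L ^ (n - j - (a + b))) α := by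
  have h1 := K.assemble_of ⟨(j, a, b), hjab⟩ ⟨α, hα⟩
  have h2 : K.lefschetzDecomposition.symm ((K.L ^ j) α) =
      DirectSum.lof ℂ _ (fun t : LefschetzIndex n => K.primitiveBi t.1.2)
        ⟨(j, a, b), hjab⟩ ⟨α, hα⟩ := by
    rw [LinearEquiv.symm_apply_eq]; exact h1.symm
  rw [hodge, LinearMap.comp_apply, LinearEquiv.coe_coe, h2]
  simp [assembleHodge, DirectSum.toModule_lof]

/-- The associated orientation `vol : Ω^(2n) → Ω^0 = A`, the restriction of `*_h`, extended by
zero to the forms of other degrees. -/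
def vol (h : ℝ) : Ω →ₗ[ℂ] A :=
  C.toZero ∘ₗ K.hodge h ∘ₗ GradedAlgebra.proj C.deg (2 * n)

/-- The metric: `g(ω ⊗ ν) = vol(ω ∧ *_h(ν*))` for `ω, ν ∈ Ω^k`, and `g(Ω^k ⊗ Ω^l) = 0` for
`k ≠ l`. -/
def metric (h : ℝ) (ω ν : Ω) : A :=
  ∑ k ∈ Finset.range (2 * n + 1), K.vol h
    (GradedAlgebra.proj C.deg k ω * K.hodge h (C.conj (GradedAlgebra.proj C.deg k ν)))

end General

end HermitianStructure

/-! ### Kähler structures and the Lefschetz operators on cohomology -/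

section Kahler

variable {A : Type*} [Ring A] [Algebra ℂ A] [StarRing A] {Ω : Type*} [Ring Ω] [Algebra ℂ Ω]

/-- A Kähler structure: an Hermitian structure whose Hermitian form is `d`-closed. -/
structure KahlerStructure (C : StarCalculus A Ω) (n : ℕ) extends HermitianStructure C n where
  form_closed : C.d form = 0

/-- The three differentials `d`, `∂`, `∂̄` of a complex structure. -/
inductive Differential
  | total
  | hol
  | antihol

namespace KahlerStructure

variable {C : StarCalculus A Ω} {n : ℕ} (K : KahlerStructure C n)

/-- The operators `d`, `∂`, `∂̄`. -/
def diff : Differential → (Ω →ₗ[ℂ] Ω)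
  | .total => C.d
  | .hol => K.del
  | .antihol => K.delbar

theorem d_L (ω : Ω) : C.d (K.L ω) = K.L (C.d ω) := by
  change C.d (K.form * ω) = K.form * C.d ω
  rw [C.leibniz 2 _ K.form_mem_deg, K.form_closed]
  simp

theorem component_of_mem (v : ℕ × ℕ) {p : ℕ × ℕ} {ω : Ω} (hω : ω ∈ K.bideg p) :
    K.component v ω = GradedAlgebra.proj K.bideg (p + v) (C.d ω) := by
  simp only [AlmostComplexStructure.component, LinearMap.comp_apply, LinearEquiv.coe_coe,
    DirectSum.decomposeLinearEquiv_apply]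
  rw [DirectSum.decompose_of_mem _ hω]
  exact DirectSum.toModule_lof (R := ℂ) (M := fun p => K.bideg p) p ⟨ω, hω⟩

theorem component_L (v : ℕ × ℕ) (ω : Ω) : K.component v (K.L ω) = K.L (K.component v ω) := by
  induction ω using DirectSum.Decomposition.inductionOn K.bideg with
  | zero => simp
  | @homogeneous p m =>
    have h1 := K.L_pow_mem_bideg 1 m.2
    rw [pow_one] at h1
    have h2 := K.proj_L_pow 1 (p + v) (C.d m)
    rw [pow_one] at h2
    rw [K.component_of_mem v h1, K.component_of_mem v m.2, K.d_L, ← h2, add_right_comm]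
  | add x y hx hy => simp only [map_add, hx, hy]

theorem diff_L (t : Differential) (ω : Ω) : K.diff t (K.L ω) = K.L (K.diff t ω) := by
  cases t
  · exact K.d_L ω
  · exact K.component_L _ ω
  · exact K.component_L _ ω

theorem diff_L_pow (t : Differential) (j : ℕ) (ω : Ω) :
    K.diff t ((K.L ^ j) ω) = (K.L ^ j) (K.diff t ω) := by
  induction j with
  | zero => simp
  | succ j ih => rw [pow_succ', Module.End.mul_apply, Module.End.mul_apply, K.diff_L, ih]

/-- The cohomology groups `H^k_d`, `H^k_∂`, `H^k_∂̄`. -/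
abbrev Cohomology (t : Differential) (k : ℕ) : Type _ := C.Cohomology (K.diff t) k

/-- The cohomology class of a closed form. -/
def cohomologyClass (t : Differential) (k : ℕ) :
    C.cocycles (K.diff t) k →ₗ[ℂ] K.Cohomology t k := Submodule.mkQ _

theorem L_pow_mem_cocycles (t : Differential) (j : ℕ) {k m : ℕ} (h : m = k + 2 * j) {ω : Ω}
    (hω : ω ∈ C.cocycles (K.diff t) k) : (K.L ^ j) ω ∈ C.cocycles (K.diff t) m := by
  subst h
  refine ⟨K.L_pow_mem_deg j hω.1, ?_⟩
  change K.diff t ((K.L ^ j) ω) = 0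
  rw [K.diff_L_pow, LinearMap.mem_ker.1 hω.2, map_zero]

theorem L_pow_mem_coboundaries (t : Differential) (j : ℕ) {k m : ℕ} (h : m = k + 2 * j) {ω : Ω}
    (hω : ω ∈ C.coboundaries (K.diff t) k) : (K.L ^ j) ω ∈ C.coboundaries (K.diff t) m := by
  subst h
  cases k with
  | zero =>
    have : ω = 0 := hω
    rw [this, map_zero]; exact Submodule.zero_mem _
  | succ k =>
    obtain ⟨ν, hν, rfl⟩ := hω
    rw [show k + 1 + 2 * j = (k + 2 * j) + 1 by ring]
    exact ⟨(K.L ^ j) ν, K.L_pow_mem_deg j hν, K.diff_L_pow t j ν⟩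

/-- The map `L^j : H^k → H^m`, `[ω] ↦ [κ^j ∧ ω]`, where `m = k + 2j`. -/
def lefschetz (t : Differential) (j k m : ℕ) (h : m = k + 2 * j) :
    K.Cohomology t k →ₗ[ℂ] K.Cohomology t m :=
  Submodule.mapQ _ _
    ((K.L ^ j).restrict fun _ hω => K.L_pow_mem_cocycles t j h hω)
    (fun _ hω => K.L_pow_mem_coboundaries t j h hω)

/-- The subspace `H^(a,b)` of `H^k`, `k = a + b`, of classes of closed `(a,b)`-forms. -/
def cohomologyBi (t : Differential) (a b : ℕ) : Submodule ℂ (K.Cohomology t (a + b)) :=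
  ((K.bideg (a, b)).comap (C.cocycles (K.diff t) (a + b)).subtype).map
    (K.cohomologyClass t (a + b))

/-- The primitive cohomology group, the kernel of `L^(n-(a+b)+1)` on `H^(a,b)`. (The subtraction
is truncated: for `a + b > n` this is the kernel of the identity, hence zero, matching the
convention that there are no primitive forms of degree larger than `n`.) -/
def primitiveCohomology (t : Differential) (a b : ℕ) :
    Submodule ℂ (K.Cohomology t (a + b)) :=
  K.cohomologyBi t a b ⊓
    LinearMap.ker (K.lefschetz t (n + 1 - (a + b)) (a + b) _ rfl)

end KahlerStructure

end Kahler

/-! ### Covariance, integrals and positive definiteness over a quantum homogeneous space -/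

section Covariant

variable {G H : Type*} [Ring G] [StarRing G] [HopfAlgebra ℂ G] [StarModule ℂ G]
  [HopfStarAlgebra G] [Ring H] [StarRing H] [HopfAlgebra ℂ H] [StarModule ℂ H]
  [HopfStarAlgebra H] {X : QuantumHomogeneousSpace G H} {Ω : Type*} [Ring Ω] [Algebra ℂ Ω]

/-- The subspace `M⁺Ω`. -/
def plusSubmodule (C : StarCalculus X.M Ω) : Submodule ℂ Ω :=
  Submodule.span ℂ {x | ∃ m : X.M, X.counit m = 0 ∧ ∃ ω : Ω, x = C.incl m * ω}

/-- Covariance of a calculus over a quantum homogeneous space: the coaction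
`Δ : M → G ⊗ M` extends to an algebra map `Ω → G ⊗ Ω`, a left coaction compatible with `d`; moreover
`Ω M⁺ ⊆ M⁺ Ω`, and `Ω` is finite-dimensional, that is, `Φ(Ω) = Ω / M⁺Ω` is a finite-dimensional
vector space. -/
structure CovariantCalculus (C : StarCalculus X.M Ω) where
  coaction : Ω →ₐ[ℂ] G ⊗[ℂ] Ω
  coaction_incl : ∀ m : X.M, ∃ t : G ⊗[ℂ] X.M,
    X.M.subtype.toLinearMap.lTensor G t = Coalgebra.comul (R := ℂ) (m : G) ∧
    coaction (C.incl m) = C.incl.toLinearMap.lTensor G t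
  coaction_d : ∀ ω, coaction (C.d ω) = C.d.lTensor G (coaction ω)
  coassoc : ∀ ω, TensorProduct.assoc ℂ G G Ω
      ((Coalgebra.comul (R := ℂ) (A := G)).rTensor Ω (coaction ω)) =
    coaction.toLinearMap.lTensor G (coaction ω)
  counit_coaction : ∀ ω, TensorProduct.lid ℂ Ω
      ((Coalgebra.counit (R := ℂ) (A := G)).rTensor Ω (coaction ω)) = ω
  mul_plus : ∀ m : X.M, X.counit m = 0 → ∀ ω, ω * C.incl m ∈ plusSubmodule C
  finiteDimensional : FiniteDimensional ℂ (Ω ⧸ plusSubmodule C)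

namespace HermitianStructure

variable {C : StarCalculus X.M Ω} {n : ℕ} (K : HermitianStructure C n)

/-- A covariant Hermitian structure: each `Ω^(a,b)` is a subcomodule (it is always a
sub-bimodule), and the Hermitian form is left coinvariant. -/
structure IsCovariant (D : CovariantCalculus C) : Prop where
  bideg_covariant : ∀ p, ∀ ω ∈ K.bideg p,
    D.coaction ω ∈ LinearMap.range ((K.bideg p).subtype.lTensor G)
  form_coinvariant : D.coaction K.form = (1 : G) ⊗ₜ[ℂ] K.form

/-- The associated integral `∫ω = h(vol(ω))`, zero on `Ω^k` for `k < 2n`. -/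
def integral [Cosemisimple G] (h : ℝ) (ω : Ω) : ℂ := haar G (K.vol h ω : G)

/-- The integral is closed: `∫ dω = 0` for all `ω ∈ Ω^(2n-1)`. -/
def IntegralClosed [Cosemisimple G] (h : ℝ) : Prop :=
  ∀ k, k + 1 = 2 * n → ∀ ω ∈ C.deg k, K.integral h (C.d ω) = 0

/-- The pairing `(ω, ν) ↦ [g(ω ⊗ ν)] ∈ Φ(M) = M / M⁺ = ℂ`, the last identification being given by
the counit. -/
def fiberPairing (h : ℝ) (ω ν : Ω) : ℂ := X.counit (K.metric h ω ν)

/-- Positive definiteness of the Hermitian structure: `[ω] ⊗ [ν] ↦ [g(ω ⊗ ν)]` is a (well-defined)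
inner product on `Φ(Ω) = Ω / M⁺Ω`. -/
structure IsPositiveDefinite (h : ℝ) : Prop where
  left_descends : ∀ ω ∈ plusSubmodule C, ∀ ν, K.fiberPairing h ω ν = 0
  right_descends : ∀ ω, ∀ ν ∈ plusSubmodule C, K.fiberPairing h ω ν = 0
  conj_symm : ∀ ω ν, K.fiberPairing h ω ν = starRingEnd ℂ (K.fiberPairing h ν ω)
  pos : ∀ ω, ω ∉ plusSubmodule C → 0 < (K.fiberPairing h ω ω).re

end HermitianStructure

end Covariant

end QKahler

end

/-! The proof is Hodge theory for an elliptic-free setting: cohomology is represented by harmonic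
forms, and `L` acts on these because the Laplacian commutes with it.

The inner product is `S(ω, ν) = ∫ ω ∧ *_1(ν*)`, where the integral keeps the given parameter `h` but
the Hodge map is the classical one. The mixture is deliberate: the integral for `h` is the closed
one, while the classical Kähler identities are those of `*_1`. For `*_h` in place of `*_1`,
covariance rewrites the form as the Haar inner product on `G` tensored with the fibre inner product
on `Φ(Ω)`, pulled back along `ω ↦ ω₍₋₁₎ ⊗ [ω₍₀₎]` (`IsCovariant.globalForm_eq`); this map is
injective (`toFiber_injective`), so the form is positive definite. Distinct Lefschetz components are
orthogonal, and on each of them `*_1` and `*_h` differ by a positive factor, so rescaling by square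
roots carries positivity over to `S` (`vol_mul_hodge_one`).

Stokes' formula and `hodge_commutator` show that `i[Λ, ∂̄]` and `-i[Λ, ∂]` are adjoint to `∂` and
`∂̄`. Purely algebraic consequences are that the Laplacians of `∂` and `∂̄` agree, that the
Laplacian of `d` is twice either (`laplacian_diff`), and that this operator commutes with `L` and
preserves bidegree (`lap_L`, `lap_mem_bideg`).

No analysis is needed to split forms into harmonic part and image of the Laplacian. Forms whose
coaction has its coefficients in a fixed finite-dimensional subspace of `G` make up a
finite-dimensional space, since it embeds in that subspace tensored with `Φ(Ω)`. The equivariant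
Laplacian preserves this space, and a self-adjoint operator on it is handled by linear algebra
(`exists_ker_add_range`).

Each class for each of the three differentials thus has a unique harmonic representative, from one
common space of harmonic forms. The bijections `L^k` and the Lefschetz decomposition of forms
restrict to harmonic forms, and then pass to cohomology. -/

noncomputable section

namespace QKahler

/-! ### Positive definite sesquilinear forms -/

section Forms

variable {V W : Type*} [AddCommGroup V] [Module ℂ V] [AddCommGroup W] [Module ℂ W]

/-- A sesquilinear form which is real and strictly positive on the diagonal away from zero. -/
def PosDefForm (S : V →ₗ[ℂ] V →ₗ⋆[ℂ] ℂ) : Prop :=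
  ∀ x, x ≠ 0 → 0 < (S x x).re ∧ (S x x).im = 0

theorem PosDefForm.im_self {S : V →ₗ[ℂ] V →ₗ⋆[ℂ] ℂ} (hS : PosDefForm S) (x : V) :
    (S x x).im = 0 := by
  by_cases hx : x = 0
  · simp [hx]
  · exact (hS x hx).2

theorem PosDefForm.re_self_nonneg {S : V →ₗ[ℂ] V →ₗ⋆[ℂ] ℂ} (hS : PosDefForm S) (x : V) :
    0 ≤ (S x x).re := by
  by_cases hx : x = 0
  · simp [hx]
  · exact (hS x hx).1.le

theorem PosDefForm.eq_zero {S : V →ₗ[ℂ] V →ₗ⋆[ℂ] ℂ} (hS : PosDefForm S) {x : V}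
    (h : S x x = 0) : x = 0 := by
  by_contra hx
  have := (hS x hx).1
  simp [h] at this

/-- A sesquilinear form with real diagonal is Hermitian. -/
theorem PosDefForm.conj_symm {S : V →ₗ[ℂ] V →ₗ⋆[ℂ] ℂ} (hS : PosDefForm S) (x y : V) :
    starRingEnd ℂ (S y x) = S x y := by
  have h1 := hS.im_self (x + y)
  have h2 := hS.im_self (x + Complex.I • y)
  have hx := hS.im_self x
  have hy := hS.im_self y
  simp only [map_add, LinearMap.add_apply, map_smul, LinearMap.smul_apply, map_smulₛₗ,
    Complex.add_im, smul_eq_mul, Complex.conj_I, Complex.mul_im, Complex.I_re, Complex.I_im,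
    Complex.add_re, Complex.mul_re, Complex.neg_re, Complex.neg_im] at h1 h2
  apply Complex.ext
  · rw [Complex.conj_re]; linarith
  · rw [Complex.conj_im]; linarith

/-- The inner product defined by a positive definite sesquilinear form. -/
abbrev PosDefForm.core {S : V →ₗ[ℂ] V →ₗ⋆[ℂ] ℂ} (hS : PosDefForm S) :
    InnerProductSpace.Core ℂ V where
  inner x y := S y x
  conj_inner_symm x y := hS.conj_symm y x
  re_inner_nonneg x := hS.re_self_nonneg x
  add_left x y z := by simp
  smul_left x y r := by simp
  definite x hx := hS.eq_zero hx

/-- The tensor product of two positive definite forms is positive definite. -/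
theorem PosDefForm.tensor {S : V →ₗ[ℂ] V →ₗ⋆[ℂ] ℂ} (hS : PosDefForm S)
    {T : W →ₗ[ℂ] W →ₗ⋆[ℂ] ℂ} (hT : PosDefForm T) {z : V ⊗[ℂ] W} (hz : z ≠ 0) :
    0 < (TensorProduct.lid ℂ ℂ (TensorProduct.map₂ S T z z)).re ∧
      (TensorProduct.lid ℂ ℂ (TensorProduct.map₂ S T z z)).im = 0 := by
  let _ : NormedAddCommGroup V := hS.core.toNormedAddCommGroup
  let _ : InnerProductSpace ℂ V := .ofCore hS.core.toCore
  let _ : NormedAddCommGroup W := hT.core.toNormedAddCommGroup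
  let _ : InnerProductSpace ℂ W := .ofCore hT.core.toCore
  -- The arguments swap because `inner` is conjugate-linear in its first slot, whereas `S` and `T`
  -- are linear there.
  have key : ∀ z w : V ⊗[ℂ] W,
      TensorProduct.lid ℂ ℂ (TensorProduct.map₂ S T z w) = inner ℂ w z := by
    intro z w
    induction z using TensorProduct.induction_on with
    | zero => simp
    | add z z' hz hz' => simp only [map_add, LinearMap.add_apply, hz, hz', inner_add_right]
    | tmul v u =>
      induction w using TensorProduct.induction_on with
      | zero => simp
      | add w w' hw hw' => simp only [map_add, hw, hw', inner_add_left]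
      | tmul v' u' =>
        rw [TensorProduct.inner_tmul]
        rfl
  rw [key]
  have h1 : 0 < ‖z‖ := norm_pos_iff.2 hz
  have h2 : inner ℂ z z = ((‖z‖ ^ 2 : ℝ) : ℂ) := by
    rw [Complex.ofReal_pow]; exact inner_self_eq_norm_sq_to_K z
  rw [h2]
  exact ⟨by rw [Complex.ofReal_re]; positivity, Complex.ofReal_im _⟩

end Forms

/-! ### Hodge decomposition for an adjoint pair of square-zero operators -/

section Hodge

variable {V : Type*} [AddCommGroup V] [Module ℂ V]

/-- `δ'` is adjoint to `δ` with respect to `S`. -/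
def IsAdjointFor (S : V →ₗ[ℂ] V →ₗ⋆[ℂ] ℂ) (δ δ' : V →ₗ[ℂ] V) : Prop :=
  ∀ x y, S (δ x) y = S x (δ' y)

/-- The Laplacian `δδ' + δ'δ`. -/
def laplacian (δ δ' : V →ₗ[ℂ] V) : V →ₗ[ℂ] V := δ ∘ₗ δ' + δ' ∘ₗ δ

variable {S : V →ₗ[ℂ] V →ₗ⋆[ℂ] ℂ} {δ δ' : V →ₗ[ℂ] V}

theorem IsAdjointFor.symm (hS : PosDefForm S) (h : IsAdjointFor S δ δ') :
    IsAdjointFor S δ' δ := fun x y => by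
  rw [← hS.conj_symm, ← h, hS.conj_symm]

theorem IsAdjointFor.laplacian_self (hS : PosDefForm S) (h : IsAdjointFor S δ δ') :
    IsAdjointFor S (laplacian δ δ') (laplacian δ δ') := fun x y => by
  simp only [laplacian, LinearMap.add_apply, LinearMap.comp_apply, map_add]
  rw [h, h.symm hS, h.symm hS, h]

/-- By adjointness `S(Δx, x) = S(δ'x, δ'x) + S(δx, δx)`, a sum of two nonnegative terms. -/
theorem laplacian_eq_zero_iff (hS : PosDefForm S) (h : IsAdjointFor S δ δ') {x : V} :
    laplacian δ δ' x = 0 ↔ δ x = 0 ∧ δ' x = 0 := by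
  constructor
  · intro hx
    have h1 : S (laplacian δ δ' x) x = S (δ' x) (δ' x) + S (δ x) (δ x) := by
      simp only [laplacian, LinearMap.add_apply, LinearMap.comp_apply, map_add]
      rw [h, h.symm hS (δ x)]
    rw [hx, map_zero, LinearMap.zero_apply] at h1
    have h2 := congrArg Complex.re h1
    rw [Complex.add_re, Complex.zero_re] at h2
    have p1 := hS.re_self_nonneg (δ x)
    have p2 := hS.re_self_nonneg (δ' x)
    constructor
    · refine hS.eq_zero (Complex.ext ?_ (hS.im_self _))
      rw [Complex.zero_re]; linarith
    · refine hS.eq_zero (Complex.ext ?_ (hS.im_self _))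
      rw [Complex.zero_re]; linarith
  · rintro ⟨h1, h2⟩
    simp [laplacian, h1, h2]

/-- A self-adjoint operator splits every stable finite-dimensional subspace into kernel and
image. -/
theorem exists_ker_add_range (hS : PosDefForm S) {T : V →ₗ[ℂ] V} (hT : IsAdjointFor S T T)
    (U : Submodule ℂ V) [FiniteDimensional ℂ U] (hU : ∀ x ∈ U, T x ∈ U) {x : V} (hx : x ∈ U) :
    ∃ y ∈ U, ∃ z ∈ U, T y = 0 ∧ x = y + T z := by
  set f : U →ₗ[ℂ] U := T.restrict hU with hf
  have hdisj : Disjoint (LinearMap.ker f) (LinearMap.range f) := by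
    rw [Submodule.disjoint_def]
    rintro y hy ⟨z, rfl⟩
    have hy' : T (T z) = 0 := congrArg Subtype.val (LinearMap.mem_ker.1 hy)
    refine Subtype.ext (hS.eq_zero (?_ : S (T z) (T z) = 0))
    rw [hT, hy', map_zero]
  have htop : LinearMap.ker f ⊔ LinearMap.range f = ⊤ :=
    -- Rank-nullity: being disjoint, kernel and image fill the finite-dimensional space. Only here
    -- is finiteness used.
    Submodule.eq_top_of_disjoint _ _ (by
      rw [add_comm, LinearMap.finrank_range_add_finrank_ker]) hdisj
  have hmem : (⟨x, hx⟩ : U) ∈ LinearMap.ker f ⊔ LinearMap.range f := htop ▸ Submodule.mem_top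
  obtain ⟨y, hy, w, ⟨z, rfl⟩, h⟩ := Submodule.mem_sup.1 hmem
  exact ⟨y, y.2, z, z.2, congrArg Subtype.val (LinearMap.mem_ker.1 hy),
    (congrArg Subtype.val h).symm⟩

/-- A closed vector differs from its harmonic part by an exact vector. -/
theorem eq_add_of_closed (hS : PosDefForm S) (h : IsAdjointFor S δ δ') (hδ : ∀ x, δ (δ x) = 0)
    {x y z : V} (hy : laplacian δ δ' y = 0) (hxy : x = y + laplacian δ δ' z) (hx : δ x = 0) :
    x = y + δ (δ' z) := by
  have hy' := ((laplacian_eq_zero_iff hS h).1 hy).1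
  -- Closedness kills everything in `δ x` except `δδ'δz`; pairing with `δz` then gives `S(δ'δz,
  -- δ'δz) = 0`.
  have h1 : δ (δ' (δ z)) = 0 := by
    rw [hxy] at hx
    simpa [laplacian, hy', hδ] using hx
  have h2 : δ' (δ z) = 0 := hS.eq_zero (by rw [h.symm hS, h1, map_zero])
  rw [hxy]
  simp [laplacian, h2]

/-- A harmonic exact vector vanishes. -/
theorem eq_zero_of_harmonic_of_exact (hS : PosDefForm S) (h : IsAdjointFor S δ δ') {y : V}
    (hy : laplacian δ δ' (δ y) = 0) : δ y = 0 :=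
  hS.eq_zero (by rw [h, ((laplacian_eq_zero_iff hS h).1 hy).2, map_zero])

end Hodge

/-! ### Slicing tensors by functionals -/

section Slice

variable {V W : Type*} [AddCommGroup V] [Module ℂ V] [AddCommGroup W] [Module ℂ W]

/-- The map `φ ⊗ id : V ⊗ W → W`. -/
def slice (φ : V →ₗ[ℂ] ℂ) : V ⊗[ℂ] W →ₗ[ℂ] W :=
  (TensorProduct.lid ℂ W).toLinearMap ∘ₗ φ.rTensor W

@[simp]
theorem slice_tmul (φ : V →ₗ[ℂ] ℂ) (v : V) (w : W) : slice φ (v ⊗ₜ[ℂ] w) = φ v • w := by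
  simp [slice]

theorem slice_lTensor {W' : Type*} [AddCommGroup W'] [Module ℂ W'] (φ : V →ₗ[ℂ] ℂ)
    (T : W →ₗ[ℂ] W') (z : V ⊗[ℂ] W) : slice φ (T.lTensor V z) = T (slice φ z) := by
  induction z using TensorProduct.induction_on with
  | zero => simp
  | tmul v w => simp
  | add x y hx hy => simp only [map_add, hx, hy]

/-- The coordinate functionals of a basis of `V` already separate tensors. This turns colinearity
into commutation with an action of the dual of `G`. -/
theorem eq_of_slice_eq {z w : V ⊗[ℂ] W} (h : ∀ φ : V →ₗ[ℂ] ℂ, slice φ z = slice φ w) :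
    z = w := by
  classical
  let b := Module.Basis.ofVectorSpace ℂ V
  apply (TensorProduct.equivFinsuppOfBasisLeft b).injective
  ext i
  have key : ∀ z : V ⊗[ℂ] W, TensorProduct.equivFinsuppOfBasisLeft b z i = slice (b.coord i) z := by
    intro z
    induction z using TensorProduct.induction_on with
    | zero => simp
    | tmul v w => simp
    | add x y hx hy => simp only [map_add, Finsupp.add_apply, hx, hy]
  rw [key, key, h]

theorem slice_mem_of_mem_range {U : Submodule ℂ W} {z : V ⊗[ℂ] W}
    (hz : z ∈ LinearMap.range (U.subtype.lTensor V)) (φ : V →ₗ[ℂ] ℂ) : slice φ z ∈ U := by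
  obtain ⟨z, rfl⟩ := hz
  rw [slice_lTensor]
  exact Subtype.mem _

/-- Induction on an element of the image of `V ⊗ U` in `V ⊗ W`. -/
theorem range_lTensor_induction {U : Submodule ℂ W} {p : V ⊗[ℂ] W → Prop} (h0 : p 0)
    (hadd : ∀ x y, p x → p y → p (x + y)) (ht : ∀ v, ∀ u ∈ U, p (v ⊗ₜ[ℂ] u)) {z : V ⊗[ℂ] W}
    (hz : z ∈ LinearMap.range (U.subtype.lTensor V)) : p z := by
  obtain ⟨z, rfl⟩ := hz
  induction z using TensorProduct.induction_on with
  | zero => simpa using h0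
  | tmul v u => exact ht v u u.2
  | add x y hx hy => rw [map_add]; exact hadd _ _ hx hy

end Slice

/-! ### Operators attached to the Lefschetz decomposition -/

namespace HermitianStructure

variable {A : Type*} [Ring A] [Algebra ℂ A] [StarRing A] {Ω : Type*} [Ring Ω] [Algebra ℂ Ω]
  {C : StarCalculus A Ω} {n : ℕ} (K : HermitianStructure C n)

theorem L_apply (ω : Ω) : K.L ω = K.form * ω := rfl

theorem proj_bideg_of_mem {p : ℕ × ℕ} {ω : Ω} (h : ω ∈ K.bideg p) :
    GradedAlgebra.proj K.bideg p ω = ω := by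
  rw [GradedAlgebra.proj_apply]; exact DirectSum.decompose_of_mem_same _ h

theorem proj_bideg_of_mem_ne {p q : ℕ × ℕ} {ω : Ω} (h : ω ∈ K.bideg p) (hpq : p ≠ q) :
    GradedAlgebra.proj K.bideg q ω = 0 := by
  rw [GradedAlgebra.proj_apply]; exact DirectSum.decompose_of_mem_ne _ h hpq

theorem proj_bideg_mem (p : ℕ × ℕ) (ω : Ω) : GradedAlgebra.proj K.bideg p ω ∈ K.bideg p := by
  rw [GradedAlgebra.proj_apply]; exact Subtype.mem _

theorem eq_zero_of_mem_bideg {p q : ℕ × ℕ} (hpq : p ≠ q) {ω : Ω} (hp : ω ∈ K.bideg p)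
    (hq : ω ∈ K.bideg q) : ω = 0 := by
  rw [← K.proj_bideg_of_mem hp, K.proj_bideg_of_mem_ne hq hpq.symm]

theorem deg_zero_eq : C.deg 0 = K.bideg (0, 0) := by
  rw [K.deg_eq]; simp

theorem mem_bideg_induction {p : Ω → Prop} (zero : p 0) (add : ∀ x y, p x → p y → p (x + y))
    (mem : ∀ q, ∀ ω ∈ K.bideg q, p ω) (ω : Ω) : p ω := by
  induction ω using DirectSum.Decomposition.inductionOn K.bideg with
  | zero => exact zero
  | homogeneous m => exact mem _ _ m.2
  | add x y hx hy => exact add x y hx hy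

theorem bideg_mul {p q : ℕ × ℕ} {ω ν : Ω} (hω : ω ∈ K.bideg p) (hν : ν ∈ K.bideg q) :
    ω * ν ∈ K.bideg (p + q) := SetLike.mul_mem_graded hω hν

/-- The forms of top degree have bidegree `(n, n)`. -/
theorem eq_zero_of_mem_bideg_top {p : ℕ × ℕ} (hp : p.1 + p.2 = 2 * n) (hne : p ≠ (n, n)) {ω : Ω}
    (hω : ω ∈ K.bideg p) : ω = 0 := by
  have h1 := K.bideg_le_deg p hω
  rw [hp] at h1
  -- A top form is `L^n` of a form of bidegree `(0, 0)`.
  obtain ⟨y, hy, rfl⟩ := (K.L_pow_bijOn (k := 0) (by omega)).surjOn h1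
  rw [SetLike.mem_coe, K.deg_zero_eq] at hy
  have h2 := K.L_pow_mem_bideg (n - 0) hy
  simp only [Nat.sub_zero, Prod.mk_add_mk, zero_add] at h2
  exact K.eq_zero_of_mem_bideg hne hω h2

theorem deg_eq_bot (K : HermitianStructure C n) {k : ℕ} (hk : 2 * n < k) {ω : Ω} (hω : ω ∈ C.deg k) : ω = 0 := by
  rwa [K.totalDimension.1 k hk, Submodule.mem_bot] at hω

theorem L_pow_primitive {a b j : ℕ} (hj : n < j + (a + b)) {α : Ω}
    (hα : α ∈ K.primitiveBi (a, b)) : (K.L ^ j) α = 0 := by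
  by_cases h : a + b ≤ n
  · exact K.L_pow_eq_zero_of_le (by omega) ((K.mem_primitiveBi h).1 hα).2
  · have : α ∈ K.primitive (a + b) := hα.2
    rw [primitive, if_neg h, Submodule.mem_bot] at this
    rw [this, map_zero]

/-- Additive properties may be checked on the elements `L^j α` with `α` primitive. -/
theorem lefschetz_induction {p : Ω → Prop} (add : ∀ x y, p x → p y → p (x + y))
    (prim : ∀ j a b, j + (a + b) ≤ n → ∀ α ∈ K.primitiveBi (a, b), p ((K.L ^ j) α)) (ω : Ω) :
    p ω := by
  obtain ⟨f, rfl⟩ := K.assemble_surjective ω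
  induction f using DirectSum.induction_on with
  | zero =>
    have := prim 0 0 0 (by omega) 0 (Submodule.zero_mem _)
    simpa using this
  | of t α =>
    have h1 := prim t.1.1 t.1.2.1 t.1.2.2 t.2 α α.2
    rw [← K.assemble_of t α] at h1
    exact h1
  | add x y hx hy => rw [map_add]; exact add _ _ hx hy

theorem proj_deg_of_mem {k : ℕ} {ω : Ω} (h : ω ∈ C.deg k) : GradedAlgebra.proj C.deg k ω = ω := by
  rw [GradedAlgebra.proj_apply]; exact DirectSum.decompose_of_mem_same _ h

theorem proj_deg_of_mem_ne {k l : ℕ} {ω : Ω} (h : ω ∈ C.deg k) (hkl : k ≠ l) :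
    GradedAlgebra.proj C.deg l ω = 0 := by
  rw [GradedAlgebra.proj_apply]; exact DirectSum.decompose_of_mem_ne _ h hkl

theorem L_pow_mem_deg_of_mem_bideg {j a b : ℕ} {α : Ω} (hα : α ∈ K.bideg (a, b)) :
    (K.L ^ j) α ∈ C.deg (a + b + 2 * j) :=
  K.L_pow_mem_deg j (K.bideg_le_deg _ hα)

theorem lefschetz_induction_deg {p : Ω → Prop} {m : ℕ} (zero : p 0)
    (add : ∀ x y, p x → p y → p (x + y))
    (prim : ∀ j a b, j + (a + b) ≤ n → a + b + 2 * j = m → ∀ α ∈ K.primitiveBi (a, b),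
      p ((K.L ^ j) α)) {ω : Ω} (hω : ω ∈ C.deg m) : p ω := by
  suffices h : p (GradedAlgebra.proj C.deg m ω) by rwa [proj_deg_of_mem hω] at h
  refine K.lefschetz_induction (p := fun ω => p (GradedAlgebra.proj C.deg m ω)) ?_ ?_ ω
  · intro x y hx hy
    rw [map_add]; exact add _ _ hx hy
  · intro j a b hj α hα
    have h1 := K.L_pow_mem_deg_of_mem_bideg (j := j) hα.1
    by_cases h : a + b + 2 * j = m
    · rw [proj_deg_of_mem (h ▸ h1)]
      exact prim j a b hj h α hα
    · rw [proj_deg_of_mem_ne h1 h]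
      exact zero

/-- The operator `L^j α ↦ c(j, a, b) L^(m(j, a, b)) α` for `α` a primitive `(a, b)`-form. -/
def lefschetzOp (c : LefschetzIndex n → ℂ) (m : LefschetzIndex n → ℕ) : Ω →ₗ[ℂ] Ω :=
  DirectSum.toModule ℂ (LefschetzIndex n) Ω
    (fun t => c t • ((K.L ^ m t) ∘ₗ (K.primitiveBi t.1.2).subtype)) ∘ₗ
      K.lefschetzDecomposition.symm.toLinearMap

theorem lefschetzOp_L_pow (c : LefschetzIndex n → ℂ) (m : LefschetzIndex n → ℕ) {j a b : ℕ}
    (hj : j + (a + b) ≤ n) {α : Ω} (hα : α ∈ K.primitiveBi (a, b)) :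
    K.lefschetzOp c m ((K.L ^ j) α) = c ⟨(j, a, b), hj⟩ • (K.L ^ m ⟨(j, a, b), hj⟩) α := by
  have h1 := K.assemble_of ⟨(j, a, b), hj⟩ ⟨α, hα⟩
  have h2 : K.lefschetzDecomposition.symm ((K.L ^ j) α) =
      DirectSum.lof ℂ _ (fun t : LefschetzIndex n => K.primitiveBi t.1.2)
        ⟨(j, a, b), hj⟩ ⟨α, hα⟩ := by
    rw [LinearEquiv.symm_apply_eq]; exact h1.symm
  rw [lefschetzOp, LinearMap.comp_apply, LinearEquiv.coe_coe, h2]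
  simp [DirectSum.toModule_lof]

section Commute

variable {K} {T : Ω →ₗ[ℂ] Ω}

theorem map_L_pow_of_commute (hL : ∀ ω, T (K.L ω) = K.L (T ω)) (j : ℕ) (ω : Ω) :
    T ((K.L ^ j) ω) = (K.L ^ j) (T ω) := by
  induction j with
  | zero => simp
  | succ j ih => rw [pow_succ', Module.End.mul_apply, Module.End.mul_apply, hL, ih]

theorem map_primitiveBi_of_commute (hL : ∀ ω, T (K.L ω) = K.L (T ω))
    (hb : ∀ p, ∀ ω ∈ K.bideg p, T ω ∈ K.bideg p) {a b : ℕ} (hab : a + b ≤ n) {α : Ω}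
    (hα : α ∈ K.primitiveBi (a, b)) : T α ∈ K.primitiveBi (a, b) := by
  rw [K.mem_primitiveBi hab] at hα ⊢
  exact ⟨hb _ _ hα.1, by rw [← map_L_pow_of_commute hL, hα.2, map_zero]⟩

/-- An operator commuting with `L` and preserving the bidegree commutes with every operator
defined through the Lefschetz decomposition. -/
theorem map_lefschetzOp_of_commute (hL : ∀ ω, T (K.L ω) = K.L (T ω))
    (hb : ∀ p, ∀ ω ∈ K.bideg p, T ω ∈ K.bideg p) (c : LefschetzIndex n → ℂ)
    (m : LefschetzIndex n → ℕ) (ω : Ω) :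
    T (K.lefschetzOp c m ω) = K.lefschetzOp c m (T ω) := by
  refine K.lefschetz_induction (p := fun ω => T (K.lefschetzOp c m ω) = K.lefschetzOp c m (T ω))
    (fun x y hx hy => by simp only [map_add, hx, hy]) (fun j a b hj α hα => ?_) ω
  rw [K.lefschetzOp_L_pow c m hj hα, map_smul, map_L_pow_of_commute hL, map_L_pow_of_commute hL,
    K.lefschetzOp_L_pow c m hj (map_primitiveBi_of_commute hL hb (by omega) hα)]

end Commute

/-- The dual Lefschetz operator `Λ`. -/
def Lam : Ω →ₗ[ℂ] Ω :=
  K.lefschetzOp (fun t => t.1.1 * ((n : ℂ) - (t.1.2.1 + t.1.2.2 : ℕ) - t.1.1 + 1))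
    (fun t => t.1.1 - 1)

/-- The bound is `n + 1` rather than `n`: in the extra case `L^j α = 0` and the coefficient vanishes
too, so the formula can also be applied after one more `L`. For `j = 0` the truncated exponent is
harmless, the coefficient being zero. -/
theorem Lam_L_pow {j a b : ℕ} (hj : j + (a + b) ≤ n + 1) {α : Ω}
    (hα : α ∈ K.primitiveBi (a, b)) :
    K.Lam ((K.L ^ j) α) = (j * ((n : ℂ) - (a + b : ℕ) - j + 1)) • (K.L ^ (j - 1)) α := by
  rcases Nat.lt_or_ge n (j + (a + b)) with h | h
  · have h1 : (n : ℂ) = j + (a + b : ℕ) - 1 := by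
      have : n + 1 = j + (a + b) := by omega
      rw [eq_sub_iff_add_eq]; exact_mod_cast this
    rw [K.L_pow_primitive h hα, map_zero, h1]
    ring_nf
    simp
  · exact K.lefschetzOp_L_pow _ _ h hα

/-- The commutation relation `[L, Λ] = k - n` on `Ω^k`. -/
theorem L_Lam_sub_Lam_L {k : ℕ} {ω : Ω} (hω : ω ∈ C.deg k) :
    K.L (K.Lam ω) - K.Lam (K.L ω) = ((k : ℂ) - n) • ω := by
  refine K.lefschetz_induction_deg (p := fun ω => K.L (K.Lam ω) - K.Lam (K.L ω) =
    ((k : ℂ) - n) • ω) (by simp) (fun x y hx hy => ?_) (fun j a b hj hk α hα => ?_) hω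
  · simp only [map_add, smul_add, ← hx, ← hy]; abel
  · have h1 : K.L ((K.L ^ j) α) = (K.L ^ (j + 1)) α := by
      rw [pow_succ', Module.End.mul_apply]
    rw [h1, K.Lam_L_pow (by omega) hα, K.Lam_L_pow (by omega) hα, map_smul, Nat.add_sub_cancel]
    have hk' : (k : ℂ) = (a + b : ℕ) + 2 * j := by exact_mod_cast hk.symm
    -- For `j = 0` the exponent `j - 1` truncates, so `L · L^(j-1) = L^j` is available only for
    -- positive `j`.
    rcases j with _ | j
    · rw [← sub_eq_zero]
      simp only [CharP.cast_eq_zero, zero_mul, zero_smul, hk']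
      rw [zero_sub, ← neg_smul, ← sub_smul]
      push_cast; ring_nf; simp
    · have h2 : K.L ((K.L ^ (j + 1 - 1)) α) = (K.L ^ (j + 1)) α := by
        rw [pow_succ', Module.End.mul_apply, Nat.add_sub_cancel]
      rw [h2, hk', ← sub_smul]
      congr 1
      push_cast; ring

/-! #### Compatibility with the involution -/

theorem conj_mem_bideg {a b : ℕ} {ω : Ω} (h : ω ∈ K.bideg (a, b)) : C.conj ω ∈ K.bideg (b, a) := by
  have : C.conj ω ∈ (K.bideg (b, a) : Set Ω) := by
    rw [← K.conj_bideg a b]; exact ⟨ω, h, rfl⟩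
  exact this

theorem conj_proj (a b : ℕ) (ω : Ω) :
    C.conj (GradedAlgebra.proj K.bideg (a, b) ω) = GradedAlgebra.proj K.bideg (b, a) (C.conj ω) := by
  refine K.mem_bideg_induction (p := fun ω => C.conj (GradedAlgebra.proj K.bideg (a, b) ω) =
    GradedAlgebra.proj K.bideg (b, a) (C.conj ω)) (by simp)
    (fun x y hx hy => by simp only [map_add, hx, hy]) (fun q ω hω => ?_) ω
  obtain ⟨c, d⟩ := q
  by_cases h : (c, d) = (a, b)
  · rw [← h, K.proj_bideg_of_mem hω]
    rw [Prod.mk.injEq] at h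
    rw [← h.1, ← h.2, K.proj_bideg_of_mem (K.conj_mem_bideg hω)]
  · rw [K.proj_bideg_of_mem_ne hω h, map_zero,
      K.proj_bideg_of_mem_ne (K.conj_mem_bideg hω)]
    rintro h'
    rw [Prod.mk.injEq] at h'
    exact h (by rw [h'.1, h'.2])

theorem conj_mem_deg (K : HermitianStructure C n) {k : ℕ} {ω : Ω} (h : ω ∈ C.deg k) : C.conj ω ∈ C.deg k := by
  rw [K.deg_eq k] at h
  induction h using Submodule.iSup_induction' with
  | zero => simp
  | add x y _ _ hx hy => rw [map_add]; exact Submodule.add_mem _ hx hy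
  | mem p x hx =>
    by_cases hp : p ∈ Finset.HasAntidiagonal.antidiagonal k
    · simp only [hp, iSup_pos] at hx
      have h1 := K.bideg_le_deg _ (K.conj_mem_bideg (a := p.1) (b := p.2) hx)
      rw [Finset.HasAntidiagonal.mem_antidiagonal] at hp
      rwa [show p.2 + p.1 = k by omega] at h1
    · simp only [hp, iSup_neg, not_false_eq_true, Submodule.mem_bot] at hx
      simp [hx]

/-- The form `κ` is real and central, and has even degree, so that the sign `(-1)^(2k)` is trivial.
-/
theorem conj_L (ω : Ω) : C.conj (K.L ω) = K.L (C.conj ω) := by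
  refine K.mem_bideg_induction (p := fun ω => C.conj (K.L ω) = K.L (C.conj ω)) (by simp)
    (fun x y hx hy => by simp only [map_add, hx, hy]) (fun q ω hω => ?_) ω
  rw [L_apply, C.conj_mul 2 _ _ K.form_mem_deg _ (K.bideg_le_deg q hω), K.form_real,
    ← K.form_central, L_apply]
  simp [pow_mul]

theorem conj_L_pow (j : ℕ) (ω : Ω) : C.conj ((K.L ^ j) ω) = (K.L ^ j) (C.conj ω) := by
  induction j with
  | zero => simp
  | succ j ih => rw [pow_succ', Module.End.mul_apply, Module.End.mul_apply, conj_L, ih]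

theorem conj_mem_primitiveBi {a b : ℕ} (hab : a + b ≤ n) {α : Ω} (hα : α ∈ K.primitiveBi (a, b)) :
    C.conj α ∈ K.primitiveBi (b, a) := by
  rw [K.mem_primitiveBi hab] at hα
  rw [K.mem_primitiveBi (by omega)]
  refine ⟨K.conj_mem_bideg hα.1, ?_⟩
  rw [← conj_L_pow, add_comm b a, hα.2, map_zero]

/-- The coefficients of `Λ` are real and see `(a, b)` only through `a + b`. -/
theorem conj_Lam (ω : Ω) : C.conj (K.Lam ω) = K.Lam (C.conj ω) := by
  refine K.lefschetz_induction (p := fun ω => C.conj (K.Lam ω) = K.Lam (C.conj ω))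
    (fun x y hx hy => by simp only [map_add, hx, hy]) (fun j a b hj α hα => ?_) ω
  rw [K.Lam_L_pow (by omega) hα, K.conj_L_pow, LinearMap.map_smulₛₗ,
    K.Lam_L_pow (by omega) (K.conj_mem_primitiveBi (by omega) hα), K.conj_L_pow, add_comm b a]
  simp

end HermitianStructure

/-! ### Coefficients at `h = 1`, and splitting of forms that are almost primitive -/

theorem qInt_one (m : ℕ) : qInt 1 m = m := by simp [qInt]

theorem qFactorial_one (m : ℕ) : qFactorial 1 m = m.factorial := by
  simp only [qFactorial, qInt_one]
  rw [← Finset.prod_range_add_one_eq_factorial]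
  push_cast; rfl

namespace HermitianStructure

variable {A : Type*} [Ring A] [Algebra ℂ A] [StarRing A] {Ω : Type*} [Ring Ω] [Algebra ℂ Ω]
  {C : StarCalculus A Ω} {n : ℕ} (K : HermitianStructure C n)

theorem mem_bideg_of_proj_eq_zero {q : ℕ × ℕ} {ω : Ω}
    (h : ∀ p, p ≠ q → GradedAlgebra.proj K.bideg p ω = 0) : ω ∈ K.bideg q := by
  classical
  have h2 : GradedAlgebra.proj K.bideg q ω = ω := by
    conv_rhs => rw [← DirectSum.sum_support_decompose K.bideg ω]
    rw [Finset.sum_eq_single q]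
    · rfl
    · exact fun p _ hp => h p hp
    · intro h
      simpa using h
  exact h2 ▸ K.proj_bideg_mem q ω

theorem eq_zero_of_proj_eq_zero {ω : Ω} (h : ∀ p, GradedAlgebra.proj K.bideg p ω = 0) :
    ω = 0 := by
  classical
  rw [← DirectSum.sum_support_decompose K.bideg ω]
  exact Finset.sum_eq_zero fun p _ => h p

/-- A homogeneous form of degree `k + 1 ≤ n + 1` killed by `L^(n-k+1)` is a primitive form plus
`L` of a primitive form. -/
theorem exists_primitive_add_L {q : ℕ × ℕ} {k : ℕ} (hk : k ≤ n) (hq : q.1 + q.2 = k + 1) {β : Ω}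
    (hβ : β ∈ K.bideg q) (h0 : (K.L ^ (n - k + 1)) β = 0) :
    ∃ α₀ ∈ K.primitiveBi q, ∃ α₁, β = α₀ + K.L α₁ ∧
      (α₁ = 0 ∨ ∃ q', q' + (1, 1) = q ∧ α₁ ∈ K.primitiveBi q') := by
  -- For `k = n` the degree is `n + 1`, where the only primitive form is zero; the hypothesis then
  -- reads `L^0 α = 0`.
  have hprim : ∀ α ∈ K.bideg q, (K.L ^ (n - k)) α = 0 → α ∈ K.primitiveBi q := by
    intro α h1 h2
    by_cases h : k + 1 ≤ n
    · refine (K.mem_primitiveBi (a := q.1) (b := q.2) (by omega)).2 ⟨h1, ?_⟩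
      rwa [show n - (q.1 + q.2) + 1 = n - k by omega]
    · rw [show n - k = 0 by omega] at h2
      have : α = 0 := by simpa using h2
      rw [this]; exact Submodule.zero_mem _
  have hβdeg : β ∈ C.deg (k + 1) := hq ▸ K.bideg_le_deg q hβ
  rcases Nat.eq_zero_or_pos k with rfl | hkpos
  · refine ⟨β, hprim β hβ ?_, 0, by simp, Or.inl rfl⟩
    exact K.deg_eq_bot (by omega) (K.L_pow_mem_deg (n - 0) hβdeg)
  · have h1 := K.L_pow_mem_deg (n - k) hβdeg
    rw [show k + 1 + 2 * (n - k) = 2 * n - (k - 1) by omega] at h1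
    -- `α₁` is chosen so that `L^(n-k)` kills `β - L α₁`: `L^(n-k) β` lies in the target of the
    -- Lefschetz isomorphism starting in degree `k - 1`.
    obtain ⟨α₁, hα₁, hL⟩ := (K.L_pow_bijOn (k := k - 1) (by omega)).surjOn h1
    simp only [SetLike.mem_coe, show n - (k - 1) = n - k + 1 by omega] at hα₁ hL
    -- Injectivity of the same isomorphism forces `α₁` to have bidegree `q - (1, 1)`, and to vanish
    -- if `q` has a zero entry.
    have hzero : ∀ p : ℕ × ℕ, p + (1, 1) ≠ q → GradedAlgebra.proj K.bideg p α₁ = 0 := by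
      intro p hp
      by_cases hpk : p.1 + p.2 = k - 1
      · refine (K.L_pow_bijOn (k := k - 1) (by omega)).injOn
          (hpk ▸ K.bideg_le_deg p (K.proj_bideg_mem p α₁)) (Submodule.zero_mem _) ?_
        simp only [show n - (k - 1) = n - k + 1 by omega, map_zero]
        rw [← K.proj_L_pow, hL]
        refine K.proj_bideg_of_mem_ne (K.L_pow_mem_bideg (n - k) hβ) ?_
        intro h
        apply hp
        rw [Prod.ext_iff] at h ⊢
        simp only [Prod.fst_add, Prod.snd_add] at h ⊢
        omega
      · exact K.proj_eq_zero hpk hα₁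
    have hα₁' : α₁ = 0 ∨ ∃ q', q' + (1, 1) = q ∧ α₁ ∈ K.bideg q' := by
      by_cases hq' : ∃ q', q' + (1, 1) = q
      · obtain ⟨q', rfl⟩ := hq'
        exact Or.inr ⟨q', rfl, K.mem_bideg_of_proj_eq_zero fun p hp =>
          hzero p fun h => hp (add_right_cancel h)⟩
      · exact Or.inl (K.eq_zero_of_proj_eq_zero fun p => hzero p fun h => hq' ⟨p, h⟩)
    refine ⟨β - K.L α₁, hprim _ (Submodule.sub_mem _ hβ ?_) ?_, α₁, by abel, ?_⟩
    · rcases hα₁' with rfl | ⟨q', rfl, h2⟩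
      · simp
      · simpa using K.L_pow_mem_bideg 1 h2
    · rw [map_sub, sub_eq_zero, ← hL, pow_succ, Module.End.mul_apply]
    · refine hα₁'.imp_right fun ⟨q', hq', h2⟩ => ⟨q', hq', ?_⟩
      subst hq'
      simp only [Prod.fst_add, Prod.snd_add] at hq
      refine (K.mem_primitiveBi (a := q'.1) (b := q'.2) (by omega)).2 ⟨h2, ?_⟩
      rw [show n - (q'.1 + q'.2) + 1 = 1 + (n - k + 1) by omega, pow_add, Module.End.mul_apply,
        hL, ← Module.End.mul_apply, ← pow_add, add_comm 1, h0]

theorem neg_one_pow_triangle (k : ℕ) :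
    (-1 : ℂ) ^ ((k + 1) * (k + 1 + 1) / 2) = (-1) ^ (k + 1) * (-1) ^ (k * (k + 1) / 2) := by
  rw [← pow_add]
  congr 1
  rw [show (k + 1) * (k + 1 + 1) = (k + 1) * 2 + k * (k + 1) by ring,
    Nat.add_div_of_dvd_right (Dvd.intro_left _ rfl)]
  simp

theorem hodgeCoeff_one (j a b : ℕ) : hodgeCoeff n 1 j a b =
    (-1) ^ ((a + b) * (a + b + 1) / 2) * Complex.I ^ ((a : ℤ) - (b : ℤ)) *
    ((j.factorial : ℂ) / ((n - j - (a + b)).factorial : ℂ)) := by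
  rw [hodgeCoeff, qFactorial_one, qFactorial_one]
  push_cast; rfl

theorem lefschetz_induction_bideg {p : Ω → Prop} {q : ℕ × ℕ} (zero : p 0)
    (add : ∀ x y, p x → p y → p (x + y))
    (prim : ∀ j a b, j + (a + b) ≤ n → ((a, b) : ℕ × ℕ) + (j, j) = q → ∀ α ∈ K.primitiveBi (a, b),
      p ((K.L ^ j) α)) {ω : Ω} (hω : ω ∈ K.bideg q) : p ω := by
  suffices h : p (GradedAlgebra.proj K.bideg q ω) by rwa [K.proj_bideg_of_mem hω] at h
  refine K.lefschetz_induction (p := fun ω => p (GradedAlgebra.proj K.bideg q ω)) ?_ ?_ ω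
  · intro x y hx hy
    rw [map_add]; exact add _ _ hx hy
  · intro j a b hj α hα
    have h1 := K.L_pow_mem_bideg j hα.1
    by_cases h : ((a, b) : ℕ × ℕ) + (j, j) = q
    · rw [K.proj_bideg_of_mem (h ▸ h1)]
      exact prim j a b hj h α hα
    · rw [K.proj_bideg_of_mem_ne h1 h]
      exact zero

/-- The space `Ω^(p - (1,1))`, zero if one of the two degrees is negative. -/
def lowered (p : ℕ × ℕ) : Submodule ℂ Ω :=
  if 1 ≤ p.1 ∧ 1 ≤ p.2 then K.bideg (p.1 - 1, p.2 - 1) else ⊥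

/-- Terms with `j = 0` are killed by `Λ`, so a surviving term contains a factor `κ` and both entries
of `p` are positive. -/
theorem Lam_mem_lowered {p : ℕ × ℕ} {ω : Ω} (hω : ω ∈ K.bideg p) : K.Lam ω ∈ K.lowered p := by
  refine K.lefschetz_induction_bideg (p := fun ω => K.Lam ω ∈ K.lowered p) (by simp)
    (fun x y hx hy => by rw [map_add]; exact Submodule.add_mem _ hx hy)
    (fun j a b hj hp α hα => ?_) hω
  rw [K.Lam_L_pow (by omega) hα]
  rcases j with _ | j
  · simp
  · refine Submodule.smul_mem _ _ ?_
    subst hp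
    rw [lowered, if_pos (by simp only [Prod.mk_add_mk]; omega)]
    exact K.L_pow_mem_bideg j hα.1

theorem map_mem_deg {T : Ω →ₗ[ℂ] Ω} (hT : ∀ p, ∀ ω ∈ K.bideg p, T ω ∈ K.bideg p) {k : ℕ} {ω : Ω}
    (h : ω ∈ C.deg k) : T ω ∈ C.deg k := by
  have hle : C.deg k ≤ (C.deg k).comap T := by
    conv_lhs => rw [K.deg_eq k]
    refine iSup₂_le fun p hp ω hω => ?_
    rw [Finset.HasAntidiagonal.mem_antidiagonal] at hp
    exact hp ▸ K.bideg_le_deg p (hT p ω hω)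
  exact hle h

end HermitianStructure

/-! ### Relations between `∂`, `∂̄` and the involution -/

namespace KahlerStructure

variable {A : Type*} [Ring A] [Algebra ℂ A] [StarRing A] {Ω : Type*} [Ring Ω] [Algebra ℂ Ω]
  {C : StarCalculus A Ω} {n : ℕ} (K : KahlerStructure C n)

theorem component_mem (v : ℕ × ℕ) {p : ℕ × ℕ} {ω : Ω} (hω : ω ∈ K.bideg p) :
    K.component v ω ∈ K.bideg (p + v) := by
  rw [K.component_of_mem v hω]; exact K.proj_bideg_mem _ _

theorem component_L_pow (v : ℕ × ℕ) (j : ℕ) (ω : Ω) :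
    K.component v ((K.L ^ j) ω) = (K.L ^ j) (K.component v ω) :=
  HermitianStructure.map_L_pow_of_commute (K.component_L v) j ω

theorem d_eq (ω : Ω) : C.d ω = K.component (1, 0) ω + K.component (0, 1) ω :=
  LinearMap.congr_fun K.integrable ω

/-- These are the components of `d² = 0` in the three bidegrees `p + (2, 0)`, `p + (0, 2)` and `p +
(1, 1)`. -/
theorem component_sq {p : ℕ × ℕ} {ω : Ω} (hω : ω ∈ K.bideg p) :
    K.component (1, 0) (K.component (1, 0) ω) = 0 ∧
      K.component (0, 1) (K.component (0, 1) ω) = 0 ∧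
      K.component (1, 0) (K.component (0, 1) ω) + K.component (0, 1) (K.component (1, 0) ω) = 0 := by
  have h := C.d_d ω
  simp only [K.d_eq, map_add] at h
  have m1 := K.component_mem (1, 0) (K.component_mem (1, 0) hω)
  have m2 := K.component_mem (1, 0) (K.component_mem (0, 1) hω)
  have m3 := K.component_mem (0, 1) (K.component_mem (1, 0) hω)
  have m4 := K.component_mem (0, 1) (K.component_mem (0, 1) hω)
  rw [add_assoc] at m1 m2 m3 m4
  simp only [Prod.mk_add_mk, Nat.reduceAdd] at m1 m2 m3 m4
  have key : ∀ q, GradedAlgebra.proj K.bideg (p + q) (K.component (1, 0) (K.component (1, 0) ω)) +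
      GradedAlgebra.proj K.bideg (p + q) (K.component (1, 0) (K.component (0, 1) ω)) +
      (GradedAlgebra.proj K.bideg (p + q) (K.component (0, 1) (K.component (1, 0) ω)) +
      GradedAlgebra.proj K.bideg (p + q) (K.component (0, 1) (K.component (0, 1) ω))) = 0 := by
    intro q
    simpa only [map_add, map_zero] using congrArg (GradedAlgebra.proj K.bideg (p + q)) h
  refine ⟨?_, ?_, ?_⟩
  · have := key (2, 0)
    rwa [K.proj_bideg_of_mem m1, K.proj_bideg_of_mem_ne m2 (by simp),
      K.proj_bideg_of_mem_ne m3 (by simp), K.proj_bideg_of_mem_ne m4 (by simp), add_zero,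
      add_zero, add_zero] at this
  · have := key (0, 2)
    rwa [K.proj_bideg_of_mem m4, K.proj_bideg_of_mem_ne m2 (by simp),
      K.proj_bideg_of_mem_ne m3 (by simp), K.proj_bideg_of_mem_ne m1 (by simp), add_zero,
      zero_add, zero_add] at this
  · have := key (1, 1)
    rwa [K.proj_bideg_of_mem m2, K.proj_bideg_of_mem m3, K.proj_bideg_of_mem_ne m1 (by simp),
      K.proj_bideg_of_mem_ne m4 (by simp), add_zero, zero_add] at this

theorem del_del (ω : Ω) : K.del (K.del ω) = 0 := by
  refine K.mem_bideg_induction (p := fun ω => K.del (K.del ω) = 0) (by simp)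
    (fun x y hx hy => by simp only [map_add, hx, hy, add_zero]) (fun q ω hω => ?_) ω
  exact (K.component_sq hω).1

theorem delbar_delbar (ω : Ω) : K.delbar (K.delbar ω) = 0 := by
  refine K.mem_bideg_induction (p := fun ω => K.delbar (K.delbar ω) = 0) (by simp)
    (fun x y hx hy => by simp only [map_add, hx, hy, add_zero]) (fun q ω hω => ?_) ω
  exact (K.component_sq hω).2.1

theorem del_delbar (ω : Ω) : K.del (K.delbar ω) = -K.delbar (K.del ω) := by
  refine K.mem_bideg_induction (p := fun ω => K.del (K.delbar ω) = -K.delbar (K.del ω)) (by simp)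
    (fun x y hx hy => by simp only [map_add, hx, hy, neg_add]) (fun q ω hω => ?_) ω
  exact eq_neg_of_add_eq_zero_left (K.component_sq hω).2.2

theorem diff_diff (t : Differential) (ω : Ω) : K.diff t (K.diff t ω) = 0 := by
  cases t
  · exact C.d_d ω
  · exact K.del_del ω
  · exact K.delbar_delbar ω

theorem conj_component (a b : ℕ) (ω : Ω) :
    C.conj (K.component (a, b) ω) = K.component (b, a) (C.conj ω) := by
  refine K.mem_bideg_induction (p := fun ω => C.conj (K.component (a, b) ω) =
    K.component (b, a) (C.conj ω)) (by simp)
    (fun x y hx hy => by simp only [map_add, hx, hy]) (fun q ω hω => ?_) ω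
  obtain ⟨c, d⟩ := q
  rw [K.component_of_mem _ hω, K.component_of_mem _ (K.conj_mem_bideg hω), C.d_conj]
  exact K.conj_proj _ _ _

theorem conj_del (ω : Ω) : C.conj (K.del ω) = K.delbar (C.conj ω) := K.conj_component 1 0 ω

theorem conj_delbar (ω : Ω) : C.conj (K.delbar ω) = K.del (C.conj ω) := K.conj_component 0 1 ω

/-! #### The Kähler identities -/

/-- The Kähler identity, in the form `*[Λ, ∂_v] = (-1)^k i^(v₁ - v₂) ∂_v *` on `Ω^k`. -/
theorem hodge_commutator {v : ℕ × ℕ} (hv : v.1 + v.2 = 1) {k : ℕ} {ω : Ω} (hω : ω ∈ C.deg k) :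
    K.hodge 1 (K.Lam (K.component v ω) - K.component v (K.Lam ω)) =
      ((-1) ^ k * Complex.I ^ ((v.1 : ℤ) - (v.2 : ℤ))) • K.component v (K.hodge 1 ω) := by
  refine K.lefschetz_induction_deg (p := fun ω =>
    K.hodge 1 (K.Lam (K.component v ω) - K.component v (K.Lam ω)) =
      ((-1) ^ k * Complex.I ^ ((v.1 : ℤ) - (v.2 : ℤ))) • K.component v (K.hodge 1 ω))
    (by simp) (fun x y hx hy => ?_) (fun j a b hj hk α hα => ?_) hω
  · simp only [map_sub, map_add, smul_add] at hx hy ⊢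
    rw [← hx, ← hy]; abel
  · have hI : (Complex.I : ℂ) ≠ 0 := Complex.I_ne_zero
    -- Since `dκ = 0`, the derivative of a primitive form satisfies the same vanishing in one degree
    -- higher, hence equals `α₀ + L α₁` with both terms primitive.
    have h0 : (K.L ^ (n - (a + b) + 1)) (K.component v α) = 0 := by
      rw [← K.component_L_pow, ((K.mem_primitiveBi (by omega)).1 hα).2, map_zero]
    obtain ⟨α₀, hα₀, α₁, hβ, hα₁⟩ := K.exists_primitive_add_L (k := a + b) (by omega)
      (by simp only [Prod.fst_add, Prod.snd_add]; omega) (K.component_mem v hα.1) h0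
    obtain ⟨v₁, v₂⟩ := v
    simp only at hv
    simp only [Prod.mk_add_mk] at hα₀ hα₁
    have hsign : ((-1 : ℂ)) ^ k = (-1) ^ (a + b) := by
      rw [← hk, pow_add, pow_mul]; simp
    have hsq : ((-1 : ℂ)) ^ (a + b) * (-1) ^ (a + b) = 1 := by rw [← mul_pow]; simp
    obtain ⟨r, hr⟩ : ∃ r, n = j + (a + b) + r := ⟨n - (j + (a + b)), by omega⟩
    have hrc : (n : ℂ) = j + (a + b : ℕ) + r := by rw [hr]; push_cast; ring
    have hr' : n - j - (a + b) = r := by omega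
    -- the contribution of `α₀`
    have hA : -((j : ℂ) • K.hodge 1 ((K.L ^ (j - 1)) α₀)) =
        ((-1) ^ k * Complex.I ^ ((v₁ : ℤ) - (v₂ : ℤ)) * HermitianStructure.hodgeCoeff n 1 j a b) •
          (K.L ^ r) α₀ := by
      -- For `j = 0` the right side vanishes as well: `r = n - (a + b)`, while `α₀` has degree `a +
      -- b + 1`.
      rcases j with _ | j
      · rw [K.L_pow_primitive (j := r) (by omega) hα₀]; simp
      · rw [Nat.add_sub_cancel, K.hodge_L_pow 1 (by omega) hα₀, smul_smul, ← neg_smul,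
          show n - j - (a + v₁ + (b + v₂)) = r by omega, hsign]
        congr 1
        rw [HermitianStructure.hodgeCoeff_one, HermitianStructure.hodgeCoeff_one, hr', show n - j - (a + v₁ + (b + v₂)) = r by omega,
          show a + v₁ + (b + v₂) = a + b + 1 by omega, HermitianStructure.neg_one_pow_triangle, Nat.factorial_succ,
          show ((a + v₁ : ℕ) : ℤ) - ((b + v₂ : ℕ) : ℤ) = ((a : ℤ) - b) + ((v₁ : ℤ) - v₂) by
            push_cast; ring, zpow_add₀ hI]
        push_cast; ring
    -- the contribution of `α₁`
    have hB : ((r : ℂ) + 1) • K.hodge 1 ((K.L ^ j) α₁) =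
        ((-1) ^ k * Complex.I ^ ((v₁ : ℤ) - (v₂ : ℤ)) * HermitianStructure.hodgeCoeff n 1 j a b) •
          (K.L ^ (r + 1)) α₁ := by
      rcases hα₁ with rfl | ⟨⟨c, d⟩, hq, hα₁⟩
      · simp
      · simp only [Prod.mk_add_mk, Prod.mk.injEq] at hq
        obtain ⟨hq1, hq2⟩ := hq
        have hab : a + b = c + d + 1 := by omega
        rw [K.hodge_L_pow 1 (by omega) hα₁, smul_smul,
          show n - j - (c + d) = r + 1 by omega, hsign]
        congr 1
        rw [HermitianStructure.hodgeCoeff_one, HermitianStructure.hodgeCoeff_one, hr', show n - j - (c + d) = r + 1 by omega, hab,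
          HermitianStructure.neg_one_pow_triangle, Nat.factorial_succ,
          show (c : ℤ) - (d : ℤ) = ((a : ℤ) - b) + ((v₁ : ℤ) - v₂) by omega, zpow_add₀ hI]
        rw [hab] at hsq
        have hr1 : ((r : ℂ) + 1) ≠ 0 := by exact_mod_cast Nat.succ_ne_zero r
        have hr2 : ((r.factorial : ℕ) : ℂ) ≠ 0 := by exact_mod_cast Nat.factorial_ne_zero r
        push_cast
        field_simp
        linear_combination (-(j.factorial : ℂ)) * hsq
    have hpow : ∀ (m : ℕ) (x : Ω), (K.L ^ m) (K.L x) = (K.L ^ (m + 1)) x := fun m x => by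
      rw [pow_succ, Module.End.mul_apply]
    have h1 : K.Lam ((K.L ^ j) α₀) = ((j : ℂ) * r) • (K.L ^ (j - 1)) α₀ := by
      rw [K.Lam_L_pow (by omega) hα₀, show a + v₁ + (b + v₂) = a + b + 1 by omega, hrc]
      congr 1; push_cast; ring
    have h2 : K.Lam ((K.L ^ (j + 1)) α₁) = (((j : ℂ) + 1) * (r + 1)) • (K.L ^ j) α₁ := by
      rcases hα₁ with rfl | ⟨⟨c, d⟩, hq, hα₁⟩
      · simp
      · simp only [Prod.mk_add_mk, Prod.mk.injEq] at hq
        rw [K.Lam_L_pow (by omega) hα₁, Nat.add_sub_cancel, hrc]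
        have hab : a + b = c + d + 1 := by omega
        rw [hab]
        congr 1; push_cast; ring
    have h3 : K.component (v₁, v₂) (K.Lam ((K.L ^ j) α)) =
        ((j : ℂ) * (r + 1)) • ((K.L ^ (j - 1)) α₀) + ((j : ℂ) * (r + 1)) • (K.L ^ j) α₁ := by
      rw [K.Lam_L_pow (by omega) hα, map_smul, K.component_L_pow, hβ, map_add, hpow, hrc, smul_add]
      rcases j with _ | j
      · simp
      · rw [Nat.add_sub_cancel]
        congr 2 <;> ring
    -- In the commutator applied to `L^j α`, the coefficient of `L^(j-1) α₀` is `jr - j(r+1) = -j`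
    -- and that of `L^j α₁` is `(j+1)(r+1) - j(r+1) = r + 1`, exactly the left sides of `hA` and
    -- `hB`.
    rw [h3, K.component_L_pow, hβ, map_add, map_add, hpow, h1, h2,
      K.hodge_L_pow 1 hj hα, hr', map_smul, K.component_L_pow, hβ, map_add, hpow, smul_smul,
      smul_add, ← hA, ← hB]
    simp only [map_sub, map_add, map_smul]
    module

/-! ### Formal adjoints and their Laplacians -/

/-- The operator `i[Λ, ∂̄]`, the formal adjoint of `∂`. -/
def delAdj : Ω →ₗ[ℂ] Ω := Complex.I • (K.Lam ∘ₗ K.delbar - K.delbar ∘ₗ K.Lam)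

/-- The operator `-i[Λ, ∂]`, the formal adjoint of `∂̄`. -/
def delbarAdj : Ω →ₗ[ℂ] Ω := -(Complex.I • (K.Lam ∘ₗ K.del - K.del ∘ₗ K.Lam))

/-- The formal adjoints of `d`, `∂`, `∂̄`. -/
def diffAdj : Differential → (Ω →ₗ[ℂ] Ω)
  | .total => K.delAdj + K.delbarAdj
  | .hol => K.delAdj
  | .antihol => K.delbarAdj

/-- The Laplacian `Δ_∂`. -/
def lap : Ω →ₗ[ℂ] Ω := laplacian K.del K.delAdj

/-- Expanding both commutators gives the same four words in `∂`, `∂̄`, `Λ` once `∂∂̄ = -∂̄∂` is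
used; adjointness plays no role. -/
theorem laplacian_delbar : laplacian K.delbar K.delbarAdj = K.lap := by
  ext ω
  simp only [lap, laplacian, delAdj, delbarAdj, LinearMap.add_apply, LinearMap.comp_apply,
    LinearMap.smul_apply, LinearMap.sub_apply, LinearMap.neg_apply, map_smul, map_sub, map_neg,
    K.del_delbar]
  module

/-- The cross terms cancel: the formal adjoint of `∂̄` is a multiple of `[Λ, ∂]`, which anticommutes
with `∂` because `∂² = 0`, and likewise with the roles exchanged. -/
theorem laplacian_total : laplacian C.d (K.delAdj + K.delbarAdj) = (2 : ℂ) • K.lap := by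
  have hd : C.d = K.del + K.delbar := K.integrable
  have h1 : laplacian C.d (K.delAdj + K.delbarAdj) =
      K.lap + laplacian K.delbar K.delbarAdj := by
    ext ω
    simp only [hd, lap, laplacian, delAdj, delbarAdj, LinearMap.add_apply, LinearMap.comp_apply,
      LinearMap.smul_apply, LinearMap.sub_apply, LinearMap.neg_apply, map_smul, map_sub, map_neg,
      map_add, K.del_delbar, K.del_del, K.delbar_delbar, map_zero]
    module
  rw [h1, laplacian_delbar, two_smul]

/-- The Laplacians of `d`, `∂`, `∂̄` are proportional. -/
theorem laplacian_diff (t : Differential) :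
    ∃ c : ℂ, c ≠ 0 ∧ laplacian (K.diff t) (K.diffAdj t) = c • K.lap := by
  cases t
  · exact ⟨2, by norm_num, K.laplacian_total⟩
  · exact ⟨1, by norm_num, by rw [one_smul]; rfl⟩
  · exact ⟨1, by norm_num, by rw [one_smul]; exact K.laplacian_delbar⟩

/-- As `L` commutes with `∂̄`, the commutator is `i([L, Λ]∂̄ - ∂̄[L, Λ])`. The scalars `k + 1 - n`
and `k - n` by which `[L, Λ]` acts in the two degrees differ by one. -/
theorem L_delAdj (ω : Ω) : K.L (K.delAdj ω) = K.delAdj (K.L ω) + Complex.I • K.delbar ω := by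
  refine K.mem_bideg_induction (p := fun ω => K.L (K.delAdj ω) =
    K.delAdj (K.L ω) + Complex.I • K.delbar ω) (by simp)
    (fun x y hx hy => by simp only [map_add, hx, hy, smul_add]; abel) (fun q ω hω => ?_) ω
  have h1 := K.L_Lam_sub_Lam_L (K.bideg_le_deg q hω)
  have h2 := K.L_Lam_sub_Lam_L (K.bideg_le_deg _ (K.component_mem (0, 1) hω))
  change K.L (K.Lam (K.delbar ω)) - K.Lam (K.L (K.delbar ω)) = _ • K.delbar ω at h2
  have h3 : ∀ x, K.delbar (K.L x) = K.L (K.delbar x) := K.component_L (0, 1)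
  have h4 := congrArg K.delbar h1
  rw [map_sub, h3, map_smul] at h4
  simp only [delAdj, LinearMap.smul_apply, LinearMap.sub_apply, LinearMap.comp_apply, map_smul,
    map_sub, h3]
  rw [← smul_add]
  congr 1
  rw [sub_eq_iff_eq_add] at h2 h4
  rw [h2, h4]
  simp only [Prod.fst_add, Prod.snd_add]
  push_cast
  module

/-- By `L_delAdj` the commutator of `L` with the Laplacian is `i(∂∂̄ + ∂̄∂) = 0`. -/
theorem lap_L (ω : Ω) : K.lap (K.L ω) = K.L (K.lap ω) := by
  have h3 : ∀ x, K.del (K.L x) = K.L (K.del x) := K.component_L (1, 0)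
  simp only [lap, laplacian, LinearMap.add_apply, LinearMap.comp_apply, map_add, h3, L_delAdj]
  rw [← h3 (K.delAdj ω), L_delAdj]
  simp only [map_add, map_smul, K.del_delbar]
  module

theorem component_lowered_mem {v w : ℕ × ℕ} (hvw : v + w = (1, 1)) {p : ℕ × ℕ} {ω : Ω}
    (hω : ω ∈ K.lowered (p + w)) : K.component v ω ∈ K.bideg p := by
  rw [HermitianStructure.lowered] at hω
  split_ifs at hω with h
  · have h1 := K.component_mem v hω
    convert h1 using 2
    simp only [Prod.ext_iff, Prod.fst_add, Prod.snd_add] at hvw h ⊢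
    omega
  · rw [(Submodule.mem_bot ℂ).1 hω, map_zero]; exact Submodule.zero_mem _

theorem component_component_lowered_mem {v w : ℕ × ℕ} (hvw : v + w = (1, 1)) {p : ℕ × ℕ} {ω : Ω}
    (hω : ω ∈ K.lowered p) : K.component w (K.component v ω) ∈ K.bideg p := by
  rw [HermitianStructure.lowered] at hω
  split_ifs at hω with h
  · have h1 := K.component_mem w (K.component_mem v hω)
    convert h1 using 2
    simp only [Prod.ext_iff, Prod.fst_add, Prod.snd_add] at hvw h ⊢
    omega
  · rw [(Submodule.mem_bot ℂ).1 hω, map_zero, map_zero]; exact Submodule.zero_mem _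

/-- Each of the four words contains `∂`, `∂̄` and `Λ` once, so its bidegree is `(1,0) + (0,1) -
(1,1)`. `lowered` keeps the intermediate subtraction honest. -/
theorem lap_mem_bideg (p : ℕ × ℕ) (ω : Ω) (hω : ω ∈ K.bideg p) : K.lap ω ∈ K.bideg p := by
  simp only [lap, laplacian, delAdj, LinearMap.add_apply, LinearMap.comp_apply,
    LinearMap.smul_apply, LinearMap.sub_apply, map_smul, map_sub]
  refine Submodule.add_mem _ (Submodule.smul_mem _ _ (Submodule.sub_mem _ ?_ ?_))
    (Submodule.smul_mem _ _ (Submodule.sub_mem _ ?_ ?_))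
  · exact K.component_lowered_mem (w := (0, 1)) (by simp)
      (K.Lam_mem_lowered (K.component_mem (0, 1) hω))
  · exact K.component_component_lowered_mem (by simp) (K.Lam_mem_lowered hω)
  · change K.Lam (K.delbar (K.del ω)) ∈ _
    have h1 := K.Lam_mem_lowered (K.component_mem (0, 1) (K.component_mem (1, 0) hω))
    rw [HermitianStructure.lowered, if_pos (by simp)] at h1
    exact h1
  · exact K.component_lowered_mem (w := (1, 0)) (by simp)
      (K.Lam_mem_lowered (K.component_mem (1, 0) hω))

theorem lap_mem_deg {k : ℕ} {ω : Ω} (hω : ω ∈ C.deg k) : K.lap ω ∈ C.deg k :=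
  K.map_mem_deg K.lap_mem_bideg hω

end KahlerStructure

/-! ### Faithfulness of the fibre functor -/

section Expectation

theorem haar_spec (H : Type*) [Ring H] [HopfAlgebra ℂ H] [Cosemisimple H] :
    IsHaarFunctional (haar H) :=
  (Cosemisimple.existsUnique_haar (G := H)).choose_spec.1

variable {G H : Type*} [Ring G] [StarRing G] [HopfAlgebra ℂ G] [StarModule ℂ G]
  [HopfStarAlgebra G] [Ring H] [StarRing H] [HopfAlgebra ℂ H] [StarModule ℂ H]
  [HopfStarAlgebra H] (X : QuantumHomogeneousSpace G H)

namespace QuantumHomogeneousSpace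

theorem rightCoaction_coassoc (g : G) :
    (Coalgebra.comul (R := ℂ) (A := H)).lTensor G (X.rightCoaction g) =
      TensorProduct.assoc ℂ G H H (X.rightCoaction.toLinearMap.rTensor H (X.rightCoaction g)) := by
  let p : G →ₗ[ℂ] H := (X.proj : G →ₗc[ℂ] H).toLinearMap
  have hρ : ∀ g, X.rightCoaction g = p.lTensor G (Coalgebra.comul (R := ℂ) g) := fun g => rfl
  have h1 : ∀ z : G ⊗[ℂ] G, (Coalgebra.comul (R := ℂ) (A := H)).lTensor G (p.lTensor G z) =
      (TensorProduct.map p p).lTensor G ((Coalgebra.comul (R := ℂ) (A := G)).lTensor G z) := by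
    intro z
    rw [← LinearMap.comp_apply, ← LinearMap.lTensor_comp, ← LinearMap.comp_apply,
      ← LinearMap.lTensor_comp]
    congr 2
    exact (CoalgHomClass.map_comp_comul X.proj).symm
  have h2 : ∀ z : G ⊗[ℂ] G, (TensorProduct.map p p).lTensor G
      (TensorProduct.assoc ℂ G G G ((Coalgebra.comul (R := ℂ) (A := G)).rTensor G z)) =
      TensorProduct.assoc ℂ G H H (X.rightCoaction.toLinearMap.rTensor H (p.lTensor G z)) := by
    intro z
    induction z using TensorProduct.induction_on with
    | zero => simp
    | add x y hx hy => simp only [map_add, hx, hy]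
    | tmul x y =>
      simp only [LinearMap.rTensor_tmul, LinearMap.lTensor_tmul, AlgHom.toLinearMap_apply, hρ]
      generalize Coalgebra.comul (R := ℂ) x = w
      induction w using TensorProduct.induction_on with
      | zero => simp
      | add a b ha hb => simp only [map_add, TensorProduct.add_tmul, ha, hb]
      | tmul a b => simp
  rw [hρ, h1, ← Coalgebra.coassoc_apply, h2, ← hρ]

variable [Cosemisimple H]

/-- Averaging over `H`, as a map into `G`. -/
def average : G →ₗ[ℂ] G :=
  (TensorProduct.rid ℂ G).toLinearMap ∘ₗ (haar H).lTensor G ∘ₗ X.rightCoaction.toLinearMap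

/-- Coassociativity moves the coaction past the averaging (`h1`), and invariance `(id ⊗ h)Δ = h · 1`
of the Haar functional of `H` leaves `1` in the second leg (`h2`). -/
theorem average_mem (g : G) : X.average g ∈ X.M := by
  change X.rightCoaction (X.average g) = X.average g ⊗ₜ[ℂ] (1 : H)
  have h1 : ∀ z : G ⊗[ℂ] H,
      X.rightCoaction (TensorProduct.rid ℂ G ((haar H).lTensor G z)) =
        ((TensorProduct.rid ℂ H).toLinearMap ∘ₗ (haar H).lTensor H).lTensor G
          (TensorProduct.assoc ℂ G H H (X.rightCoaction.toLinearMap.rTensor H z)) := by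
    intro z
    induction z using TensorProduct.induction_on with
    | zero => simp
    | add x y hx hy => simp only [map_add, hx, hy]
    | tmul x y =>
      simp only [LinearMap.rTensor_tmul, LinearMap.lTensor_tmul, AlgHom.toLinearMap_apply,
        TensorProduct.rid_tmul, map_smul]
      generalize X.rightCoaction x = w
      induction w using TensorProduct.induction_on with
      | zero => simp
      | add a b ha hb => simp only [map_add, TensorProduct.add_tmul, smul_add, ha, hb]
      | tmul a b => simp
  have h2 : ∀ z : G ⊗[ℂ] H,
      ((TensorProduct.rid ℂ H).toLinearMap ∘ₗ (haar H).lTensor H).lTensor G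
        ((Coalgebra.comul (R := ℂ) (A := H)).lTensor G z) =
      (TensorProduct.rid ℂ G ((haar H).lTensor G z)) ⊗ₜ[ℂ] (1 : H) := by
    intro z
    induction z using TensorProduct.induction_on with
    | zero => simp
    | add x y hx hy => simp only [map_add, TensorProduct.add_tmul, hx, hy]
    | tmul x y =>
      simp only [LinearMap.lTensor_tmul, LinearMap.comp_apply, LinearEquiv.coe_coe,
        (haar_spec H).2.1, TensorProduct.rid_tmul, TensorProduct.smul_tmul, TensorProduct.tmul_smul]
  change X.rightCoaction (TensorProduct.rid ℂ G ((haar H).lTensor G (X.rightCoaction g))) = _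
  rw [h1, ← rightCoaction_coassoc, h2]
  rfl

/-- The projection `G → M` given by averaging over `H`. -/
def expectation : G →ₗ[ℂ] X.M :=
  X.average.codRestrict (Subalgebra.toSubmodule X.M.toSubalgebra) X.average_mem

theorem expectation_one : X.expectation 1 = 1 := by
  apply Subtype.ext
  change TensorProduct.rid ℂ G ((haar H).lTensor G (X.rightCoaction 1)) = 1
  rw [map_one, Algebra.TensorProduct.one_def]
  simp [(haar_spec H).1]

/-- The coaction is multiplicative and `m` is coinvariant. Right `M`-linearity is what lets
`descend` detect `M⁺Ω`. -/
theorem expectation_mul (g : G) (m : X.M) :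
    X.expectation (g * m) = X.expectation g * m := by
  apply Subtype.ext
  change TensorProduct.rid ℂ G ((haar H).lTensor G (X.rightCoaction (g * m))) =
    TensorProduct.rid ℂ G ((haar H).lTensor G (X.rightCoaction g)) * m
  have hm : X.rightCoaction (m : G) = (m : G) ⊗ₜ[ℂ] (1 : H) := m.2
  rw [map_mul, hm]
  generalize X.rightCoaction g = z
  induction z using TensorProduct.induction_on with
  | zero => simp
  | add x y hx hy => simp only [map_add, add_mul, hx, hy]
  | tmul x y => simp

end QuantumHomogeneousSpace

variable {X} {Ω : Type*} [Ring Ω] [Algebra ℂ Ω] {C : StarCalculus X.M Ω}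

namespace CovariantCalculus

variable (D : CovariantCalculus C) [Cosemisimple H]

/-- The map `x ⊗ y ⊗ ω ↦ E(x S(y)) ω`, with `E : G → M` the averaging projection. -/
def descend : G ⊗[ℂ] (G ⊗[ℂ] Ω) →ₗ[ℂ] Ω :=
  LinearMap.mul' ℂ Ω ∘ₗ
    (C.incl.toLinearMap ∘ₗ X.expectation ∘ₗ LinearMap.mul' ℂ G ∘ₗ
      (HopfAlgebra.antipode ℂ (A := G)).lTensor G).rTensor Ω ∘ₗ
    (TensorProduct.assoc ℂ G G Ω).symm.toLinearMap

theorem descend_tmul (x y : G) (ω : Ω) : descend (C := C) (x ⊗ₜ[ℂ] (y ⊗ₜ[ℂ] ω)) =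
    C.incl (X.expectation (x * HopfAlgebra.antipode ℂ y)) * ω := by
  simp [descend]

/-- The antipode axiom `x₍₁₎ S(x₍₂₎) = ε(x)` collapses `E(ω₍₋₂₎ S(ω₍₋₁₎)) ω₍₀₎` to `ω`. -/
theorem descend_coaction (ω : Ω) :
    descend (C := C) (D.coaction.toLinearMap.lTensor G (D.coaction ω)) = ω := by
  rw [← D.coassoc]
  have h : ∀ z : G ⊗[ℂ] Ω, descend (C := C) (TensorProduct.assoc ℂ G G Ω
      ((Coalgebra.comul (R := ℂ) (A := G)).rTensor Ω z)) =
      TensorProduct.lid ℂ Ω ((Coalgebra.counit (R := ℂ) (A := G)).rTensor Ω z) := by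
    intro z
    induction z using TensorProduct.induction_on with
    | zero => simp
    | add x y hx hy => simp only [map_add, hx, hy]
    | tmul x y =>
      simp [descend, Algebra.algebraMap_eq_smul_one, X.expectation_one]
  rw [h, D.counit_coaction]

/-- Since `S` reverses products and `E` is right `M`-linear, a left factor `g ⊗ m` contributes `S(g)
m` at the right end inside `E`. For `t` the coaction of `m ∈ M⁺` this is `S(m₍₁₎) m₍₂₎ = ε(m) = 0`.
-/
theorem descend_incl_mul (x : G) (t : G ⊗[ℂ] X.M)
    (ht : LinearMap.mul' ℂ G ((HopfAlgebra.antipode ℂ (A := G)).rTensor G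
      (X.M.subtype.toLinearMap.lTensor G t)) = 0) (w : G ⊗[ℂ] Ω) :
    descend (C := C) (x ⊗ₜ[ℂ] (C.incl.toLinearMap.lTensor G t * w)) = 0 := by
  induction w using TensorProduct.induction_on with
  | zero => simp
  | add a b ha hb => rw [mul_add, TensorProduct.tmul_add, map_add, ha, hb, add_zero]
  | tmul y ν =>
    have h : ∀ t : G ⊗[ℂ] X.M,
        descend (C := C) (x ⊗ₜ[ℂ] (C.incl.toLinearMap.lTensor G t * y ⊗ₜ[ℂ] ν)) =
        C.incl (X.expectation (x * HopfAlgebra.antipode ℂ y *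
          LinearMap.mul' ℂ G ((HopfAlgebra.antipode ℂ (A := G)).rTensor G
            (X.M.subtype.toLinearMap.lTensor G t)))) * ν := by
      intro t
      induction t using TensorProduct.induction_on with
      | zero => simp
      | add a b ha hb =>
        simp only [map_add, add_mul, mul_add, TensorProduct.tmul_add, ha, hb]
      | tmul g m =>
        have h1 := X.expectation_mul
          (x * (HopfAlgebra.antipode ℂ y * HopfAlgebra.antipode ℂ g)) m
        simp only [LinearMap.lTensor_tmul, LinearMap.rTensor_tmul, LinearMap.mul'_apply,
          Algebra.TensorProduct.tmul_mul_tmul, descend_tmul, HopfAlgebra.antipode_mul_antidistrib,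
          AlgHom.toLinearMap_apply]
        rw [← mul_assoc, ← map_mul, ← h1]
        congr 3
        simp only [mul_assoc]
        rfl
    rw [h, ht]
    simp

theorem descend_plus {u : Ω} (hu : u ∈ plusSubmodule C) (x : G) :
    descend (C := C) (x ⊗ₜ[ℂ] D.coaction u) = 0 := by
  induction hu using Submodule.span_induction with
  | zero => simp
  | add a b _ _ ha hb => rw [map_add, TensorProduct.tmul_add, map_add, ha, hb, add_zero]
  | smul c a _ ha => rw [map_smul, TensorProduct.tmul_smul, map_smul, ha, smul_zero]
  | mem u hu =>
    obtain ⟨m, hm, ω, rfl⟩ := hu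
    obtain ⟨t, ht, ht'⟩ := D.coaction_incl m
    rw [map_mul, ht']
    refine descend_incl_mul x t ?_ _
    rw [ht, HopfAlgebra.mul_antipode_rTensor_comul_apply]
    have : Coalgebra.counit (R := ℂ) (m : G) = 0 := hm
    rw [this, map_zero]

/-- The map `Ω → G ⊗ Φ(Ω)`, `ω ↦ ω₍₋₁₎ ⊗ [ω₍₀₎]`. -/
def toFiber : Ω →ₗ[ℂ] G ⊗[ℂ] (Ω ⧸ plusSubmodule C) :=
  (plusSubmodule C).mkQ.lTensor G ∘ₗ D.coaction.toLinearMap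

/-- If `ω` maps to zero, right exactness of the tensor product puts its coaction in `G ⊗ M⁺Ω`.
Coacting again and applying `descend` gives zero there, but gives back `ω` by `descend_coaction`. -/
theorem toFiber_injective : Function.Injective D.toFiber := by
  rw [injective_iff_map_eq_zero]
  intro ω hω
  have hex : Function.Exact (plusSubmodule C).subtype (plusSubmodule C).mkQ := by
    rw [LinearMap.exact_iff]; simp
  have h1 : D.coaction ω ∈ LinearMap.range ((plusSubmodule C).subtype.lTensor G) :=
    (lTensor_exact G hex (Submodule.mkQ_surjective _) _).1 hω
  rw [← D.descend_coaction ω]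
  refine range_lTensor_induction (p := fun z =>
    descend (C := C) (D.coaction.toLinearMap.lTensor G z) = 0) (by simp)
    (fun x y hx hy => by rw [map_add, map_add, hx, hy, add_zero]) (fun v u hu => ?_) h1
  rw [LinearMap.lTensor_tmul]
  exact D.descend_plus hu v

end CovariantCalculus

end Expectation

/-! ### Equivariant operators -/

section Equivariant

variable {G H : Type*} [Ring G] [StarRing G] [HopfAlgebra ℂ G] [StarModule ℂ G]
  [HopfStarAlgebra G] [Ring H] [StarRing H] [HopfAlgebra ℂ H] [StarModule ℂ H]
  [HopfStarAlgebra H] {X : QuantumHomogeneousSpace G H} {Ω : Type*} [Ring Ω] [Algebra ℂ Ω]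
  {C : StarCalculus X.M Ω}

namespace CovariantCalculus

variable (D : CovariantCalculus C)

/-- Left `G`-colinear operators on `Ω`. -/
def IsEquivariant (T : Ω →ₗ[ℂ] Ω) : Prop :=
  ∀ ω, D.coaction (T ω) = T.lTensor G (D.coaction ω)

/-- The action `ω ↦ φ(ω₍₋₁₎) ω₍₀₎` of the linear dual of `G`. -/
def act (φ : G →ₗ[ℂ] ℂ) : Ω →ₗ[ℂ] Ω := slice φ ∘ₗ D.coaction.toLinearMap

theorem act_apply (φ : G →ₗ[ℂ] ℂ) (ω : Ω) : D.act φ ω = slice φ (D.coaction ω) := rfl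

variable {D}

/-- Slices separate tensors. In this form equivariance can be treated as ordinary commutation of
operators on `Ω`. -/
theorem isEquivariant_iff {T : Ω →ₗ[ℂ] Ω} :
    D.IsEquivariant T ↔ ∀ φ ω, D.act φ (T ω) = T (D.act φ ω) := by
  refine ⟨fun h φ ω => ?_, fun h ω => eq_of_slice_eq fun φ => ?_⟩
  · rw [act_apply, act_apply, h, slice_lTensor]
  · rw [slice_lTensor, ← act_apply, h, act_apply]

theorem IsEquivariant.comp {S T : Ω →ₗ[ℂ] Ω} (hS : D.IsEquivariant S) (hT : D.IsEquivariant T) :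
    D.IsEquivariant (S ∘ₗ T) := by
  rw [isEquivariant_iff] at *
  intro φ ω
  rw [LinearMap.comp_apply, hS, hT, LinearMap.comp_apply]

theorem IsEquivariant.add {S T : Ω →ₗ[ℂ] Ω} (hS : D.IsEquivariant S) (hT : D.IsEquivariant T) :
    D.IsEquivariant (S + T) := by
  rw [isEquivariant_iff] at *
  intro φ ω
  rw [LinearMap.add_apply, map_add, hS, hT, LinearMap.add_apply]

theorem IsEquivariant.sub {S T : Ω →ₗ[ℂ] Ω} (hS : D.IsEquivariant S) (hT : D.IsEquivariant T) :
    D.IsEquivariant (S - T) := by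
  rw [isEquivariant_iff] at *
  intro φ ω
  rw [LinearMap.sub_apply, map_sub, hS, hT, LinearMap.sub_apply]

theorem IsEquivariant.smul {T : Ω →ₗ[ℂ] Ω} (c : ℂ) (hT : D.IsEquivariant T) :
    D.IsEquivariant (c • T) := by
  rw [isEquivariant_iff] at *
  intro φ ω
  rw [LinearMap.smul_apply, map_smul, hT, LinearMap.smul_apply]

variable (D)

/-- The subspace of the forms `ω` whose coaction lies in `c ⊗ Ω`. -/
def coefficientSpace (c : Submodule ℂ G) : Submodule ℂ Ω :=
  (LinearMap.range (c.subtype.rTensor Ω)).comap D.coaction.toLinearMap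

variable {D}

theorem IsEquivariant.map_mem_coefficientSpace {T : Ω →ₗ[ℂ] Ω} (hT : D.IsEquivariant T)
    {c : Submodule ℂ G} {ω : Ω} (hω : ω ∈ D.coefficientSpace c) :
    T ω ∈ D.coefficientSpace c := by
  obtain ⟨z, hz⟩ := hω
  refine ⟨T.lTensor c z, ?_⟩
  rw [AlgHom.toLinearMap_apply] at hz ⊢
  rw [hT, ← hz]
  simp only [← LinearMap.comp_apply, LinearMap.lTensor_comp_rTensor, LinearMap.rTensor_comp_lTensor]

variable (D)

theorem exists_mem_coefficientSpace (ω : Ω) :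
    ∃ c : Submodule ℂ G, FiniteDimensional ℂ c ∧ ω ∈ D.coefficientSpace c := by
  obtain ⟨c, hc, h⟩ := TensorProduct.exists_finite_submodule_left_of_setFinite
    {D.coaction ω} (Set.finite_singleton _)
  exact ⟨c, hc, h (Set.mem_singleton _)⟩

/-- The injection `toFiber` sends this space into the image of `c ⊗ Φ(Ω)`, and `Φ(Ω)` is
finite-dimensional. -/
theorem finiteDimensional_coefficientSpace [Cosemisimple H] (c : Submodule ℂ G)
    [FiniteDimensional ℂ c] : FiniteDimensional ℂ (D.coefficientSpace c) := by
  have := D.finiteDimensional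
  let R : Submodule ℂ (G ⊗[ℂ] (Ω ⧸ plusSubmodule C)) :=
    LinearMap.range (c.subtype.rTensor (Ω ⧸ plusSubmodule C))
  have hR : ∀ ω ∈ D.coefficientSpace c, D.toFiber ω ∈ R := by
    rintro ω ⟨z, hz⟩
    refine ⟨(plusSubmodule C).mkQ.lTensor c z, ?_⟩
    rw [AlgHom.toLinearMap_apply] at hz
    rw [toFiber, LinearMap.comp_apply, AlgHom.toLinearMap_apply, ← hz]
    simp only [← LinearMap.comp_apply, LinearMap.lTensor_comp_rTensor,
      LinearMap.rTensor_comp_lTensor]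
  let f : D.coefficientSpace c →ₗ[ℂ] R := D.toFiber.restrict hR
  have hf : Function.Injective f := fun x y hxy =>
    Subtype.ext (D.toFiber_injective (congrArg Subtype.val hxy))
  have hfin : FiniteDimensional ℂ R := Module.Finite.range _
  have : IsNoetherian ℂ R := isNoetherian_of_isNoetherianRing_of_finite ℂ R
  exact Module.Finite.of_injective f hf

end CovariantCalculus

/-! ### Covariance of `L`, of the Lefschetz operators and of the projections -/

namespace HermitianStructure

variable {n : ℕ} {K : HermitianStructure C n} {D : CovariantCalculus C}

theorem IsCovariant.act_L (hK : K.IsCovariant D) (φ : G →ₗ[ℂ] ℂ) (ω : Ω) :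
    D.act φ (K.L ω) = K.L (D.act φ ω) := by
  refine CovariantCalculus.isEquivariant_iff.1 (fun ω => ?_) φ ω
  rw [L_apply, map_mul, hK.form_coinvariant]
  generalize D.coaction ω = z
  induction z using TensorProduct.induction_on with
  | zero => simp
  | add x y hx hy => rw [mul_add, hx, hy, map_add]
  | tmul x y => simp [L_apply]

theorem IsCovariant.act_mem_bideg (hK : K.IsCovariant D) (φ : G →ₗ[ℂ] ℂ) (p : ℕ × ℕ) (ω : Ω)
    (hω : ω ∈ K.bideg p) : D.act φ ω ∈ K.bideg p :=
  slice_mem_of_mem_range (hK.bideg_covariant p ω hω) φ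

/-- Every functional on `G` acts by an operator that commutes with `L` and preserves bidegree, hence
respects the Lefschetz decomposition. The result covers both `Λ` and the Hodge maps, which are such
operators by definition. -/
theorem IsCovariant.lefschetzOp (hK : K.IsCovariant D) (c : LefschetzIndex n → ℂ)
    (m : LefschetzIndex n → ℕ) : D.IsEquivariant (K.lefschetzOp c m) :=
  CovariantCalculus.isEquivariant_iff.2 fun φ ω =>
    map_lefschetzOp_of_commute (hK.act_L φ) (hK.act_mem_bideg φ) c m ω

theorem proj_bideg_of_map_mem {T : Ω →ₗ[ℂ] Ω} (hT : ∀ p, ∀ ω ∈ K.bideg p, T ω ∈ K.bideg p)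
    (p : ℕ × ℕ) (ω : Ω) :
    T (GradedAlgebra.proj K.bideg p ω) = GradedAlgebra.proj K.bideg p (T ω) := by
  refine K.mem_bideg_induction (p := fun ω => T (GradedAlgebra.proj K.bideg p ω) =
    GradedAlgebra.proj K.bideg p (T ω)) (by simp)
    (fun x y hx hy => by simp only [map_add, hx, hy]) (fun q ω hω => ?_) ω
  by_cases h : q = p
  · subst h
    rw [K.proj_bideg_of_mem hω, K.proj_bideg_of_mem (hT _ _ hω)]
  · rw [K.proj_bideg_of_mem_ne hω h, K.proj_bideg_of_mem_ne (hT _ _ hω) h, map_zero]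

theorem proj_deg_of_map_mem {T : Ω →ₗ[ℂ] Ω} (hT : ∀ p, ∀ ω ∈ K.bideg p, T ω ∈ K.bideg p)
    (k : ℕ) (ω : Ω) :
    T (GradedAlgebra.proj C.deg k ω) = GradedAlgebra.proj C.deg k (T ω) := by
  refine K.mem_bideg_induction (p := fun ω => T (GradedAlgebra.proj C.deg k ω) =
    GradedAlgebra.proj C.deg k (T ω)) (by simp)
    (fun x y hx hy => by simp only [map_add, hx, hy]) (fun q ω hω => ?_) ω
  have h1 := K.bideg_le_deg q hω
  have h2 := K.bideg_le_deg q (hT _ _ hω)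
  by_cases h : q.1 + q.2 = k
  · subst h
    rw [proj_deg_of_mem h1, proj_deg_of_mem h2]
  · rw [proj_deg_of_mem_ne h1 h, proj_deg_of_mem_ne h2 h, map_zero]

theorem IsCovariant.proj_bideg (hK : K.IsCovariant D) (p : ℕ × ℕ) :
    D.IsEquivariant (GradedAlgebra.proj K.bideg p) :=
  CovariantCalculus.isEquivariant_iff.2 fun φ ω =>
    proj_bideg_of_map_mem (hK.act_mem_bideg φ) p ω

theorem IsCovariant.proj_deg (hK : K.IsCovariant D) (k : ℕ) :
    D.IsEquivariant (GradedAlgebra.proj C.deg k) :=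
  CovariantCalculus.isEquivariant_iff.2 fun φ ω =>
    proj_deg_of_map_mem (hK.act_mem_bideg φ) k ω

theorem IsCovariant.coaction_mem_deg (hK : K.IsCovariant D) {k : ℕ} {ω : Ω} (hω : ω ∈ C.deg k) :
    D.coaction ω ∈ LinearMap.range ((C.deg k).subtype.lTensor G) := by
  have hle : C.deg k ≤
      (LinearMap.range ((C.deg k).subtype.lTensor G)).comap D.coaction.toLinearMap := by
    conv_lhs => rw [K.deg_eq k]
    refine iSup₂_le fun p hp ω hω => ?_
    rw [Finset.HasAntidiagonal.mem_antidiagonal] at hp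
    refine range_lTensor_induction (p := fun z => z ∈ LinearMap.range
      ((C.deg k).subtype.lTensor G)) (Submodule.zero_mem _) (fun x y => Submodule.add_mem _)
      (fun v u hu => ?_) (hK.bideg_covariant p ω hω)
    exact ⟨v ⊗ₜ[ℂ] ⟨u, hp ▸ K.bideg_le_deg p hu⟩, by simp⟩
  exact hle hω

end HermitianStructure

/-! ### The coaction and the involution -/

namespace StarCalculus

/-- The antilinear map `x ⊗ ω ↦ x* ⊗ ω*`. -/
def tensorConj (C : StarCalculus X.M Ω) : G ⊗[ℂ] Ω →ₛₗ[starRingEnd ℂ] G ⊗[ℂ] Ω :=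
  TensorProduct.map (starLinearEquiv ℂ (A := G)).toLinearMap C.conj

@[simp]
theorem tensorConj_tmul (x : G) (ω : Ω) : C.tensorConj (x ⊗ₜ[ℂ] ω) = star x ⊗ₜ[ℂ] C.conj ω := rfl

theorem tensorConj_mul {k l : ℕ} {z w : G ⊗[ℂ] Ω}
    (hz : z ∈ LinearMap.range ((C.deg k).subtype.lTensor G))
    (hw : w ∈ LinearMap.range ((C.deg l).subtype.lTensor G)) :
    C.tensorConj (z * w) = (-1 : ℂ) ^ (k * l) • (C.tensorConj w * C.tensorConj z) := by
  refine range_lTensor_induction (p := fun z => C.tensorConj (z * w) =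
    (-1 : ℂ) ^ (k * l) • (C.tensorConj w * C.tensorConj z)) (by simp)
    (fun x y hx hy => by simp only [add_mul, map_add, mul_add, smul_add, hx, hy])
    (fun x u hu => ?_) hz
  refine range_lTensor_induction (p := fun w => C.tensorConj (x ⊗ₜ[ℂ] u * w) =
    (-1 : ℂ) ^ (k * l) • (C.tensorConj w * C.tensorConj (x ⊗ₜ[ℂ] u))) (by simp)
    (fun x y hx hy => by simp only [add_mul, map_add, mul_add, smul_add, hx, hy])
    (fun y v hv => ?_) hw
  simp only [Algebra.TensorProduct.tmul_mul_tmul, tensorConj_tmul, C.conj_mul k l u hu v hv,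
    star_mul, TensorProduct.tmul_smul]

end StarCalculus

namespace HermitianStructure

variable {n : ℕ} {K : HermitianStructure C n} {D : CovariantCalculus C}

theorem coaction_conj_incl (m : X.M) :
    D.coaction (C.conj (C.incl m)) = C.tensorConj (D.coaction (C.incl m)) := by
  obtain ⟨t, ht, ht'⟩ := D.coaction_incl m
  obtain ⟨s, hs, hs'⟩ := D.coaction_incl (star m)
  have h1 : ∀ t : G ⊗[ℂ] X.M, X.M.subtype.toLinearMap.lTensor G (star t) =
      star (X.M.subtype.toLinearMap.lTensor G t) := by
    intro t
    induction t using TensorProduct.induction_on with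
    | zero => simp
    | add a b ha hb => rw [star_add, map_add, ha, hb, map_add, star_add]
    | tmul x y => simp [TensorProduct.star_tmul]
  have h2 : ∀ t : G ⊗[ℂ] X.M, C.tensorConj (C.incl.toLinearMap.lTensor G t) =
      C.incl.toLinearMap.lTensor G (star t) := by
    intro t
    induction t using TensorProduct.induction_on with
    | zero => simp
    | add a b ha hb => rw [star_add, map_add, map_add, ha, hb, map_add]
    | tmul x y => simp [TensorProduct.star_tmul, C.conj_incl]
  -- The lifts `t` and `s` to `G ⊗ M` are determined by their images in `G ⊗ G`, by flatness over
  -- `ℂ`; there the identity is that `Δ` is a `*`-map.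
  have hinj : Function.Injective (X.M.subtype.toLinearMap.lTensor G) :=
    Module.Flat.lTensor_preserves_injective_linearMap _ Subtype.val_injective
  have hst : s = star t := by
    apply hinj
    rw [h1, ht, hs, ← HopfStarAlgebra.comul_star]
    rfl
  rw [C.conj_incl, hs', ht', h2, hst]

theorem IsCovariant.coaction_conj_mul (hK : K.IsCovariant D) {k l : ℕ} {ω ν : Ω}
    (hω : ω ∈ C.deg k) (hν : ν ∈ C.deg l)
    (h1 : D.coaction (C.conj ω) = C.tensorConj (D.coaction ω))
    (h2 : D.coaction (C.conj ν) = C.tensorConj (D.coaction ν)) :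
    D.coaction (C.conj (ω * ν)) = C.tensorConj (D.coaction (ω * ν)) := by
  rw [C.conj_mul k l _ hω _ hν, map_smul, map_mul, map_mul, h1, h2,
    StarCalculus.tensorConj_mul (hK.coaction_mem_deg hω) (hK.coaction_mem_deg hν)]

theorem coaction_conj_d {ω : Ω} (h : D.coaction (C.conj ω) = C.tensorConj (D.coaction ω)) :
    D.coaction (C.conj (C.d ω)) = C.tensorConj (D.coaction (C.d ω)) := by
  rw [← C.d_conj, D.coaction_d, D.coaction_d, h]
  generalize D.coaction ω = z
  induction z using TensorProduct.induction_on with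
  | zero => simp
  | add a b ha hb => simp only [map_add, ha, hb]
  | tmul x y => simp [C.d_conj]

/-- The involution is compatible with the coaction. -/
theorem IsCovariant.coaction_conj (hK : K.IsCovariant D) (ω : Ω) :
    D.coaction (C.conj ω) = C.tensorConj (D.coaction ω) := by
  have hincl : ∀ m : X.M, C.incl m ∈ C.deg 0 := fun m => by
    rw [← C.range_incl]; exact ⟨m, rfl⟩
  -- Compatibility is known on `M` and passes to `d` and to products, so it reaches the spanning
  -- forms `a₀ da₁ ⋯ daₖ`. Degrees are tracked for the sign in the involution of a product.
  have hprod : ∀ k (a : Fin k → X.M),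
      (List.ofFn fun i => C.d (C.incl (a i))).prod ∈ C.deg k ∧
      D.coaction (C.conj (List.ofFn fun i => C.d (C.incl (a i))).prod) =
        C.tensorConj (D.coaction (List.ofFn fun i => C.d (C.incl (a i))).prod) := by
    intro k
    induction k with
    | zero =>
      intro a
      rw [List.ofFn_zero, List.prod_nil, ← map_one C.incl]
      exact ⟨hincl 1, coaction_conj_incl 1⟩
    | succ k ih =>
      intro a
      obtain ⟨ih1, ih2⟩ := ih fun i => a i.succ
      have h1 := C.d_mem 0 _ (hincl (a 0))
      rw [List.ofFn_succ, List.prod_cons]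
      refine ⟨?_, hK.coaction_conj_mul h1 ih1 (coaction_conj_d (coaction_conj_incl _)) ih2⟩
      have := SetLike.mul_mem_graded h1 ih1
      rwa [show 0 + 1 + k = k + 1 by ring] at this
  have hdeg : ∀ k, ∀ ω ∈ C.deg k, D.coaction (C.conj ω) = C.tensorConj (D.coaction ω) := by
    intro k ω hω
    rw [C.deg_eq_span k] at hω
    induction hω using Submodule.span_induction with
    | zero => simp
    | add x y _ _ hx hy => simp only [map_add, hx, hy]
    | smul c x _ hx => simp only [map_smulₛₗ, RingHom.id_apply, hx]
    | mem x hx =>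
      obtain ⟨a₀, a, rfl⟩ := hx
      exact hK.coaction_conj_mul (hincl a₀) (hprod k a).1 (coaction_conj_incl a₀) (hprod k a).2
  refine K.mem_bideg_induction (p := fun ω => D.coaction (C.conj ω) =
    C.tensorConj (D.coaction ω)) (by simp)
    (fun x y hx hy => by simp only [map_add, hx, hy]) (fun q ω hω => ?_) ω
  exact hdeg _ _ (K.bideg_le_deg q hω)

end HermitianStructure

end Equivariant

/-! ### Positivity of the global inner product -/

section Positive

namespace DifferentialCalculus

variable {A : Type*} [Ring A] [Algebra ℂ A] {Ω : Type*} [Ring Ω] [Algebra ℂ Ω]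
  (C : DifferentialCalculus A Ω)

theorem incl_mem (a : A) : C.incl a ∈ C.deg 0 := by
  rw [← C.range_incl]; exact ⟨a, rfl⟩

theorem toZero_incl (a : A) : C.toZero (C.incl a) = a := by
  simp only [toZero, LinearMap.comp_apply, LinearEquiv.coe_coe,
    DirectSum.decomposeLinearEquiv_apply]
  rw [DirectSum.decompose_of_mem _ (C.incl_mem a)]
  have h1 : DirectSum.component ℂ ℕ (fun k => C.deg k) 0
      (DirectSum.of (fun k => C.deg k) 0 ⟨C.incl a, C.incl_mem a⟩) = ⟨C.incl a, C.incl_mem a⟩ :=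
    DirectSum.component.lof_self ..
  rw [h1, zeroEquiv, LinearEquiv.symm_apply_eq]
  rfl

theorem toZero_of_mem {k : ℕ} (hk : k ≠ 0) {ω : Ω} (hω : ω ∈ C.deg k) : C.toZero ω = 0 := by
  simp only [toZero, LinearMap.comp_apply, LinearEquiv.coe_coe,
    DirectSum.decomposeLinearEquiv_apply]
  have h1 : DirectSum.component ℂ ℕ (fun k => C.deg k) 0 (DirectSum.decompose C.deg ω) = 0 :=
    Subtype.ext (DirectSum.decompose_of_mem_ne _ hω hk)
  rw [h1, map_zero]

end DifferentialCalculus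

namespace HermitianStructure

section General

variable {A : Type*} [Ring A] [Algebra ℂ A] [StarRing A] {Ω : Type*} [Ring Ω] [Algebra ℂ Ω]
  {C : StarCalculus A Ω} {n : ℕ} (K : HermitianStructure C n)

theorem hodge_mem_deg (h : ℝ) {k : ℕ} {ω : Ω} (hω : ω ∈ C.deg k) :
    K.hodge h ω ∈ C.deg (2 * n - k) := by
  refine K.lefschetz_induction_deg (p := fun ω => K.hodge h ω ∈ C.deg (2 * n - k)) (by simp)
    (fun x y hx hy => by rw [map_add]; exact Submodule.add_mem _ hx hy)
    (fun j a b hj hk α hα => ?_) hω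
  rw [K.hodge_L_pow h hj hα]
  refine Submodule.smul_mem _ _ ?_
  have := K.L_pow_mem_deg_of_mem_bideg (j := n - j - (a + b)) hα.1
  rwa [show a + b + 2 * (n - j - (a + b)) = 2 * n - k by omega] at this

theorem vol_of_mem {h : ℝ} {k : ℕ} (hk : k ≠ 2 * n) {ω : Ω} (hω : ω ∈ C.deg k) :
    K.vol h ω = 0 := by
  rw [vol, LinearMap.comp_apply, LinearMap.comp_apply, proj_deg_of_mem_ne hω hk, map_zero,
    map_zero]

theorem vol_mul_hodge_of_ne (h h' : ℝ) {k l : ℕ} (hkl : k ≠ l) {ω ν : Ω} (hω : ω ∈ C.deg k)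
    (hν : ν ∈ C.deg l) : K.vol h (ω * K.hodge h' ν) = 0 := by
  by_cases hl : l ≤ 2 * n
  · exact K.vol_of_mem (by omega) (SetLike.mul_mem_graded hω (K.hodge_mem_deg h' hν))
  · rw [K.deg_eq_bot (by omega) hν]; simp

/-- Cross terms between different degrees do not have degree `2n`, so `vol` discards them and the
sum over degrees is superfluous. -/
theorem metric_eq (h : ℝ) (ω ν : Ω) : K.metric h ω ν = K.vol h (ω * K.hodge h (C.conj ν)) := by
  refine K.mem_bideg_induction (p := fun ω => K.metric h ω ν =
    K.vol h (ω * K.hodge h (C.conj ν))) (by simp [metric])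
    (fun x y hx hy => by
      rw [add_mul, map_add, ← hx, ← hy]
      simp only [metric, map_add, add_mul, Finset.sum_add_distrib]) (fun q ω hω => ?_) ω
  refine K.mem_bideg_induction (p := fun ν => K.metric h ω ν =
    K.vol h (ω * K.hodge h (C.conj ν))) (by simp [metric])
    (fun x y hx hy => by
      rw [map_add, map_add, mul_add, map_add, ← hx, ← hy]
      simp only [metric, map_add, mul_add, Finset.sum_add_distrib]) (fun r ν hν => ?_) ν
  have h1 := K.bideg_le_deg q hω
  have h2 := K.bideg_le_deg r hν
  rw [metric]
  by_cases hq : q.1 + q.2 ≤ 2 * n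
  · rw [Finset.sum_eq_single (q.1 + q.2)]
    · rw [proj_deg_of_mem h1]
      by_cases hqr : r.1 + r.2 = q.1 + q.2
      · rw [← hqr, proj_deg_of_mem h2]
      · rw [proj_deg_of_mem_ne h2 hqr,
          K.vol_mul_hodge_of_ne h h (Ne.symm hqr) h1 (K.conj_mem_deg h2)]
        simp
    · intro k _ hk
      rw [proj_deg_of_mem_ne h1 hk.symm]; simp
    · intro h'
      exact absurd (Finset.mem_range.2 (by omega)) h'
  · rw [K.deg_eq_bot (by omega) h1]; simp

end General

variable {G H : Type*} [Ring G] [StarRing G] [HopfAlgebra ℂ G] [StarModule ℂ G]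
  [HopfStarAlgebra G] [Ring H] [StarRing H] [HopfAlgebra ℂ H] [StarModule ℂ H]
  [HopfStarAlgebra H] {X : QuantumHomogeneousSpace G H} {Ω : Type*} [Ring Ω] [Algebra ℂ Ω]
  {C : StarCalculus X.M Ω} {n : ℕ} (K : HermitianStructure C n) {D : CovariantCalculus C}

theorem IsCovariant.comul_toZero {K : HermitianStructure C n} (hK : K.IsCovariant D) (ω : Ω) :
    Coalgebra.comul (R := ℂ) (C.toZero ω : G) =
      (X.M.subtype.toLinearMap ∘ₗ C.toZero).lTensor G (D.coaction ω) := by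
  refine K.mem_bideg_induction (p := fun ω => Coalgebra.comul (R := ℂ) (C.toZero ω : G) =
    (X.M.subtype.toLinearMap ∘ₗ C.toZero).lTensor G (D.coaction ω)) (by simp)
    (fun x y hx hy => by
      rw [map_add D.coaction, map_add (LinearMap.lTensor G _), ← hx, ← hy, ← map_add,
        map_add C.toZero]
      rfl) (fun q ω hω => ?_) ω
  by_cases hq : q.1 + q.2 = 0
  · have h1 := K.bideg_le_deg q hω
    rw [hq, ← C.range_incl] at h1
    obtain ⟨m, rfl⟩ := h1
    obtain ⟨t, ht, ht'⟩ := D.coaction_incl m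
    rw [AlgHom.toLinearMap_apply, C.toZero_incl, ht', ← ht, ← LinearMap.comp_apply,
      ← LinearMap.lTensor_comp]
    congr 2
    ext m
    simp [C.toZero_incl]
  · have h1 := K.bideg_le_deg q hω
    rw [C.toZero_of_mem hq h1]
    simp only [ZeroMemClass.coe_zero, map_zero]
    refine (range_lTensor_induction (p := fun z =>
      (X.M.subtype.toLinearMap ∘ₗ C.toZero).lTensor G z = 0) (by simp)
      (fun x y hx hy => by rw [map_add, hx, hy, add_zero]) (fun v u hu => ?_)
      (hK.coaction_mem_deg h1)).symm
    simp [C.toZero_of_mem hq hu]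

/-- The linear functional `ε ∘ vol`. -/
def fiberVol (h : ℝ) : Ω →ₗ[ℂ] ℂ := X.counit ∘ₗ K.vol h

/-- Covariance of the orientation: `vol(ω) = ω₍₋₁₎ ε(vol(ω₍₀₎))`. -/
theorem IsCovariant.vol_eq {K : HermitianStructure C n} (hK : K.IsCovariant D) (h : ℝ) (ω : Ω) :
    (K.vol h ω : G) =
      TensorProduct.rid ℂ G ((K.fiberVol h).lTensor G (D.coaction ω)) := by
  let T : Ω →ₗ[ℂ] Ω := K.hodge h ∘ₗ GradedAlgebra.proj C.deg (2 * n)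
  have hT : D.IsEquivariant T := (hK.lefschetzOp _ _).comp (hK.proj_deg _)
  -- With `T` moved across the coaction by equivariance, the claim becomes the counit axiom for the
  -- element of `M` underlying `T ω`.
  have h1 : K.fiberVol h = Coalgebra.counit (R := ℂ) (A := G) ∘ₗ
      (X.M.subtype.toLinearMap ∘ₗ C.toZero) ∘ₗ T := rfl
  rw [h1, LinearMap.lTensor_comp, LinearMap.comp_apply, LinearMap.lTensor_comp,
    LinearMap.comp_apply, ← hT, ← hK.comul_toZero, Coalgebra.lTensor_counit_comul,
    TensorProduct.rid_tmul, one_smul]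
  rfl

/-- The sesquilinear form `(ω, ν) ↦ ε(g(ω, ν))` on `Ω`. -/
def fiberForm (h : ℝ) : Ω →ₗ[ℂ] Ω →ₗ⋆[ℂ] ℂ :=
  LinearMap.mk₂'ₛₗ (RingHom.id ℂ) (starRingEnd ℂ)
    (fun ω ν => K.fiberVol h (ω * K.hodge h (C.conj ν)))
    (by intros; simp [add_mul]) (by intros; simp) (by intros; simp [mul_add])
    (by intros; simp)

theorem fiberForm_eq (h : ℝ) (ω ν : Ω) : K.fiberForm h ω ν = K.fiberPairing h ω ν := by
  rw [fiberPairing, metric_eq]; rfl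

/-- The sesquilinear form `(ω, ν) ↦ ∫_h ω ∧ *_h'(ν*)`. -/
def globalForm [Cosemisimple G] (h h' : ℝ) : Ω →ₗ[ℂ] Ω →ₗ⋆[ℂ] ℂ :=
  LinearMap.mk₂'ₛₗ (RingHom.id ℂ) (starRingEnd ℂ)
    (fun ω ν => haar G (K.vol h (ω * K.hodge h' (C.conj ν)) : G))
    (by intros; simp [add_mul]) (by intros; simp) (by intros; simp [mul_add])
    (by intros; simp)

theorem globalForm_apply [Cosemisimple G] (h h' : ℝ) (ω ν : Ω) :
    K.globalForm h h' ω ν = K.integral h (ω * K.hodge h' (C.conj ν)) := rfl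

/-- The inner product `(x, y) ↦ h(x y*)` of the Haar functional. -/
def haarForm (G : Type*) [Ring G] [StarRing G] [HopfAlgebra ℂ G] [StarModule ℂ G]
    [Cosemisimple G] : G →ₗ[ℂ] G →ₗ⋆[ℂ] ℂ :=
  LinearMap.mk₂'ₛₗ (RingHom.id ℂ) (starRingEnd ℂ) (fun x y => haar G (x * star y))
    (by intros; simp [add_mul]) (by intros; simp) (by intros; simp [mul_add])
    (by intros; simp)

theorem haarForm_posDef (G : Type*) [Ring G] [StarRing G] [HopfAlgebra ℂ G] [StarModule ℂ G]
    [CompactQuantumGroupAlgebra G] : PosDefForm (haarForm G) :=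
  CompactQuantumGroupAlgebra.haar_pos

end HermitianStructure

namespace HermitianStructure

variable {G H : Type*} [Ring G] [StarRing G] [HopfAlgebra ℂ G] [StarModule ℂ G]
  [CompactQuantumGroupAlgebra G] [Ring H] [StarRing H] [HopfAlgebra ℂ H] [StarModule ℂ H]
  [HopfStarAlgebra H] {X : QuantumHomogeneousSpace G H} {Ω : Type*} [Ring Ω] [Algebra ℂ Ω]
  {C : StarCalculus X.M Ω} {n : ℕ} {K : HermitianStructure C n} {D : CovariantCalculus C}

/-- The coaction respects products, the involution and the Hodge map, so by `IsCovariant.vol_eq` the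
integrand is `ω₍₋₁₎ ν₍₋₁₎* ε(g(ω₍₀₎, ν₍₀₎))`. -/
theorem IsCovariant.globalForm_eq (hK : K.IsCovariant D) (h : ℝ) (ω ν : Ω) :
    K.globalForm h h ω ν = TensorProduct.lid ℂ ℂ
      (TensorProduct.map₂ (haarForm G) (K.fiberForm h) (D.coaction ω) (D.coaction ν)) := by
  change haar G (K.vol h (ω * K.hodge h (C.conj ν)) : G) = _
  rw [hK.vol_eq, map_mul, show D.coaction (K.hodge h (C.conj ν)) = _ from
    hK.lefschetzOp _ _ _, hK.coaction_conj]
  generalize D.coaction ω = z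
  generalize D.coaction ν = w
  induction z using TensorProduct.induction_on with
  | zero => simp
  | add a b ha hb => simp only [add_mul, map_add, LinearMap.add_apply, ha, hb]
  | tmul x ω =>
    induction w using TensorProduct.induction_on with
    | zero => simp
    | add a b ha hb => simp only [mul_add, map_add, ha, hb]
    | tmul y ν =>
      simp only [StarCalculus.tensorConj_tmul, LinearMap.lTensor_tmul,
        Algebra.TensorProduct.tmul_mul_tmul, TensorProduct.rid_tmul, map_smul,
        TensorProduct.map₂_apply_tmul, smul_eq_mul]
      rw [mul_comm]
      rfl

/-- The fibre form descends to an inner product `F` on `Φ(Ω)`, defined here through a linear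
section; its tensor product with the Haar form is positive definite and is pulled back along the
injection `toFiber`. -/
theorem IsCovariant.globalForm_posDef [Cosemisimple H] (hK : K.IsCovariant D) {h : ℝ}
    (hpos : K.IsPositiveDefinite h) : PosDefForm (K.globalForm h h) := by
  intro ω hω
  obtain ⟨s, hs⟩ := LinearMap.exists_rightInverse_of_surjective (plusSubmodule C).mkQ
    (Submodule.range_mkQ _)
  have hs' : ∀ ω, s ((plusSubmodule C).mkQ ω) - ω ∈ plusSubmodule C := by
    intro ω
    rw [← Submodule.Quotient.mk_eq_zero, Submodule.Quotient.mk_sub, sub_eq_zero]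
    exact LinearMap.congr_fun hs _
  let F : (Ω ⧸ plusSubmodule C) →ₗ[ℂ] (Ω ⧸ plusSubmodule C) →ₗ⋆[ℂ] ℂ :=
    LinearMap.mk₂'ₛₗ (RingHom.id ℂ) (starRingEnd ℂ) (fun x y => K.fiberForm h (s x) (s y))
      (by intros; simp) (by intros; simp) (by intros; simp) (by intros; simp)
  have hF : ∀ ω ν, F ((plusSubmodule C).mkQ ω) ((plusSubmodule C).mkQ ν) =
      K.fiberForm h ω ν := by
    intro ω ν
    change K.fiberForm h (s ((plusSubmodule C).mkQ ω)) (s ((plusSubmodule C).mkQ ν)) = _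
    have h1 := hpos.left_descends _ (hs' ω) (s ((plusSubmodule C).mkQ ν))
    have h2 := hpos.right_descends ω _ (hs' ν)
    rw [← fiberForm_eq, map_sub, LinearMap.sub_apply, sub_eq_zero] at h1
    rw [← fiberForm_eq, map_sub, sub_eq_zero] at h2
    rw [h1, h2]
  have hFpos : PosDefForm F := by
    intro x hx
    obtain ⟨ω, rfl⟩ := Submodule.mkQ_surjective _ x
    rw [hF, fiberForm_eq]
    refine ⟨hpos.pos ω fun h => hx ((Submodule.Quotient.mk_eq_zero _).2 h), ?_⟩
    exact Complex.conj_eq_iff_im.1 (hpos.conj_symm ω ω).symm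
  have hmap : ∀ z w : G ⊗[ℂ] Ω, TensorProduct.map₂ (haarForm G) (K.fiberForm h) z w =
      TensorProduct.map₂ (haarForm G) F ((plusSubmodule C).mkQ.lTensor G z)
        ((plusSubmodule C).mkQ.lTensor G w) := by
    intro z w
    induction z using TensorProduct.induction_on with
    | zero => simp
    | add a b ha hb => simp only [map_add, LinearMap.add_apply, ha, hb]
    | tmul x ω =>
      induction w using TensorProduct.induction_on with
      | zero => simp
      | add a b ha hb => simp only [map_add, ha, hb]
      | tmul y ν =>
        rw [LinearMap.lTensor_tmul, LinearMap.lTensor_tmul, TensorProduct.map₂_apply_tmul,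
          TensorProduct.map₂_apply_tmul, TensorProduct.map_tmul, TensorProduct.map_tmul, hF]
  rw [hK.globalForm_eq, hmap]
  exact (haarForm_posDef G).tensor hFpos
    (z := D.toFiber ω) fun h0 => hω (D.toFiber_injective (h0.trans (map_zero _).symm))

end HermitianStructure

end Positive

/-! ### Passing from `*_h` to `*_1` -/

theorem qInt_pos {h : ℝ} (hh : 0 < h) {m : ℕ} (hm : 0 < m) : 0 < qInt h m :=
  Finset.sum_pos (fun _ _ => zpow_pos hh _) (Finset.nonempty_range_iff.2 hm.ne')

theorem qFactorial_pos {h : ℝ} (hh : 0 < h) (m : ℕ) : 0 < qFactorial h m :=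
  Finset.prod_pos fun i _ => qInt_pos hh i.succ_pos

namespace HermitianStructure

section General

variable {A : Type*} [Ring A] [Algebra ℂ A] [StarRing A] {Ω : Type*} [Ring Ω] [Algebra ℂ Ω]
  {C : StarCalculus A Ω} {n : ℕ} (K : HermitianStructure C n)

theorem L_pow_mul (j : ℕ) (ω ν : Ω) : (K.L ^ j) (ω * ν) = (K.L ^ j) ω * ν := by
  induction j with
  | zero => simp
  | succ j ih =>
    rw [pow_succ', Module.End.mul_apply, Module.End.mul_apply, ih, L_apply, L_apply, mul_assoc]

theorem L_pow_mul' (j : ℕ) (ω ν : Ω) : (K.L ^ j) (ω * ν) = ω * (K.L ^ j) ν := by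
  induction j with
  | zero => simp
  | succ j ih =>
    rw [pow_succ', Module.End.mul_apply, Module.End.mul_apply, ih, L_apply, L_apply, ← mul_assoc,
      K.form_central, mul_assoc]

/-- Orthogonality of the Lefschetz components. -/
theorem vol_L_pow_mul_hodge_of_ne (h h' : ℝ) {i j a b c d : ℕ}
    (hj : j + (c + d) ≤ n) (hne : ¬(i = j ∧ a + b = c + d)) {α β : Ω}
    (hα : α ∈ K.primitiveBi (a, b)) (hβ : β ∈ K.primitiveBi (c, d)) :
    K.vol h ((K.L ^ i) α * K.hodge h' ((K.L ^ j) β)) = 0 := by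
  have hα' := K.L_pow_mem_deg_of_mem_bideg (j := i) hα.1
  have hβ' := K.L_pow_mem_deg_of_mem_bideg (j := j) hβ.1
  by_cases hdeg : a + b + 2 * i = c + d + 2 * j
  · have h0 : (K.L ^ i) α * (K.L ^ (n - j - (c + d))) β = 0 := by
      rw [← K.L_pow_mul, ← K.L_pow_mul', ← Module.End.mul_apply, ← pow_add]
      -- All powers of `L` can be moved to either factor because `κ` is central; the total power is
      -- large enough to kill the factor of larger primitive degree.
      rcases lt_or_gt_of_ne (show a + b ≠ c + d by omega) with hlt | hlt
      · rw [K.L_pow_mul', K.L_pow_primitive (by omega) hβ, mul_zero]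
      · rw [K.L_pow_mul, K.L_pow_primitive (by omega) hα, zero_mul]
    rw [K.hodge_L_pow h' hj hβ, mul_smul_comm, h0, smul_zero, map_zero]
  · exact K.vol_mul_hodge_of_ne h h' hdeg hα' hβ'

/-- The ratio of the coefficients of `*_1` and `*_h`. -/
def hodgeRatio (n : ℕ) (h : ℝ) (j k : ℕ) : ℝ :=
  (qFactorial 1 j / qFactorial 1 (n - j - k)) / (qFactorial h j / qFactorial h (n - j - k))

theorem hodgeRatio_pos {h : ℝ} (hh : 0 < h) (j k : ℕ) : 0 < hodgeRatio n h j k := by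
  have h1 := qFactorial_pos hh
  have h2 := qFactorial_pos one_pos
  exact div_pos (div_pos (h2 _) (h2 _)) (div_pos (h1 _) (h1 _))

theorem hodgeCoeff_one_eq {h : ℝ} (hh : 0 < h) (j a b : ℕ) :
    hodgeCoeff n 1 j a b = (hodgeRatio n h j (a + b) : ℂ) * hodgeCoeff n h j a b := by
  have h1 : qFactorial h j ≠ 0 := (qFactorial_pos hh _).ne'
  have h2 : qFactorial h (n - j - (a + b)) ≠ 0 := (qFactorial_pos hh _).ne'
  have h3 : qFactorial 1 j / qFactorial 1 (n - j - (a + b)) = hodgeRatio n h j (a + b) *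
      (qFactorial h j / qFactorial h (n - j - (a + b))) :=
    (div_mul_cancel₀ _ (div_ne_zero h1 h2)).symm
  rw [hodgeCoeff, hodgeCoeff, h3, Complex.ofReal_mul]
  ring

/-- The operator rescaling the Lefschetz components so as to pass from `*_h` to `*_1`. -/
def rescale (h : ℝ) : Ω →ₗ[ℂ] Ω :=
  K.lefschetzOp (fun t => (Real.sqrt (hodgeRatio n h t.1.1 (t.1.2.1 + t.1.2.2)) : ℂ))
    (fun t => t.1.1)

theorem rescale_L_pow (h : ℝ) {j a b : ℕ} (hj : j + (a + b) ≤ n) {α : Ω}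
    (hα : α ∈ K.primitiveBi (a, b)) :
    K.rescale h ((K.L ^ j) α) =
      (Real.sqrt (hodgeRatio n h j (a + b)) : ℂ) • (K.L ^ j) α :=
  K.lefschetzOp_L_pow _ _ hj hα

theorem rescale_injective {h : ℝ} (hh : 0 < h) : Function.Injective (K.rescale h) := by
  have key : ∀ ω, K.lefschetzOp
      (fun t => (Real.sqrt (hodgeRatio n h t.1.1 (t.1.2.1 + t.1.2.2)) : ℂ)⁻¹)
      (fun t => t.1.1) (K.rescale h ω) = ω := fun ω => by
    refine K.lefschetz_induction (p := fun ω => K.lefschetzOp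
      (fun t => (Real.sqrt (hodgeRatio n h t.1.1 (t.1.2.1 + t.1.2.2)) : ℂ)⁻¹)
      (fun t => t.1.1) (K.rescale h ω) = ω)
      (fun x y hx hy => by rw [map_add, map_add, hx, hy]) (fun j a b hj α hα => ?_) ω
    rw [K.rescale_L_pow h hj hα, map_smul, K.lefschetzOp_L_pow _ _ hj hα, smul_smul,
      mul_inv_cancel₀, one_smul]
    exact_mod_cast (Real.sqrt_pos.2 (hodgeRatio_pos hh _ _)).ne'
  exact Function.LeftInverse.injective key

/-- On matching components the two square roots multiply to the ratio of Hodge coefficients; other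
components are orthogonal for both Hodge maps. The ratio depends only on `j` and `a + b`, so no
orthogonality between bidegrees of equal total degree is required. -/
theorem vol_mul_hodge_one {h : ℝ} (hh : 0 < h) (ω ν : Ω) :
    K.vol h (ω * K.hodge 1 (C.conj ν)) =
      K.vol h (K.rescale h ω * K.hodge h (C.conj (K.rescale h ν))) := by
  refine K.lefschetz_induction (p := fun ω => K.vol h (ω * K.hodge 1 (C.conj ν)) =
      K.vol h (K.rescale h ω * K.hodge h (C.conj (K.rescale h ν))))
    (fun x y hx hy => by simp only [add_mul, map_add, hx, hy]) (fun i a b hi α hα => ?_) ω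
  refine K.lefschetz_induction (p := fun ν => K.vol h ((K.L ^ i) α * K.hodge 1 (C.conj ν)) =
      K.vol h (K.rescale h ((K.L ^ i) α) * K.hodge h (C.conj (K.rescale h ν))))
    (fun x y hx hy => by simp only [mul_add, map_add, hx, hy]) (fun j c d hj β hβ => ?_) ν
  have hβ' := K.conj_mem_primitiveBi (by omega) hβ
  have hj' : j + (d + c) ≤ n := by omega
  rw [K.rescale_L_pow h hi hα, K.rescale_L_pow h hj hβ, LinearMap.map_smulₛₗ, K.conj_L_pow,
    map_smul, smul_mul_smul_comm, map_smul]
  by_cases hij : i = j ∧ a + b = d + c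
  · obtain ⟨rfl, hab⟩ := hij
    rw [K.hodge_L_pow 1 hj' hβ', K.hodge_L_pow h hj' hβ', hodgeCoeff_one_eq hh, mul_smul_comm,
      mul_smul_comm, map_smul, map_smul, smul_smul]
    congr 1
    rw [Complex.conj_ofReal, hab, add_comm c d, ← Complex.ofReal_mul,
      Real.mul_self_sqrt (hodgeRatio_pos hh _ _).le]
  · rw [K.vol_L_pow_mul_hodge_of_ne h 1 hj' hij hα hβ',
      K.vol_L_pow_mul_hodge_of_ne h h hj' hij hα hβ', smul_zero]

end General

variable {G H : Type*} [Ring G] [StarRing G] [HopfAlgebra ℂ G] [StarModule ℂ G]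
  [CompactQuantumGroupAlgebra G] [Ring H] [StarRing H] [HopfAlgebra ℂ H] [StarModule ℂ H]
  [HopfStarAlgebra H] {X : QuantumHomogeneousSpace G H} {Ω : Type*} [Ring Ω] [Algebra ℂ Ω]
  {C : StarCalculus X.M Ω} {n : ℕ} {K : HermitianStructure C n} {D : CovariantCalculus C}

theorem IsCovariant.globalForm_one_posDef [Cosemisimple H] (hK : K.IsCovariant D) {h : ℝ}
    (hh : 0 < h) (hpos : K.IsPositiveDefinite h) : PosDefForm (K.globalForm h 1) := by
  intro ω hω
  have h1 : K.globalForm h 1 ω ω = K.globalForm h h (K.rescale h ω) (K.rescale h ω) :=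
    congrArg (fun m : X.M => haar G (m : G)) (K.vol_mul_hodge_one hh ω ω)
  rw [h1]
  refine hK.globalForm_posDef hpos _ fun h0 => hω ?_
  exact K.rescale_injective hh (h0.trans (map_zero _).symm)

end HermitianStructure

/-! ### Integration by parts and adjointness -/

namespace KahlerStructure

section General

variable {A : Type*} [Ring A] [Algebra ℂ A] [StarRing A] {Ω : Type*} [Ring Ω] [Algebra ℂ Ω]
  {C : StarCalculus A Ω} {n : ℕ} (K : KahlerStructure C n)

/-- The graded Leibniz rule for `∂` and `∂̄`. -/
theorem component_mul {v : ℕ × ℕ} (hv : v = (1, 0) ∨ v = (0, 1)) {p : ℕ × ℕ} {ω : Ω}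
    (hω : ω ∈ K.bideg p) (ν : Ω) :
    K.component v (ω * ν) = K.component v ω * ν + (-1 : ℂ) ^ (p.1 + p.2) • (ω * K.component v ν) := by
  refine K.mem_bideg_induction (p := fun ν => K.component v (ω * ν) =
    K.component v ω * ν + (-1 : ℂ) ^ (p.1 + p.2) • (ω * K.component v ν)) (by simp)
    (fun x y hx hy => by simp only [mul_add, map_add, smul_add, hx, hy]; abel)
    (fun q ν hν => ?_) ν
  rw [K.component_of_mem v (K.bideg_mul hω hν), C.leibniz _ _ (K.bideg_le_deg p hω), K.d_eq ω,
    K.d_eq ν]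
  have m1 := K.bideg_mul (K.component_mem (1, 0) hω) hν
  have m2 := K.bideg_mul (K.component_mem (0, 1) hω) hν
  have m3 := K.bideg_mul hω (K.component_mem (1, 0) hν)
  have m4 := K.bideg_mul hω (K.component_mem (0, 1) hν)
  rw [add_right_comm] at m1 m2
  rw [← add_assoc] at m3 m4
  simp only [add_mul, mul_add, map_add, map_smul]
  rcases hv with rfl | rfl
  · rw [K.proj_bideg_of_mem m1, K.proj_bideg_of_mem m3, K.proj_bideg_of_mem_ne m2 (by simp),
      K.proj_bideg_of_mem_ne m4 (by simp), add_zero, add_zero]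
  · rw [K.proj_bideg_of_mem m2, K.proj_bideg_of_mem m4, K.proj_bideg_of_mem_ne m1 (by simp),
      K.proj_bideg_of_mem_ne m3 (by simp), zero_add, zero_add]

theorem component_mem_deg {v : ℕ × ℕ} (hv : v = (1, 0) ∨ v = (0, 1)) {k : ℕ} {ω : Ω}
    (hω : ω ∈ C.deg k) : K.component v ω ∈ C.deg (k + 1) := by
  have hle : C.deg k ≤ (C.deg (k + 1)).comap (K.component v) := by
    conv_lhs => rw [K.deg_eq k]
    refine iSup₂_le fun p hp ω hω => ?_
    rw [Finset.HasAntidiagonal.mem_antidiagonal] at hp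
    have h1 := K.bideg_le_deg _ (K.component_mem v hω)
    rwa [show (p + v).1 + (p + v).2 = k + 1 by rcases hv with rfl | rfl <;> simp <;> omega] at h1
  exact hle hω

end General

variable {G H : Type*} [Ring G] [StarRing G] [HopfAlgebra ℂ G] [StarModule ℂ G]
  [CompactQuantumGroupAlgebra G] [Ring H] [StarRing H] [HopfAlgebra ℂ H] [StarModule ℂ H]
  [HopfStarAlgebra H] {X : QuantumHomogeneousSpace G H} {Ω : Type*} [Ring Ω] [Algebra ℂ Ω]
  {C : StarCalculus X.M Ω} {n : ℕ} (K : KahlerStructure C n) {D : CovariantCalculus C}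

theorem integral_of_mem (h : ℝ) {k : ℕ} (hk : k ≠ 2 * n) {ω : Ω} (hω : ω ∈ C.deg k) :
    K.integral h ω = 0 := by
  rw [HermitianStructure.integral, K.vol_of_mem hk hω]
  simp

theorem integral_add (h : ℝ) (ω ν : Ω) :
    K.integral h (ω + ν) = K.integral h ω + K.integral h ν := by
  simp [HermitianStructure.integral]

theorem integral_smul (h : ℝ) (c : ℂ) (ω : Ω) :
    K.integral h (c • ω) = c * K.integral h ω := by
  simp [HermitianStructure.integral]

theorem integral_zero (h : ℝ) : K.integral h 0 = 0 := by
  simp [HermitianStructure.integral]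

/-- If the integral is closed then it vanishes on `∂`- and `∂̄`-exact forms. -/
theorem integral_component {h : ℝ} (hcl : K.IntegralClosed h) {v : ℕ × ℕ}
    (hv : v = (1, 0) ∨ v = (0, 1)) (ω : Ω) : K.integral h (K.component v ω) = 0 := by
  refine K.mem_bideg_induction (p := fun ω => K.integral h (K.component v ω) = 0)
    (by rw [map_zero, integral_zero])
    (fun x y hx hy => by rw [map_add, integral_add, hx, hy, add_zero]) (fun p ω hω => ?_) ω
  have hdeg := K.bideg_le_deg p hω
  by_cases hp : p.1 + p.2 + 1 = 2 * n
  -- If `∂_v ω` has bidegree `(n, n)`, the other component of `dω` has a different top bidegree and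
  -- vanishes, so `∂_v ω = dω`.
  · by_cases hpv : p + v = (n, n)
    · have h1 := hcl _ hp ω hdeg
      rw [K.d_eq] at h1
      rcases hv with rfl | rfl
      · rwa [K.eq_zero_of_mem_bideg_top (by simp only [Prod.fst_add, Prod.snd_add]; omega)
          (by rw [← hpv]; simp) (K.component_mem (0, 1) hω), add_zero] at h1
      · rwa [K.eq_zero_of_mem_bideg_top (by simp only [Prod.fst_add, Prod.snd_add]; omega)
          (by rw [← hpv]; simp) (K.component_mem (1, 0) hω), zero_add] at h1
    · rw [K.eq_zero_of_mem_bideg_top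
        (by rcases hv with rfl | rfl <;> simp only [Prod.fst_add, Prod.snd_add] <;> omega) hpv
        (K.component_mem v hω), integral_zero]
  · exact K.integral_of_mem h hp (K.component_mem_deg hv hdeg)

/-- Integrating the Leibniz rule for `ω ∧ *(ν*)` moves the differential to the second factor with
sign `-(-1)^(deg ω) = (-1)^(deg ν)`, the sign in `hδ'`. In mismatched degrees both sides vanish. -/
theorem globalForm_component {h : ℝ} (hcl : K.IntegralClosed h) {v : ℕ × ℕ}
    (hv : v = (1, 0) ∨ v = (0, 1)) {δ' : Ω →ₗ[ℂ] Ω}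
    (hδ' : ∀ k, ∀ ν ∈ C.deg k, K.hodge 1 (C.conj (δ' ν)) =
      (-1 : ℂ) ^ k • K.component v (K.hodge 1 (C.conj ν))) :
    IsAdjointFor (K.globalForm h 1) (K.component v) δ' := by
  intro ω ν
  refine K.mem_bideg_induction (p := fun ω => K.globalForm h 1 (K.component v ω) ν =
    K.globalForm h 1 ω (δ' ν)) (by simp)
    (fun x y hx hy => by simp only [map_add, LinearMap.add_apply, hx, hy]) (fun p ω hω => ?_) ω
  refine K.mem_bideg_induction (p := fun ν => K.globalForm h 1 (K.component v ω) ν =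
    K.globalForm h 1 ω (δ' ν)) (by simp)
    (fun x y hx hy => by simp only [map_add, hx, hy]) (fun q ν hν => ?_) ν
  have hω' := K.bideg_le_deg p hω
  have hν' := K.bideg_le_deg q hν
  rw [K.globalForm_apply, K.globalForm_apply, hδ' _ ν hν', mul_smul_comm, integral_smul]
  by_cases hq : q.1 + q.2 ≤ 2 * n
  · have hh := K.hodge_mem_deg 1 (K.conj_mem_deg hν')
    by_cases hpq : p.1 + p.2 + 1 = q.1 + q.2
    · have h1 := K.integral_component hcl hv (ω * K.hodge 1 (C.conj ν))
      rw [K.component_mul hv hω, integral_add, integral_smul] at h1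
      rw [← hpq, pow_succ]
      linear_combination h1
    · rw [K.integral_of_mem h (by omega)
        (SetLike.mul_mem_graded (K.component_mem_deg hv hω') hh),
        K.integral_of_mem h (by omega)
        (SetLike.mul_mem_graded hω' (K.component_mem_deg hv hh)), mul_zero]
  · rw [K.deg_eq_bot (by omega) hν']
    simp [integral_zero]

/-- The involution turns `i[Λ, ∂̄]` into `-i[Λ, ∂]`, and the factor `i` from `hodge_commutator`
cancels the `-i`. -/
theorem adjoint_del {h : ℝ} (hcl : K.IntegralClosed h) :
    IsAdjointFor (K.globalForm h 1) K.del K.delAdj := by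
  refine K.globalForm_component hcl (Or.inl rfl) fun k ν hν => ?_
  have h1 := K.hodge_commutator (v := (1, 0)) (by simp) (K.conj_mem_deg hν)
  simp only [delAdj, LinearMap.smul_apply, LinearMap.sub_apply, LinearMap.comp_apply,
    LinearMap.map_smulₛₗ, map_sub, K.conj_Lam, K.conj_delbar] at h1 ⊢
  change _ • (K.hodge 1 (K.Lam (K.component (1, 0) _)) -
    K.hodge 1 (K.component (1, 0) (K.Lam _))) = _
  rw [h1, smul_smul]
  congr 1
  simp only [Complex.conj_I, RingHom.id_apply, Nat.cast_one, Nat.cast_zero, sub_zero, zpow_one]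
  linear_combination (-(-1 : ℂ) ^ k) * Complex.I_mul_I

theorem adjoint_delbar {h : ℝ} (hcl : K.IntegralClosed h) :
    IsAdjointFor (K.globalForm h 1) K.delbar K.delbarAdj := by
  refine K.globalForm_component hcl (Or.inr rfl) fun k ν hν => ?_
  have h1 := K.hodge_commutator (v := (0, 1)) (by simp) (K.conj_mem_deg hν)
  simp only [delbarAdj, LinearMap.neg_apply, LinearMap.smul_apply, LinearMap.sub_apply,
    LinearMap.comp_apply, LinearMap.map_smulₛₗ, map_sub, map_neg, K.conj_Lam, K.conj_del] at h1 ⊢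
  change -(_ • (K.hodge 1 (K.Lam (K.component (0, 1) _)) -
    K.hodge 1 (K.component (0, 1) (K.Lam _)))) = _
  rw [h1, smul_smul, ← neg_smul]
  congr 1
  simp only [Complex.conj_I, RingHom.id_apply, Nat.cast_one, Nat.cast_zero, zero_sub, zpow_neg,
    zpow_one, Complex.inv_I]
  linear_combination (-(-1 : ℂ) ^ k) * Complex.I_mul_I

theorem adjoint_diff {h : ℝ} (hcl : K.IntegralClosed h) (t : Differential) :
    IsAdjointFor (K.globalForm h 1) (K.diff t) (K.diffAdj t) := by
  cases t
  · intro ω ν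
    have h1 := K.adjoint_del hcl ω ν
    have h2 := K.adjoint_delbar hcl ω ν
    change K.globalForm h 1 (C.d ω) ν = K.globalForm h 1 ω (K.delAdj ν + K.delbarAdj ν)
    rw [map_add, ← h1, ← h2, K.integrable, LinearMap.add_apply, map_add, LinearMap.add_apply]
  · exact K.adjoint_del hcl
  · exact K.adjoint_delbar hcl

variable {K}

theorem component_equivariant (hK : K.IsCovariant D) (v : ℕ × ℕ) :
    D.IsEquivariant (K.component v) := by
  refine CovariantCalculus.isEquivariant_iff.2 fun φ ω => ?_
  refine K.mem_bideg_induction (p := fun ω => D.act φ (K.component v ω) =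
    K.component v (D.act φ ω)) (by simp)
    (fun x y hx hy => by simp only [map_add, hx, hy]) (fun p ω hω => ?_) ω
  rw [K.component_of_mem v hω, K.component_of_mem v (hK.act_mem_bideg φ p ω hω),
    CovariantCalculus.isEquivariant_iff.1 (hK.proj_bideg (p + v)),
    CovariantCalculus.isEquivariant_iff.1 D.coaction_d]

theorem lap_equivariant (hK : K.IsCovariant D) : D.IsEquivariant K.lap := by
  have h1 := component_equivariant hK (1, 0)
  have h2 := component_equivariant hK (0, 1)
  have h3 : D.IsEquivariant K.Lam := hK.lefschetzOp _ _
  have h4 : D.IsEquivariant K.delAdj := ((h3.comp h2).sub (h2.comp h3)).smul _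
  exact (h1.comp h4).add (h4.comp h1)

end KahlerStructure

/-! ### Projections onto the Lefschetz components -/

namespace HermitianStructure

variable {A : Type*} [Ring A] [Algebra ℂ A] [StarRing A] {Ω : Type*} [Ring Ω] [Algebra ℂ Ω]
  {C : StarCalculus A Ω} {n : ℕ} (K : HermitianStructure C n)

instance finite_lefschetzIndex (n : ℕ) : Finite (LefschetzIndex n) := by
  refine Finite.of_injective
    (fun t : LefschetzIndex n => ((⟨t.1.1, by omega⟩, ⟨t.1.2.1, by omega⟩, ⟨t.1.2.2, by omega⟩) :
      Fin (n + 1) × Fin (n + 1) × Fin (n + 1))) fun s t h => ?_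
  simp only [Prod.mk.injEq, Fin.mk.injEq] at h
  exact Subtype.ext (Prod.ext h.1 (Prod.ext h.2.1 h.2.2))

/-- The projection onto the component `L^j P^(a,b)` of the Lefschetz decomposition, where
`s = (j, a, b)` (zero if `j + a + b > n`). -/
def lefschetzProj (s : ℕ × ℕ × ℕ) : Ω →ₗ[ℂ] Ω :=
  K.lefschetzOp (fun t => if t.1 = s then 1 else 0) (fun t => t.1.1)

theorem lefschetzProj_L_pow (s : ℕ × ℕ × ℕ) {j a b : ℕ} (hj : j + (a + b) ≤ n) {α : Ω}
    (hα : α ∈ K.primitiveBi (a, b)) :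
    K.lefschetzProj s ((K.L ^ j) α) = if (j, a, b) = s then (K.L ^ j) α else 0 := by
  rw [lefschetzProj, K.lefschetzOp_L_pow _ _ hj hα]
  split_ifs with h
  · rw [one_smul]
  · rw [zero_smul]

theorem exists_lefschetzProj_eq (s : ℕ × ℕ × ℕ) (ω : Ω) :
    ∃ α ∈ K.primitiveBi s.2, K.lefschetzProj s ω = (K.L ^ s.1) α := by
  refine K.lefschetz_induction (p := fun ω => ∃ α ∈ K.primitiveBi s.2,
    K.lefschetzProj s ω = (K.L ^ s.1) α) ?_ (fun j a b hj α hα => ?_) ω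
  · rintro x y ⟨α, hα, hx⟩ ⟨β, hβ, hy⟩
    exact ⟨α + β, Submodule.add_mem _ hα hβ, by rw [map_add, map_add, hx, hy]⟩
  · rw [K.lefschetzProj_L_pow s hj hα]
    split_ifs with h
    · subst h
      exact ⟨α, hα, rfl⟩
    · exact ⟨0, Submodule.zero_mem _, (map_zero _).symm⟩

theorem mem_of_lefschetzProj_mem {N : Submodule ℂ Ω} {ω : Ω}
    (h : ∀ t : LefschetzIndex n, K.lefschetzProj t.1 ω ∈ N) : ω ∈ N := by
  have := Fintype.ofFinite (LefschetzIndex n)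
  have hsum : ω = ∑ t : LefschetzIndex n, K.lefschetzProj t.1 ω := by
    refine K.lefschetz_induction (p := fun ω => ω = ∑ t : LefschetzIndex n,
      K.lefschetzProj t.1 ω) (fun x y hx hy => ?_) (fun j a b hj α hα => ?_) ω
    · simp only [map_add, Finset.sum_add_distrib, ← hx, ← hy]
    · rw [Finset.sum_eq_single ⟨(j, a, b), hj⟩, K.lefschetzProj_L_pow _ hj hα, if_pos rfl]
      · intro t _ ht
        rw [K.lefschetzProj_L_pow _ hj hα, if_neg]
        exact fun h => ht (Subtype.ext h.symm)
      · exact fun h => absurd (Finset.mem_univ _) h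
  rw [hsum]
  exact Submodule.sum_mem _ fun t _ => h t

theorem L_pow_injOn {j k : ℕ} (hjk : j + k ≤ n) {ω : Ω} (hω : ω ∈ C.deg k)
    (h : (K.L ^ j) ω = 0) : ω = 0 := by
  refine (K.L_pow_bijOn (k := k) (by omega)).injOn hω (Submodule.zero_mem _) ?_
  simp only [map_zero]
  exact K.L_pow_eq_zero_of_le (by omega) h

end HermitianStructure

/-! ### Harmonic representatives and hard Lefschetz -/

namespace KahlerStructure

variable {A : Type*} [Ring A] [Algebra ℂ A] [StarRing A] {Ω : Type*} [Ring Ω] [Algebra ℂ Ω]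
  {C : StarCalculus A Ω} {n : ℕ} (K : KahlerStructure C n)

/-- A Kähler structure with a positive definite form for which `diffAdj` is adjoint to `diff`, and
for which every subspace stable under the Laplacian splits into harmonic and non-harmonic parts. -/
structure HodgeTheory (S : Ω →ₗ[ℂ] Ω →ₗ⋆[ℂ] ℂ) : Prop where
  posDef : PosDefForm S
  adjoint : ∀ t, IsAdjointFor S (K.diff t) (K.diffAdj t)
  split : ∀ W : Submodule ℂ Ω, (∀ x ∈ W, K.lap x ∈ W) → ∀ ω ∈ W,
    ∃ η ∈ W, ∃ ξ ∈ W, K.lap η = 0 ∧ ω = η + K.lap ξ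

/-- The harmonic `k`-forms. -/
def harmonic (k : ℕ) : Submodule ℂ Ω := C.deg k ⊓ LinearMap.ker K.lap

theorem diff_mem_deg (t : Differential) {k : ℕ} {ω : Ω} (hω : ω ∈ C.deg k) :
    K.diff t ω ∈ C.deg (k + 1) := by
  cases t
  · exact C.d_mem k ω hω
  · exact K.component_mem_deg (Or.inl rfl) hω
  · exact K.component_mem_deg (Or.inr rfl) hω

theorem proj_deg_succ_diff (t : Differential) (k : ℕ) (ω : Ω) :
    GradedAlgebra.proj C.deg (k + 1) (K.diff t ω) =
      K.diff t (GradedAlgebra.proj C.deg k ω) := by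
  refine K.mem_bideg_induction (p := fun ω => GradedAlgebra.proj C.deg (k + 1) (K.diff t ω) =
    K.diff t (GradedAlgebra.proj C.deg k ω)) (by simp)
    (fun x y hx hy => by simp only [map_add, hx, hy]) (fun p ω hω => ?_) ω
  have h1 := K.bideg_le_deg p hω
  have h2 := K.diff_mem_deg t h1
  by_cases hp : p.1 + p.2 = k
  · subst hp
    rw [HermitianStructure.proj_deg_of_mem h1, HermitianStructure.proj_deg_of_mem h2]
  · rw [HermitianStructure.proj_deg_of_mem_ne h1 hp,
      HermitianStructure.proj_deg_of_mem_ne h2 (by omega), map_zero]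

theorem proj_deg_zero_diff (t : Differential) (ω : Ω) :
    GradedAlgebra.proj C.deg 0 (K.diff t ω) = 0 := by
  refine K.mem_bideg_induction (p := fun ω => GradedAlgebra.proj C.deg 0 (K.diff t ω) = 0)
    (by simp) (fun x y hx hy => by simp only [map_add, hx, hy, add_zero]) (fun p ω hω => ?_) ω
  exact HermitianStructure.proj_deg_of_mem_ne (K.diff_mem_deg t (K.bideg_le_deg p hω)) (by omega)

/-- A potential of mixed degree may be replaced by its component of degree `k - 1`, as the
differential has degree one. -/
theorem mem_coboundaries (t : Differential) {k : ℕ} {ω : Ω} (hω : K.diff t ω ∈ C.deg k) :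
    K.diff t ω ∈ C.coboundaries (K.diff t) k := by
  cases k with
  | zero =>
    have h1 := K.proj_deg_zero_diff t ω
    rw [HermitianStructure.proj_deg_of_mem hω] at h1
    rw [h1]; exact Submodule.zero_mem _
  | succ k =>
    have h1 := K.proj_deg_succ_diff t k ω
    rw [HermitianStructure.proj_deg_of_mem hω] at h1
    rw [h1]
    refine Submodule.mem_map_of_mem ?_
    rw [GradedAlgebra.proj_apply]; exact Subtype.mem _

theorem exists_of_mem_coboundaries (t : Differential) {k : ℕ} {ω : Ω}
    (hω : ω ∈ C.coboundaries (K.diff t) k) : ∃ ν, ω = K.diff t ν := by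
  cases k with
  | zero =>
    have : ω = 0 := hω
    exact ⟨0, by rw [this, map_zero]⟩
  | succ k =>
    obtain ⟨ν, _, rfl⟩ := hω
    exact ⟨ν, rfl⟩

theorem cohomologyClass_eq_zero_iff (t : Differential) {k : ℕ} (ω : C.cocycles (K.diff t) k) :
    K.cohomologyClass t k ω = 0 ↔ (ω : Ω) ∈ C.coboundaries (K.diff t) k :=
  Submodule.Quotient.mk_eq_zero _

variable {K} {S : Ω →ₗ[ℂ] Ω →ₗ⋆[ℂ] ℂ}

namespace HodgeTheory

theorem laplacian_eq_zero (t : Differential) {η : Ω} (hη : K.lap η = 0) :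
    laplacian (K.diff t) (K.diffAdj t) η = 0 := by
  obtain ⟨c, _, h⟩ := K.laplacian_diff t
  rw [h, LinearMap.smul_apply, hη, smul_zero]

theorem harmonic_le_cocycles (hS : K.HodgeTheory S) (t : Differential) (k : ℕ) :
    K.harmonic k ≤ C.cocycles (K.diff t) k := fun _ hη =>
  ⟨hη.1, ((laplacian_eq_zero_iff hS.posDef (hS.adjoint t)).1 (laplacian_eq_zero t hη.2)).1⟩

/-- The cohomology class of a harmonic form. -/
def harmonicClass (hS : K.HodgeTheory S) (t : Differential) (k : ℕ) :
    K.harmonic k →ₗ[ℂ] K.Cohomology t k :=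
  K.cohomologyClass t k ∘ₗ Submodule.inclusion (hS.harmonic_le_cocycles t k)

theorem harmonicClass_injective (hS : K.HodgeTheory S) (t : Differential) (k : ℕ) :
    Function.Injective (hS.harmonicClass t k) := by
  rw [injective_iff_map_eq_zero]
  intro η hη
  obtain ⟨ν, hν⟩ := K.exists_of_mem_coboundaries t ((K.cohomologyClass_eq_zero_iff t _).1 hη)
  change (η : Ω) = K.diff t ν at hν
  have h1 := laplacian_eq_zero t (LinearMap.mem_ker.1 η.2.2)
  rw [hν] at h1
  refine Subtype.ext ?_
  rw [hν]
  exact eq_zero_of_harmonic_of_exact hS.posDef (hS.adjoint t) h1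

/-- A closed form is cohomologous to its harmonic part. -/
theorem class_eq_harmonicClass (hS : K.HodgeTheory S) (t : Differential) {k : ℕ} {ω ξ : Ω} (η : K.harmonic k)
    (hω : ω ∈ C.cocycles (K.diff t) k) (h : ω = η + K.lap ξ) :
    K.cohomologyClass t k ⟨ω, hω⟩ = hS.harmonicClass t k η := by
  obtain ⟨c, hc, hlap⟩ := K.laplacian_diff t
  -- The factor `c⁻¹` absorbs the proportionality constant between this Laplacian and `lap`.
  have h1 : ω = η + laplacian (K.diff t) (K.diffAdj t) (c⁻¹ • ξ) := by
    rw [hlap, LinearMap.smul_apply, map_smul, smul_smul, mul_inv_cancel₀ hc, one_smul, h]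
  have h2 := eq_add_of_closed hS.posDef (hS.adjoint t) (K.diff_diff t)
    (laplacian_eq_zero t (LinearMap.mem_ker.1 η.2.2)) h1 (LinearMap.mem_ker.1 hω.2)
  have h3 : ω - η = K.diff t (K.diffAdj t (c⁻¹ • ξ)) := sub_eq_of_eq_add' h2
  rw [← sub_eq_zero]
  change K.cohomologyClass t k ⟨ω, hω⟩ - K.cohomologyClass t k _ = 0
  rw [← map_sub, cohomologyClass_eq_zero_iff]
  change ω - η ∈ _
  have h4 : ω - η ∈ C.deg k := Submodule.sub_mem _ hω.1 η.2.1
  rw [h3] at h4 ⊢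
  exact K.mem_coboundaries t h4

/-- The harmonic representative of a class represented by a closed form in a subspace stable under
the Laplacian. -/
theorem exists_harmonicClass_eq (hS : K.HodgeTheory S) (t : Differential) {k : ℕ} {W : Submodule ℂ Ω}
    (hWk : W ≤ C.deg k) (hW : ∀ x ∈ W, K.lap x ∈ W) {ω : Ω} (hωW : ω ∈ W)
    (hω : ω ∈ C.cocycles (K.diff t) k) :
    ∃ η : K.harmonic k, (η : Ω) ∈ W ∧
      hS.harmonicClass t k η = K.cohomologyClass t k ⟨ω, hω⟩ := by
  obtain ⟨η, hη, ξ, _, hη0, h⟩ := hS.split W hW ω hωW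
  exact ⟨⟨η, hWk hη, hη0⟩, hη, (hS.class_eq_harmonicClass t ⟨η, hWk hη, hη0⟩ hω h).symm⟩

theorem harmonicClass_surjective (hS : K.HodgeTheory S) (t : Differential) (k : ℕ) :
    Function.Surjective (hS.harmonicClass t k) := by
  intro x
  obtain ⟨ω, rfl⟩ := Submodule.mkQ_surjective _ x
  obtain ⟨η, _, h⟩ := hS.exists_harmonicClass_eq t le_rfl (fun x hx => K.lap_mem_deg hx)
    ω.2.1 ω.2
  exact ⟨η, h⟩

/-- The Hodge isomorphism between harmonic forms and cohomology. -/
def hodgeEquiv (hS : K.HodgeTheory S) (t : Differential) (k : ℕ) : K.harmonic k ≃ₗ[ℂ] K.Cohomology t k :=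
  LinearEquiv.ofBijective (hS.harmonicClass t k)
    ⟨hS.harmonicClass_injective t k, hS.harmonicClass_surjective t k⟩

theorem L_pow_mem_harmonic {j k m : ℕ} (h : m = k + 2 * j) {η : Ω} (hη : η ∈ K.harmonic k) :
    (K.L ^ j) η ∈ K.harmonic m := by
  refine ⟨h ▸ K.L_pow_mem_deg j hη.1, ?_⟩
  change K.lap ((K.L ^ j) η) = 0
  rw [HermitianStructure.map_L_pow_of_commute K.lap_L, LinearMap.mem_ker.1 hη.2, map_zero]

theorem lefschetz_harmonicClass (hS : K.HodgeTheory S) (t : Differential) {j k m : ℕ} (h : m = k + 2 * j)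
    (η : K.harmonic k) :
    K.lefschetz t j k m h (hS.harmonicClass t k η) =
      hS.harmonicClass t m ⟨(K.L ^ j) η, L_pow_mem_harmonic h η.2⟩ := rfl

/-- The Lefschetz isomorphism on forms commutes with the Laplacian, so it restricts to harmonic
forms. -/
theorem lefschetz_bijective (hS : K.HodgeTheory S) (t : Differential) {k : ℕ} (hk : k ≤ n)
    (h : n + k = n - k + 2 * k) : Function.Bijective (K.lefschetz t k (n - k) (n + k) h) := by
  constructor
  · rw [injective_iff_map_eq_zero]
    intro x hx
    obtain ⟨η, rfl⟩ := hS.harmonicClass_surjective t _ x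
    rw [hS.lefschetz_harmonicClass] at hx
    have h1 := (injective_iff_map_eq_zero _).1 (hS.harmonicClass_injective t _) _ hx
    have h2 : η = 0 := Subtype.ext (K.L_pow_injOn (by omega) η.2.1 (congrArg Subtype.val h1))
    rw [h2, map_zero]
  · intro y
    obtain ⟨ζ, rfl⟩ := hS.harmonicClass_surjective t _ y
    have h1 : (ζ : Ω) ∈ C.deg (2 * n - (n - k)) :=
      (show n + k = 2 * n - (n - k) by omega) ▸ ζ.2.1
    obtain ⟨η, hη, hL⟩ := (K.L_pow_bijOn (k := n - k) (by omega)).surjOn h1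
    simp only [show n - (n - k) = k by omega] at hL
    -- The preimage of a harmonic form is harmonic, since `L^k` is injective in degree `n - k` and
    -- kills its Laplacian.
    have h2 : K.lap η = 0 := by
      refine K.L_pow_injOn (j := k) (by omega) (K.lap_mem_deg hη) ?_
      rw [← HermitianStructure.map_L_pow_of_commute K.lap_L, hL, LinearMap.mem_ker.1 ζ.2.2]
    refine ⟨hS.harmonicClass t _ ⟨η, hη, h2⟩, ?_⟩
    rw [hS.lefschetz_harmonicClass]
    exact congrArg _ (Subtype.ext hL)

/-- Two of the cohomologies are identified, compatibly with the classes of forms which are closed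
for both differentials. -/
theorem exists_equiv (hS : K.HodgeTheory S) (s t : Differential) (k : ℕ) :
    ∃ e : K.Cohomology s k ≃ₗ[ℂ] K.Cohomology t k, ∀ ω,
      ∀ (h₁ : ω ∈ C.cocycles (K.diff s) k) (h₂ : ω ∈ C.cocycles (K.diff t) k),
        e (K.cohomologyClass s k ⟨ω, h₁⟩) = K.cohomologyClass t k ⟨ω, h₂⟩ := by
  refine ⟨(hS.hodgeEquiv s k).symm.trans (hS.hodgeEquiv t k), fun ω h₁ h₂ => ?_⟩
  obtain ⟨η, hη, ξ, _, hη0, h⟩ := hS.split (C.deg k) (fun x hx => K.lap_mem_deg hx) ω h₁.1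
  have e1 := hS.class_eq_harmonicClass s ⟨η, hη, hη0⟩ h₁ h
  have e2 := hS.class_eq_harmonicClass t ⟨η, hη, hη0⟩ h₂ h
  rw [LinearEquiv.trans_apply, e1, e2]
  change hS.hodgeEquiv t k ((hS.hodgeEquiv s k).symm (hS.hodgeEquiv s k _)) = _
  rw [LinearEquiv.symm_apply_apply]
  rfl

/-- Primitive classes are the classes of primitive harmonic forms. -/
theorem mem_primitiveCohomology (hS : K.HodgeTheory S) (t : Differential) (a b : ℕ) (x : K.Cohomology t (a + b)) :
    x ∈ K.primitiveCohomology t a b ↔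
      ∃ η : K.harmonic (a + b), (η : Ω) ∈ K.primitiveBi (a, b) ∧
        hS.harmonicClass t (a + b) η = x := by
  constructor
  · rintro ⟨⟨ω, hω, rfl⟩, hx⟩
    obtain ⟨η, hη, h⟩ : ∃ η : K.harmonic (a + b), (η : Ω) ∈ K.bideg (a, b) ∧
        hS.harmonicClass t (a + b) η = K.cohomologyClass t (a + b) ω :=
      hS.exists_harmonicClass_eq t (K.bideg_le_deg (a, b)) (K.lap_mem_bideg (a, b)) hω ω.2
    refine ⟨η, ?_, h⟩
    have h0 : (K.L ^ (n + 1 - (a + b))) (η : Ω) = 0 := by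
      have h1 := LinearMap.mem_ker.1 hx
      change K.lefschetz t _ _ _ _ (K.cohomologyClass t (a + b) ω) = 0 at h1
      rw [← h, hS.lefschetz_harmonicClass] at h1
      exact congrArg Subtype.val
        ((injective_iff_map_eq_zero _).1 (hS.harmonicClass_injective t _) _ h1)
    -- Above the middle degree the truncated exponent is zero, so `h0` says that the representative
    -- vanishes.
    by_cases hab : a + b ≤ n
    · rw [K.mem_primitiveBi hab]
      exact ⟨hη, by rwa [show n - (a + b) + 1 = n + 1 - (a + b) by omega]⟩
    · rw [show n + 1 - (a + b) = 0 by omega, pow_zero, Module.End.one_apply] at h0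
      rw [h0]; exact Submodule.zero_mem _
  · rintro ⟨η, hη, rfl⟩
    refine ⟨⟨⟨η, hS.harmonic_le_cocycles t _ η.2⟩, hη.1, rfl⟩, ?_⟩
    change K.lefschetz t _ _ _ _ (hS.harmonicClass t (a + b) η) = 0
    rw [hS.lefschetz_harmonicClass]
    have h0 : (K.L ^ (n + 1 - (a + b))) (η : Ω) = 0 := K.L_pow_primitive (by omega) hη
    simp only [h0]
    exact map_zero (hS.harmonicClass t _)

/-- The Lefschetz decomposition of cohomology. -/
theorem isInternal (hS : K.HodgeTheory S) (t : Differential) (k : ℕ) :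
    DirectSum.IsInternal
      (fun p : {p : ℕ × ℕ × ℕ // k = p.2.1 + p.2.2 + 2 * p.1} =>
        (K.primitiveCohomology t p.1.2.1 p.1.2.2).map
          (K.lefschetz t p.1.1 (p.1.2.1 + p.1.2.2) k p.2)) := by
  -- Harmonic representatives embed cohomology in `Ω`, where the Lefschetz projections separate the
  -- summands.
  let r : K.Cohomology t k →ₗ[ℂ] Ω :=
    (K.harmonic k).subtype ∘ₗ (hS.hodgeEquiv t k).symm.toLinearMap
  have hr : ∀ η, r (hS.harmonicClass t k η) = η := fun η =>
    congrArg Subtype.val ((hS.hodgeEquiv t k).symm_apply_apply η)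
  have hrinj : Function.Injective r :=
    Subtype.val_injective.comp (hS.hodgeEquiv t k).symm.injective
  have hmem : ∀ (p : {p : ℕ × ℕ × ℕ // k = p.2.1 + p.2.2 + 2 * p.1}) (x : K.Cohomology t k),
      x ∈ (K.primitiveCohomology t p.1.2.1 p.1.2.2).map
          (K.lefschetz t p.1.1 (p.1.2.1 + p.1.2.2) k p.2) →
      ∃ α ∈ K.primitiveBi p.1.2, r x = (K.L ^ p.1.1) α := by
    rintro p _ ⟨y, hy, rfl⟩
    obtain ⟨η, hη, rfl⟩ := (hS.mem_primitiveCohomology t _ _ y).1 hy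
    refine ⟨η, hη, ?_⟩
    rw [hS.lefschetz_harmonicClass, hr]
  have hproj : ∀ (p q : {p : ℕ × ℕ × ℕ // k = p.2.1 + p.2.2 + 2 * p.1}) (x : K.Cohomology t k),
      x ∈ (K.primitiveCohomology t p.1.2.1 p.1.2.2).map
          (K.lefschetz t p.1.1 (p.1.2.1 + p.1.2.2) k p.2) →
      K.lefschetzProj q.1 (r x) = if p = q then r x else 0 := by
    intro p q x hx
    obtain ⟨α, hα, h⟩ := hmem p x hx
    rw [h]
    -- The index set also contains triples with `j + a + b > n`; their summands are zero because
    -- `L^j α = 0`.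
    by_cases hp : p.1.1 + (p.1.2.1 + p.1.2.2) ≤ n
    · rw [K.lefschetzProj_L_pow q.1 hp hα]
      simp only [Prod.mk.eta, Subtype.coe_inj]
    · rw [K.L_pow_primitive (a := p.1.2.1) (b := p.1.2.2) (by omega) hα, map_zero, ite_self]
  rw [DirectSum.isInternal_submodule_iff_iSupIndep_and_iSup_eq_top]
  constructor
  · intro p
    rw [Submodule.disjoint_def]
    intro x hx hx'
    have h1 := hproj p p x hx
    rw [if_pos rfl] at h1
    have h2 : x ∈ LinearMap.ker (K.lefschetzProj p.1 ∘ₗ r) := by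
      refine (iSup₂_le (fun q hq y hy => ?_) :
        (⨆ (q) (_ : q ≠ p), (K.primitiveCohomology t q.1.2.1 q.1.2.2).map
          (K.lefschetz t q.1.1 (q.1.2.1 + q.1.2.2) k q.2)) ≤ _) hx'
      rw [LinearMap.mem_ker, LinearMap.comp_apply, hproj q p y hy, if_neg hq]
    apply hrinj
    rw [map_zero, ← h1]
    exact h2
  · rw [eq_top_iff]
    intro x _
    obtain ⟨η, rfl⟩ := hS.harmonicClass_surjective t k x
    set N := ⨆ p : {p : ℕ × ℕ × ℕ // k = p.2.1 + p.2.2 + 2 * p.1},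
      (K.primitiveCohomology t p.1.2.1 p.1.2.2).map
          (K.lefschetz t p.1.1 (p.1.2.1 + p.1.2.2) k p.2) with hN
    -- The Lefschetz components are tested for all triples; projecting to degree `k` discards those
    -- of another degree.
    suffices h : (η : Ω) ∈ (N.map r).comap (GradedAlgebra.proj C.deg k) by
      rw [Submodule.mem_comap, HermitianStructure.proj_deg_of_mem η.2.1] at h
      obtain ⟨y, hy, hyη⟩ := h
      rw [← hr η] at hyη
      exact hrinj hyη ▸ hy
    refine K.mem_of_lefschetzProj_mem fun s => ?_
    obtain ⟨⟨j, a, b⟩, hs⟩ := s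
    simp only at hs
    obtain ⟨α, hα, hs'⟩ := K.exists_lefschetzProj_eq (j, a, b) η
    simp only at hα hs'
    rw [Submodule.mem_comap, hs']
    have hdeg := K.L_pow_mem_deg_of_mem_bideg (j := j) hα.1
    by_cases hk : a + b + 2 * j = k
    · rw [HermitianStructure.proj_deg_of_mem (hk ▸ hdeg)]
      -- The Laplacian commutes with the Lefschetz projections, so `L^j α` is harmonic, and `L^j` is
      -- injective in degree `a + b`.
      have hlap : K.lap α = 0 := by
        refine K.L_pow_injOn (j := j) hs (K.lap_mem_deg (K.bideg_le_deg _ hα.1)) ?_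
        rw [← HermitianStructure.map_L_pow_of_commute K.lap_L, ← hs',
          HermitianStructure.lefschetzProj,
          HermitianStructure.map_lefschetzOp_of_commute K.lap_L K.lap_mem_bideg,
          LinearMap.mem_ker.1 η.2.2, map_zero]
      let α' : K.harmonic (a + b) := ⟨α, K.bideg_le_deg _ hα.1, hlap⟩
      refine ⟨K.lefschetz t j (a + b) k hk.symm (hS.harmonicClass t (a + b) α'), ?_, ?_⟩
      · exact (le_iSup (fun p : {p : ℕ × ℕ × ℕ // k = p.2.1 + p.2.2 + 2 * p.1} =>
          (K.primitiveCohomology t p.1.2.1 p.1.2.2).map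
            (K.lefschetz t p.1.1 (p.1.2.1 + p.1.2.2) k p.2)) ⟨(j, a, b), hk.symm⟩)
          ⟨_, (hS.mem_primitiveCohomology t a b _).2 ⟨α', hα, rfl⟩, rfl⟩
      · rw [hS.lefschetz_harmonicClass, hr]
    · rw [HermitianStructure.proj_deg_of_mem_ne hdeg hk]
      exact Submodule.zero_mem _

end HodgeTheory

/-! ### Hodge theory over the quantum homogeneous space -/

section Homogeneous

variable {G H : Type*} [Ring G] [StarRing G] [HopfAlgebra ℂ G] [StarModule ℂ G]
  [CompactQuantumGroupAlgebra G] [Ring H] [StarRing H] [HopfAlgebra ℂ H] [StarModule ℂ H]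
  [HopfStarAlgebra H] [Cosemisimple H] {X : QuantumHomogeneousSpace G H} {Ω : Type*} [Ring Ω]
  [Algebra ℂ Ω] {C : StarCalculus X.M Ω} {n : ℕ} {K : KahlerStructure C n}
  {D : CovariantCalculus C}

/-- Hodge theory for covariant Kähler structures which are positive definite and have closed
integral. -/
theorem hodgeTheory (hK : K.IsCovariant D) {h : ℝ} (hh : 0 < h) (hpos : K.IsPositiveDefinite h)
    (hcl : K.IntegralClosed h) : K.HodgeTheory (K.globalForm h 1) where
  posDef := hK.globalForm_one_posDef hh hpos
  adjoint := K.adjoint_diff hcl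
  split W hW ω hω := by
    have hS := hK.globalForm_one_posDef hh hpos
    obtain ⟨c, _, hc⟩ := D.exists_mem_coefficientSpace ω
    have := D.finiteDimensional_coefficientSpace c
    -- `W` itself may be infinite-dimensional; its intersection with a coefficient space containing
    -- `ω` is finite-dimensional and still stable under the Laplacian.
    have : FiniteDimensional ℂ (D.coefficientSpace c ⊓ W : Submodule ℂ Ω) :=
      Submodule.finiteDimensional_of_le inf_le_left
    obtain ⟨η, hη, ξ, hξ, h1, h2⟩ := exists_ker_add_range hS
      ((K.adjoint_del hcl).laplacian_self hS) (D.coefficientSpace c ⊓ W)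
      (fun x hx => ⟨(lap_equivariant hK).map_mem_coefficientSpace hx.1, hW x hx.2⟩) ⟨hc, hω⟩
    exact ⟨η, hη.2, ξ, hξ.2, h1, h2⟩

end Homogeneous

end KahlerStructure

end QKahler

end

open QKahler in
theorem mainTheorem4 {G H Ω : Type*}
    [Ring G] [StarRing G] [HopfAlgebra ℂ G] [StarModule ℂ G] [CompactQuantumGroupAlgebra G]
    [Ring H] [StarRing H] [HopfAlgebra ℂ H] [StarModule ℂ H] [HopfStarAlgebra H]
    [Cosemisimple H] [Ring Ω] [Algebra ℂ Ω]
    (X : QuantumHomogeneousSpace G H) (C : StarCalculus X.M Ω) (D : CovariantCalculus C)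
    (n : ℕ) (K : KahlerStructure C n) (hcov : K.IsCovariant D)
    (h : ℝ) (hh : 0 < h) (hpos : K.IsPositiveDefinite h) (hclosed : K.IntegralClosed h) :
    (∀ t : Differential,
      (∀ (k : ℕ) (hk : k ≤ n),
        Function.Bijective (K.lefschetz t k (n - k) (n + k) (by omega))) ∧
      (∀ k : ℕ,
        DirectSum.IsInternal
          (fun p : {p : ℕ × ℕ × ℕ // k = p.2.1 + p.2.2 + 2 * p.1} =>
            (K.primitiveCohomology t p.1.2.1 p.1.2.2).map
              (K.lefschetz t p.1.1 (p.1.2.1 + p.1.2.2) k p.2)))) ∧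
    (∀ (t : Differential) (k : ℕ),
      ∃ e : K.Cohomology .total k ≃ₗ[ℂ] K.Cohomology t k,
        ∀ a b : ℕ, a + b = k → ∀ ω ∈ K.bideg (a, b),
          ∀ (h₁ : ω ∈ C.cocycles (K.diff .total) k) (h₂ : ω ∈ C.cocycles (K.diff t) k),
            e (K.cohomologyClass .total k ⟨ω, h₁⟩) = K.cohomologyClass t k ⟨ω, h₂⟩) := by
  have hS := KahlerStructure.hodgeTheory hcov hh hpos hclosed
  refine ⟨fun t => ⟨fun k hk => hS.lefschetz_bijective t hk _, hS.isInternal t⟩, fun t k => ?_⟩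
  obtain ⟨e, he⟩ := hS.exists_equiv .total t k
  exact ⟨e, fun a b _ ω _ h₁ h₂ => he ω h₁ h₂⟩
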